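/- Consider general relativity with a minimally coupled massless canonical scalar field, with action $\int d^4x\sqrt{-g}\,[R/2-\tfrac12\partial_\mu\psi\,\partial^\mu\psi]$, and its static spherically symmetric solutions $ds^2=-A\,dt^2+H\,d\rho^2+r^2(d\theta^2+\sin^2\theta\,d\varphi^2)$, $\psi=\psi(\rho)$, where $A,H,r>0$ are functions of an arbitrary radial coordinate $\rho$. Let $\hat f=H^{-1/2}\,df/d\rho$, let $\phi=2\hat r/r$ be the sheet expansion, $\mathcal A=\hat A/(2A)$ the acceleration of the static observers and $K=1/r^2$ the Gaussian curvature of the spheres, and put $$x_2=\frac{\phi}{2\sqrt K},\qquad x_3=\frac{\mathcal A}{\sqrt K},\qquad y_1=\frac{\hat\psi}{\sqrt{2K}},\qquad f'=\frac{\hat f}{\sqrt K}.$$ **Reduction.** The field equations imply $y_1^2=x_2^2+2x_2x_3-1$ and $$x_2'=1-x_2(x_2+x_3),\qquad x_3'=-x_3(x_2+x_3)\qquad\text{on the region } x_2^2+2x_2x_3\ge 1 .$$ Through each point of the region there is a maximal solution that stays in the region. Conversely, each maximal solution $\xi\mapsto(x_2,x_3)$ in the region describes a metric $-A(r)\,dt^2+dr^2/B(r)+r^2d\Omega^2$,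 where the area radius satisfies $r'=x_2r$ and takes each value in its range once, $B=x_2^2$ and $d\ln A/d\ln r=2x_3/x_2$; with a suitable $\psi(r)$ every such metric solves the field equations. **Finite fixed points.** The fixed points in the region are exactly $P_M=(1,0)$ and $\bar P_M=(-1,0)$. The linearization has the eigenvalues $-2,-1$ at $P_M$ and $2,1$ at $\bar P_M$; $P_M$ is a sink (asymptotically stable) and $\bar P_M$ is a source (asymptotically stable for the reversed flow). The metric described by either fixed point is Minkowski: $B=1$, $A$ constant, $0<r<\infty$. **Points at infinity.** The Poincaré map $X_i=x_i/\sqrt{1+x_2^2+x_3^2}$ is a bijection from the region onto the part with $X_2^2+X_3^2<1$ of $\{2X_2^2+2X_2X_3+X_3^2\ge1,\ X_2^2+X_3^2\le 1\}$, and with $\tilde f=\sqrt{1-X_2^2-X_3^2}\,f'$ it carries the system to $$\tilde X_2=[1-X_2(2X_2+X_3)](1-X_2^2-X_3^2),\qquad \tilde X_3=-X_3(2X_2+X_3)(1-X_2^2-X_3^2).$$ The points at infinity, $X_2^2+X_3^2=1$, are all critical. They form two disjoint arcs of the unit circle: the right arc $X_2\ge 0$, $X_3\ge-1/\sqrt5$,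 with end points $P_H=(0,1)$ and $P_S=(2/\sqrt5,-1/\sqrt5)$, and the opposite, left arc, with end points $\bar P_H=-P_H$ and $\bar P_S=-P_S$. These four end points are exactly the points at infinity with $2X_2^2+2X_2X_3+X_3^2=1$. For the flow on the compactified region, $P_H$ and $P_S$ are (Lyapunov) unstable and $\bar P_H$ and $\bar P_S$ are (Lyapunov) stable. **Solutions.** Every maximal solution in the region is one of the following: the constant solution $P_M$ or $\bar P_M$; a solution with $x_2>0$ on an interval $(a,\infty)$, $a\in\mathbb R$, that comes from a point $Q$ of the right arc as $\xi\to a$ and tends to $P_M$ as $\xi\to\infty$; or a solution with $x_2<0$ on an interval $(-\infty,b)$, $b\in\mathbb R$, that comes from $\bar P_M$ as $\xi\to-\infty$ and tends to a point $Q$ of the left arc as $\xi\to b$. For each point $Q$ of the two arcs there is exactly one such orbit. Moreover: * (Horizons.) Exactly one orbit joins $P_H$ to $P_M$, and exactly one joins $\bar P_M$ to $\bar P_H$. On each of them the scalar field is constant ($y_1=0$) and the metric is the exterior Schwarzschild metric of some mass $M>0$: $B=1-2M/r$ and $A=c\,(1-2M/r)$ with a constant $c>0$, for $r>2M$. It is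 asymptotically flat, and $Q$ corresponds to the horizon $r=2M>0$, where $A$ and $B$ tend to $0$ while the Kretschmann scalar stays bounded. * (Singularities.) Every other non-constant solution, that is, every one with $Q\neq P_H,\bar P_H$, is a naked singularity: $r$ runs through $(0,\infty)$; $A,B>0$ throughout, so there is no horizon; the Kretschmann scalar tends to $+\infty$ as $r\to0$; $\int_0^R dr/\sqrt{AB}<\infty$ for every $R>0$, so that radial light rays from $r=0$ reach every radius in finite static time; and the metric is asymptotically flat, i.e. $A=c+O(1/r)$ for a constant $c>0$ and $B=1+O(1/r)$ as $r\to\infty$. If $Q=(\bar X_2,\bar X_3)$, then $A/r^{\beta}$ and $B/r^{\alpha}$ have positive finite limits as $r\to0$, where $\beta=2\bar X_3/\bar X_2$ and $\alpha=-2(1+\bar X_3/\bar X_2)$. * For $Q=P_S$ or $\bar P_S$ one has $y_1=0$ and the metric is the Schwarzschild metric of some negative mass on $0<r<\infty$ (so $A$ and $B$ behave like $1/r$ as $r\to0$). For all remaining points $Q$ of the two arcs, $y_1^2>0$ along the orbit. -/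

import Mathlib

open Real Set Filter Topology

noncomputable section

namespace StaticScalar

/-! ### Curvature of a metric in a four-dimensional coordinate chart -/

/-- Partial derivative of `f` in the direction of the `i`-th coordinate. -/
def pderiv (i : Fin 4) (f : (Fin 4 → ℝ) → ℝ) (p : Fin 4 → ℝ) : ℝ :=
  deriv (fun s => f (Function.update p i s)) (p i)

/-- A field of symmetric bilinear forms on a chart, given by its matrix of components. -/
abbrev MetricField := (Fin 4 → ℝ) → Matrix (Fin 4) (Fin 4) ℝ

/-- Christoffel symbols `Γ^i_{jk}` of the Levi-Civita connection. -/
def christoffel (g : MetricField) (i j k : Fin 4) (p : Fin 4 → ℝ) : ℝ :=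
  (1 / 2) * ∑ l, (g p)⁻¹ i l *
    (pderiv j (fun q => g q l k) p + pderiv k (fun q => g q l j) p - pderiv l (fun q => g q j k) p)

/-- Riemann tensor `R^i_{jkl} = ∂_k Γ^i_{lj} - ∂_l Γ^i_{kj} + Γ^i_{km} Γ^m_{lj} - Γ^i_{lm} Γ^m_{kj}`. -/
def riemann (g : MetricField) (i j k l : Fin 4) (p : Fin 4 → ℝ) : ℝ :=
  pderiv k (christoffel g i l j) p - pderiv l (christoffel g i k j) p
    + ∑ m, (christoffel g i k m p * christoffel g m l j p
          - christoffel g i l m p * christoffel g m k j p)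

/-- Ricci tensor `R_{jl} = R^i_{jil}`. -/
def ricci (g : MetricField) (j l : Fin 4) (p : Fin 4 → ℝ) : ℝ :=
  ∑ i, riemann g i j i l p

/-- Scalar curvature `R = g^{jl} R_{jl}`. -/
def scalarCurvature (g : MetricField) (p : Fin 4 → ℝ) : ℝ :=
  ∑ j, ∑ l, (g p)⁻¹ j l * ricci g j l p

/-- Einstein tensor `G_{ab} = R_{ab} - R g_{ab} / 2`. -/
def einstein (g : MetricField) (a b : Fin 4) (p : Fin 4 → ℝ) : ℝ :=
  ricci g a b p - (1 / 2) * scalarCurvature g p * g p a b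

/-- Riemann tensor with two indices up, `R^{ab}_{cd} = g^{bm} R^a_{mcd}`. -/
def riemannUp (g : MetricField) (a b c d : Fin 4) (p : Fin 4 → ℝ) : ℝ :=
  ∑ m, (g p)⁻¹ b m * riemann g a m c d p

/-- Kretschmann scalar `R_{abcd} R^{abcd} = R^{ab}_{cd} R^{cd}_{ab}`. -/
def kretschmann (g : MetricField) (p : Fin 4 → ℝ) : ℝ :=
  ∑ a, ∑ b, ∑ c, ∑ d, riemannUp g a b c d p * riemannUp g c d a b p

/-- Energy-momentum tensor of a massless canonical scalar field,
`T_{ab} = ∂_a ψ ∂_b ψ - g_{ab} (∇ψ)² / 2`. -/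
def scalarStress (g : MetricField) (f : (Fin 4 → ℝ) → ℝ) (a b : Fin 4) (p : Fin 4 → ℝ) : ℝ :=
  pderiv a f p * pderiv b f p
    - (1 / 2) * g p a b * ∑ c, ∑ d, (g p)⁻¹ c d * (pderiv c f p * pderiv d f p)

/-- Wave operator `g^{ab} (∂_a ∂_b f - Γ^c_{ab} ∂_c f)`. -/
def waveOperator (g : MetricField) (f : (Fin 4 → ℝ) → ℝ) (p : Fin 4 → ℝ) : ℝ :=
  ∑ a, ∑ b, (g p)⁻¹ a b *
    (pderiv a (pderiv b f) p - ∑ c, christoffel g c a b p * pderiv c f p)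

/-! ### Static spherically symmetric solutions with a massless canonical scalar field -/

/-- The metric `-A(ρ) dt² + H(ρ) dρ² + r(ρ)² (dθ² + sin² θ dφ²)` in the coordinates
`(t, ρ, θ, φ)`, for an arbitrary radial coordinate `ρ`. -/
def staticMetric (A H r : ℝ → ℝ) : MetricField := fun p =>
  Matrix.diagonal ![-A (p 1), H (p 1), r (p 1) ^ 2, r (p 1) ^ 2 * sin (p 2) ^ 2]

/-- `(A, H, r, ψ)` is, for `ρ` in the open interval `I`, a static spherically symmetric solution of
general relativity minimally coupled to a massless canonical scalar field `ψ`
(action `∫ √(-g) (R / 2 - (∂ψ)² / 2)`). -/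
structure IsScalarSpacetime (I : Set ℝ) (A H r ψ : ℝ → ℝ) : Prop where
  isOpen : IsOpen I
  ordConnected : I.OrdConnected
  nonempty : I.Nonempty
  contDiff_A : ContDiffOn ℝ 2 A I
  contDiff_H : ContDiffOn ℝ 2 H I
  contDiff_r : ContDiffOn ℝ 2 r I
  contDiff_ψ : ContDiffOn ℝ 2 ψ I
  pos : ∀ ρ ∈ I, 0 < A ρ ∧ 0 < H ρ ∧ 0 < r ρ
  einstein_eq : ∀ p : Fin 4 → ℝ, p 1 ∈ I → sin (p 2) ≠ 0 → ∀ a b,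
    einstein (staticMetric A H r) a b p = scalarStress (staticMetric A H r) (fun q => ψ (q 1)) a b p
  wave_eq : ∀ p : Fin 4 → ℝ, p 1 ∈ I → sin (p 2) ≠ 0 →
    waveOperator (staticMetric A H r) (fun q => ψ (q 1)) p = 0

/-- Derivative along the unit radial vector `n = H^{-1/2} ∂_ρ`. -/
def hat (H f : ℝ → ℝ) (ρ : ℝ) : ℝ := deriv f ρ / √(H ρ)

/-- Sheet expansion: the divergence of `n` along the spheres of radius `r`. -/
def sheetExpansion (H r : ℝ → ℝ) (ρ : ℝ) : ℝ := 2 * hat H r ρ / r ρ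

/-- Acceleration `n^a u^b ∇_b u_a` of the static observers `u = A^{-1/2} ∂_t`. -/
def acceleration (A H : ℝ → ℝ) (ρ : ℝ) : ℝ := hat H A ρ / (2 * A ρ)

/-- Gaussian curvature of the spheres of radius `r`. -/
def gaussCurvature (r : ℝ → ℝ) (ρ : ℝ) : ℝ := 1 / r ρ ^ 2

/-- `x₂ = φ / (2 √K)`, with `φ` the sheet expansion. -/
def x₂ (H r : ℝ → ℝ) (ρ : ℝ) : ℝ := sheetExpansion H r ρ / (2 * √(gaussCurvature r ρ))

/-- `x₃ = 𝒜 / √K`, with `𝒜` the acceleration. -/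
def x₃ (A H r : ℝ → ℝ) (ρ : ℝ) : ℝ := acceleration A H ρ / √(gaussCurvature r ρ)

/-- `y₁ = Ψ / √(2 K)`, with `Ψ` the derivative of the scalar field along `n`. -/
def y₁ (H r ψ : ℝ → ℝ) (ρ : ℝ) : ℝ := hat H ψ ρ / √(2 * gaussCurvature r ρ)

/-- The normalized radial derivative `f' = f̂ / √K`. -/
def normDeriv (H r f : ℝ → ℝ) (ρ : ℝ) : ℝ := hat H f ρ / √(gaussCurvature r ρ)

/-! ### The reduced dynamical system -/

/-- The vector field of `x₂' = 1 - x₂ (x₂ + x₃)`, `x₃' = -x₃ (x₂ + x₃)`. -/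
def field (x : ℝ × ℝ) : ℝ × ℝ := (1 - x.1 * (x.1 + x.2), -x.2 * (x.1 + x.2))

/-- The phase space `x₂² + 2 x₂ x₃ ≥ 1`. -/
def phaseSpace : Set (ℝ × ℝ) := {x | 1 ≤ x.1 ^ 2 + 2 * x.1 * x.2}

/-- `γ` solves the reduced system in the phase space on the open interval `J`. -/
structure IsSolution (γ : ℝ → ℝ × ℝ) (J : Set ℝ) : Prop where
  isOpen : IsOpen J
  ordConnected : J.OrdConnected
  nonempty : J.Nonempty
  hasDerivAt : ∀ ξ ∈ J, HasDerivAt γ (field (γ ξ)) ξ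
  mem : ∀ ξ ∈ J, γ ξ ∈ phaseSpace

/-- A solution that cannot be continued beyond the interval `J`. -/
def IsMaximalSolution (γ : ℝ → ℝ × ℝ) (J : Set ℝ) : Prop :=
  IsSolution γ J ∧ ∀ γ' J', IsSolution γ' J' → J ⊆ J' → EqOn γ' γ J → J' = J

/-- The fixed point `P_M`. -/
def PM : ℝ × ℝ := (1, 0)

/-- The fixed point `P̄_M`. -/
def PMbar : ℝ × ℝ := (-1, 0)

/-- Lyapunov stability of `P` for the flow of `v` on `S`, in forward direction. -/
def IsStable (v : ℝ × ℝ → ℝ × ℝ) (S : Set (ℝ × ℝ)) (P : ℝ × ℝ) : Prop :=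
  ∀ ε > 0, ∃ δ > 0, ∀ (T : ℝ) (γ : ℝ → ℝ × ℝ),
    (∀ τ ∈ Icc 0 T, HasDerivWithinAt γ (v (γ τ)) (Icc 0 T) τ ∧ γ τ ∈ S) →
    dist (γ 0) P < δ → ∀ τ ∈ Icc 0 T, dist (γ τ) P < ε

/-- Asymptotic stability: Lyapunov stability, and all points of `S` near `P` flow to `P`. -/
def IsAsymptoticallyStable (v : ℝ × ℝ → ℝ × ℝ) (S : Set (ℝ × ℝ)) (P : ℝ × ℝ) : Prop :=
  IsStable v S P ∧ ∃ δ > 0, ∀ x ∈ S, dist x P < δ → ∃ γ : ℝ → ℝ × ℝ, γ 0 = x ∧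
    (∀ τ ∈ Ici (0 : ℝ), HasDerivWithinAt γ (v (γ τ)) (Ici 0) τ ∧ γ τ ∈ S) ∧
    Tendsto γ atTop (𝓝 P)

/-! ### Poincaré variables -/

/-- `X = x / √(1 + x₂² + x₃²)`. -/
def toPoincare (x : ℝ × ℝ) : ℝ × ℝ :=
  (x.1 / √(1 + x.1 ^ 2 + x.2 ^ 2), x.2 / √(1 + x.1 ^ 2 + x.2 ^ 2))

/-- The vector field of the system in Poincaré variables. -/
def poincareField (X : ℝ × ℝ) : ℝ × ℝ :=
  ((1 - X.1 * (2 * X.1 + X.2)) * (1 - X.1 ^ 2 - X.2 ^ 2),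
    -X.2 * (2 * X.1 + X.2) * (1 - X.1 ^ 2 - X.2 ^ 2))

/-- The compactified phase space. -/
def poincareSpace : Set (ℝ × ℝ) :=
  {X | 1 ≤ 2 * X.1 ^ 2 + 2 * X.1 * X.2 + X.2 ^ 2 ∧ X.1 ^ 2 + X.2 ^ 2 ≤ 1}

/-- The points at infinity `X₂² + X₃² = 1` of the compactified phase space. -/
def atInfinity : Set (ℝ × ℝ) := {X | X ∈ poincareSpace ∧ X.1 ^ 2 + X.2 ^ 2 = 1}

/-- The arc of the unit circle from `P_S` to `P_H`. -/
def rightArc : Set (ℝ × ℝ) := {X | X.1 ^ 2 + X.2 ^ 2 = 1 ∧ 0 ≤ X.1 ∧ -(1 / √5) ≤ X.2}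

/-- The opposite arc, from `P̄_S` to `P̄_H`. -/
def leftArc : Set (ℝ × ℝ) := {X | -X ∈ rightArc}

/-- The point at infinity `P_H`. -/
def PH : ℝ × ℝ := (0, 1)

/-- The point at infinity `P̄_H`. -/
def PHbar : ℝ × ℝ := (0, -1)

/-- The point at infinity `P_S`. -/
def PS : ℝ × ℝ := (2 / √5, -(1 / √5))

/-- The point at infinity `P̄_S`. -/
def PSbar : ℝ × ℝ := (-(2 / √5), 1 / √5)

/-- The solution `γ` on `J` comes from the point at infinity `Q` and goes to `P_M`. -/
def GoesToPM (γ : ℝ → ℝ × ℝ) (J : Set ℝ) (Q : ℝ × ℝ) : Prop :=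
  (∀ ξ ∈ J, 0 < (γ ξ).1) ∧ ∃ a : ℝ, J = Ioi a ∧
    Tendsto (fun ξ => toPoincare (γ ξ)) (𝓝[>] a) (𝓝 Q) ∧ Tendsto γ atTop (𝓝 PM)

/-- The solution `γ` on `J` comes from `P̄_M` and goes to the point at infinity `Q`. -/
def ComesFromPMbar (γ : ℝ → ℝ × ℝ) (J : Set ℝ) (Q : ℝ × ℝ) : Prop :=
  (∀ ξ ∈ J, (γ ξ).1 < 0) ∧ ∃ b : ℝ, J = Iio b ∧
    Tendsto γ atBot (𝓝 PMbar) ∧ Tendsto (fun ξ => toPoincare (γ ξ)) (𝓝[<] b) (𝓝 Q)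

/-! ### The spacetime of a solution -/

/-- The solution `γ` on `J` describes the metric
`-A(r) dt² + dr² / B(r) + r² (dθ² + sin² θ dφ²)`, `r ∈ I`: the area radius satisfies `r' = x₂ r`
and runs through `I` exactly once, `B = x₂²`, and `d ln A / d ln r = 2 x₃ / x₂`. -/
def Describes (γ : ℝ → ℝ × ℝ) (J I : Set ℝ) (A B : ℝ → ℝ) : Prop :=
  ∃ r : ℝ → ℝ, BijOn r J I ∧ ∀ ξ ∈ J, 0 < r ξ ∧ HasDerivAt r ((γ ξ).1 * r ξ) ξ ∧
    B (r ξ) = (γ ξ).1 ^ 2 ∧ 0 < A (r ξ) ∧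
    HasDerivAt A (2 * (γ ξ).2 / (γ ξ).1 * (A (r ξ) / r ξ)) (r ξ)

/-- The metric `-A(r) dt² + dr² / B(r) + r² (dθ² + sin² θ dφ²)` in the coordinates
`(t, r, θ, φ)`. -/
def schwarzschildForm (A B : ℝ → ℝ) : MetricField := staticMetric A (fun r => 1 / B r) id

/-- Minkowski spacetime, up to a constant rescaling of time. -/
def IsMinkowski (I : Set ℝ) (A B : ℝ → ℝ) : Prop :=
  I = Ioi 0 ∧ ∃ c > 0, ∀ r ∈ I, A r = c ∧ B r = 1

/-- The static (exterior) Schwarzschild spacetime of mass `M`, up to a constant rescaling of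
time. -/
def IsSchwarzschild (M : ℝ) (I : Set ℝ) (A B : ℝ → ℝ) : Prop :=
  I = {r | 0 < r ∧ 0 < 1 - 2 * M / r} ∧
    ∃ c > 0, ∀ r ∈ I, A r = c * (1 - 2 * M / r) ∧ B r = 1 - 2 * M / r

/-- The metric tends to the Minkowski metric for `r → ∞`, up to a constant rescaling of time and
terms of order `1 / r`. -/
def IsAsymptoticallyFlat (A B : ℝ → ℝ) : Prop :=
  (∃ c > 0, (fun r => A r - c) =O[atTop] fun r => 1 / r) ∧
    (fun r => B r - 1) =O[atTop] fun r => 1 / r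

/-- The region `r > r_h` outside a horizon: `A` and `B` are positive and vanish in the limit
`r → r_h > 0`, and the curvature stays bounded. -/
def IsHorizonExterior (I : Set ℝ) (A B : ℝ → ℝ) : Prop :=
  ∃ rh > 0, I = Ioi rh ∧ (∀ r ∈ I, 0 < A r ∧ 0 < B r) ∧
    Tendsto A (𝓝[>] rh) (𝓝 0) ∧ Tendsto B (𝓝[>] rh) (𝓝 0) ∧
    ∃ C, ∀ p : Fin 4 → ℝ, p 1 ∈ I → sin (p 2) ≠ 0 → |kretschmann (schwarzschildForm A B) p| ≤ C

/-- A naked singularity: the static region extends without horizon from `r = 0` to an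
asymptotically flat end, the curvature diverges at `r = 0`, and light rays from `r = 0` reach every
radius within finite static time `∫ dr / √(A B)`. -/
structure IsNakedSingularity (I : Set ℝ) (A B : ℝ → ℝ) : Prop where
  range : I = Ioi 0
  no_horizon : ∀ r > 0, 0 < A r ∧ 0 < B r
  singular : ∀ t θ φ : ℝ, sin θ ≠ 0 →
    Tendsto (fun r => kretschmann (schwarzschildForm A B) ![t, r, θ, φ]) (𝓝[>] 0) atTop
  flat : IsAsymptoticallyFlat A B
  visible : ∀ R > 0, MeasureTheory.IntegrableOn (fun r => 1 / √(A r * B r)) (Ioc 0 R)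

/-- Near `r = 0`, `A ≃ r^β` and `B ≃ r^α`, up to positive constant factors. -/
def HasPowerLaw (A B : ℝ → ℝ) (α β : ℝ) : Prop :=
  (∃ a > 0, Tendsto (fun r => A r / r ^ β) (𝓝[>] 0) (𝓝 a)) ∧
    ∃ b > 0, Tendsto (fun r => B r / r ^ α) (𝓝[>] 0) (𝓝 b)

end StaticScalar

end

/-!
Along a solution, `w = x₂ + x₃` satisfies `w' = 1 - w²`, and `w² = x₃² + x₂² + 2 x₂ x₃ ≥ 1`. Hence
every non-constant solution with `x₂ > 0` has `w = coth ξ` after a translation of `ξ`, so that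
`x₂ = (cosh ξ - c) / sinh ξ` and `x₃ = c / sinh ξ` on `ξ > 0`, with a constant `c`. The constraint
`x₂² + 2 x₂ x₃ = 1 + (1 - c²) / sinh² ξ` confines `c` to `[-1, 1]`, and `c` is also the parameter of
the point at infinity reached as `ξ → 0`. The symmetry `x ↦ -x`, `ξ ↦ -ξ` yields the solutions with
`x₂ < 0`.

In terms of `T = tanh (ξ / 2) ∈ (0, 1)` the area radius is `r = k T^(1 - c) / (1 - T²)`, and
`A = A₀ T^(2c)`, `B = ((1 + T² - c (1 - T²)) / (2 T))²`. Hence `c = 1` is the Schwarzschild metric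
of mass `k / 2`, `c = -1` that of mass `-k / 2`, and for `c < 1` the radius runs through `(0, ∞)`
while `B → ∞` as `T → 0`, which makes the curvature diverge there.
-/

noncomputable section

namespace StaticScalar

/-! ### Curvature of a static spherically symmetric metric -/

section Curvature

variable {A H r : ℝ → ℝ} {p : Fin 4 → ℝ}

theorem pderiv_congr {i : Fin 4} {f g : (Fin 4 → ℝ) → ℝ} (h : f =ᶠ[𝓝 p] g) :
    pderiv i f p = pderiv i g p := by
  have hupdate : Tendsto (fun s => Function.update p i s) (𝓝 (p i)) (𝓝 p) := by
    simpa only [id_eq, Function.update_eq_self] using (continuous_const.update i continuous_id :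
      Continuous fun s => Function.update p i s).tendsto (p i)
  exact Filter.EventuallyEq.deriv_eq (hupdate.eventually h)

theorem pderiv_comp_radius (i : Fin 4) (f : ℝ → ℝ) (p : Fin 4 → ℝ) :
    pderiv i (fun q => f (q 1)) p = if i = 1 then deriv f (p 1) else 0 := by
  fin_cases i <;> simp [pderiv, Function.update]

/-- The diagonal of `staticMetric A H r`. -/
def metricDiag (A H r : ℝ → ℝ) (p : Fin 4 → ℝ) : Fin 4 → ℝ :=
  ![-A (p 1), H (p 1), r (p 1) ^ 2, r (p 1) ^ 2 * sin (p 2) ^ 2]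

theorem staticMetric_apply (A H r : ℝ → ℝ) (p : Fin 4 → ℝ) (a b : Fin 4) :
    staticMetric A H r p a b = if a = b then metricDiag A H r p a else 0 :=
  Matrix.diagonal_apply ..

/-- Pointwise conditions under which the curvature of `staticMetric A H r` is given by the
classical formulas. -/
structure RegularAt (A H r : ℝ → ℝ) (p : Fin 4 → ℝ) : Prop where
  contDiffAt_A : ContDiffAt ℝ 2 A (p 1)
  contDiffAt_H : ContDiffAt ℝ 2 H (p 1)
  contDiffAt_r : ContDiffAt ℝ 2 r (p 1)
  pos_A : 0 < A (p 1)
  pos_H : 0 < H (p 1)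
  pos_r : 0 < r (p 1)
  sin_ne_zero : sin (p 2) ≠ 0

theorem hasDerivAt_of_contDiffAt_two {f : ℝ → ℝ} {x : ℝ} (h : ContDiffAt ℝ 2 f x) :
    HasDerivAt f (deriv f x) x :=
  (h.differentiableAt (by norm_num)).hasDerivAt

theorem hasDerivAt_deriv_of_contDiffAt_two {f : ℝ → ℝ} {x : ℝ} (h : ContDiffAt ℝ 2 f x) :
    HasDerivAt (deriv f) (deriv (deriv f) x) x :=
  ((ContDiffAt.derivWithin (m := 1) h (by norm_num)).differentiableAt (by norm_num)).hasDerivAt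

namespace RegularAt

theorem eventually (h : RegularAt A H r p) : ∀ᶠ q in 𝓝 p, RegularAt A H r q := by
  have radius : Tendsto (fun q : Fin 4 → ℝ => q 1) (𝓝 p) (𝓝 (p 1)) := (continuous_apply 1).tendsto p
  have angle : Tendsto (fun q : Fin 4 → ℝ => q 2) (𝓝 p) (𝓝 (p 2)) := (continuous_apply 2).tendsto p
  filter_upwards [radius.eventually (h.contDiffAt_A.eventually (by simp)),
    radius.eventually (h.contDiffAt_H.eventually (by simp)),
    radius.eventually (h.contDiffAt_r.eventually (by simp)),
    radius.eventually (h.contDiffAt_A.continuousAt.eventually (lt_mem_nhds h.pos_A)),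
    radius.eventually (h.contDiffAt_H.continuousAt.eventually (lt_mem_nhds h.pos_H)),
    radius.eventually (h.contDiffAt_r.continuousAt.eventually (lt_mem_nhds h.pos_r)),
    angle.eventually (continuous_sin.continuousAt.eventually (isOpen_ne.mem_nhds h.sin_ne_zero))]
    with q cA cH cr pA pH pr hs
  exact ⟨cA, cH, cr, pA, pH, pr, hs⟩

theorem metricDiag_ne_zero (h : RegularAt A H r p) (a : Fin 4) : metricDiag A H r p a ≠ 0 := by
  have := h.pos_A.ne'
  have := h.pos_H.ne'
  have := h.pos_r.ne'
  have := h.sin_ne_zero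
  fin_cases a <;> simp [metricDiag, *]

theorem inv_apply (h : RegularAt A H r p) (a b : Fin 4) :
    (staticMetric A H r p)⁻¹ a b = if a = b then (metricDiag A H r p a)⁻¹ else 0 := by
  have hinv : (staticMetric A H r p)⁻¹ = Matrix.diagonal fun a => (metricDiag A H r p a)⁻¹ := by
    apply Matrix.inv_eq_right_inv
    rw [staticMetric, ← metricDiag, Matrix.diagonal_mul_diagonal, ← Matrix.diagonal_one]
    exact congrArg _ (funext fun a => mul_inv_cancel₀ (h.metricDiag_ne_zero a))
  rw [hinv, Matrix.diagonal_apply]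

end RegularAt

/-- The partial derivatives of the diagonal of `staticMetric A H r`. -/
def metricDiagDeriv (A H r : ℝ → ℝ) (p : Fin 4 → ℝ) : Fin 4 → Fin 4 → ℝ :=
  ![0,
    ![-deriv A (p 1), deriv H (p 1), 2 * r (p 1) * deriv r (p 1),
      2 * r (p 1) * deriv r (p 1) * sin (p 2) ^ 2],
    ![0, 0, 0, 2 * r (p 1) ^ 2 * sin (p 2) * cos (p 2)],
    0]

theorem pderiv_metricDiag (hr : DifferentiableAt ℝ r (p 1)) (i a : Fin 4) :
    pderiv i (fun q => metricDiag A H r q a) p = metricDiagDeriv A H r p i a := by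
  have hr_sq : deriv (fun ρ => r ρ ^ 2) (p 1) = 2 * r (p 1) * deriv r (p 1) := by
    simpa using (hr.hasDerivAt.fun_pow 2).deriv
  have hsin_sq : deriv (fun θ => sin θ ^ 2) (p 2) = 2 * sin (p 2) * cos (p 2) := by
    simp
  fin_cases i <;> fin_cases a <;>
    simp [pderiv, metricDiag, metricDiagDeriv, Function.update, hr_sq, hsin_sq]
  ring

theorem pderiv_staticMetric (hr : DifferentiableAt ℝ r (p 1)) (i a b : Fin 4) :
    pderiv i (fun q => staticMetric A H r q a b) p =
      if a = b then metricDiagDeriv A H r p i a else 0 := by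
  simp only [staticMetric_apply]
  split_ifs
  · exact pderiv_metricDiag hr i a
  · simp [pderiv]

/-- The matrices `(Γ_k)^i_j = Γ^i_{kj}` of the Levi-Civita connection of a static spherically
symmetric metric, in terms of the values of the Christoffel symbols that do not vanish. -/
def connectionMatrix (a b h l w u v z : ℝ) : Fin 4 → Matrix (Fin 4) (Fin 4) ℝ
  | 0 => !![0, a, 0, 0; b, 0, 0, 0; 0, 0, 0, 0; 0, 0, 0, 0]
  | 1 => !![a, 0, 0, 0; 0, h, 0, 0; 0, 0, l, 0; 0, 0, 0, l]
  | 2 => !![0, 0, 0, 0; 0, 0, w, 0; 0, l, 0, 0; 0, 0, 0, z]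
  | 3 => !![0, 0, 0, 0; 0, 0, 0, u; 0, 0, 0, v; 0, l, z, 0]

theorem hasDerivAt_connectionMatrix {a b h l w u v z : ℝ → ℝ} {a' b' h' l' w' u' v' z' x : ℝ}
    (ha : HasDerivAt a a' x) (hb : HasDerivAt b b' x) (hh : HasDerivAt h h' x)
    (hl : HasDerivAt l l' x) (hw : HasDerivAt w w' x) (hu : HasDerivAt u u' x)
    (hv : HasDerivAt v v' x) (hz : HasDerivAt z z' x) (k i j : Fin 4) :
    HasDerivAt (fun x => connectionMatrix (a x) (b x) (h x) (l x) (w x) (u x) (v x) (z x) k i j)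
      (connectionMatrix a' b' h' l' w' u' v' z' k i j) x := by
  have h_zero := hasDerivAt_const x (0 : ℝ)
  fin_cases k <;> fin_cases i <;> fin_cases j <;> assumption

/-- The connection matrices of `staticMetric A H r` at radius `ρ` and polar angle `θ`. -/
def connection (A H r : ℝ → ℝ) (ρ θ : ℝ) : Fin 4 → Matrix (Fin 4) (Fin 4) ℝ :=
  connectionMatrix (deriv A ρ / (2 * A ρ)) (deriv A ρ / (2 * H ρ)) (deriv H ρ / (2 * H ρ))
    (deriv r ρ / r ρ) (-(r ρ * deriv r ρ) / H ρ) (-(r ρ * deriv r ρ) / H ρ * sin θ ^ 2)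
    (-(sin θ * cos θ)) (cos θ / sin θ)

theorem christoffel_staticMetric (h : RegularAt A H r p) (i k j : Fin 4) :
    christoffel (staticMetric A H r) i k j p = connection A H r (p 1) (p 2) k i j := by
  have hA := h.pos_A.ne'
  have hH := h.pos_H.ne'
  have hr := h.pos_r.ne'
  have hs := h.sin_ne_zero
  have hdiag : christoffel (staticMetric A H r) i k j p = (metricDiag A H r p i)⁻¹ / 2 *
      ((if i = j then metricDiagDeriv A H r p k i else 0)
        + (if i = k then metricDiagDeriv A H r p j i else 0)
        - if k = j then metricDiagDeriv A H r p i k else 0) := by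
    simp only [christoffel, h.inv_apply, pderiv_staticMetric (hasDerivAt_of_contDiffAt_two
      h.contDiffAt_r).differentiableAt, ite_mul, zero_mul, Finset.sum_ite_eq, Finset.mem_univ,
      if_true]
    ring
  rw [hdiag]
  fin_cases k <;> fin_cases i <;> fin_cases j <;>
    simp [connection, connectionMatrix, metricDiag, metricDiagDeriv] <;> field_simp

/-- The radial derivatives `∂_ρ Γ_k` of the connection matrices. -/
def connectionRadialDeriv (A H r : ℝ → ℝ) (ρ θ : ℝ) : Fin 4 → Matrix (Fin 4) (Fin 4) ℝ :=
  let w' := (-(deriv r ρ ^ 2 + r ρ * deriv (deriv r) ρ) * H ρ + r ρ * deriv r ρ * deriv H ρ)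
    / H ρ ^ 2
  connectionMatrix ((deriv (deriv A) ρ * A ρ - deriv A ρ ^ 2) / (2 * A ρ ^ 2))
    ((deriv (deriv A) ρ * H ρ - deriv A ρ * deriv H ρ) / (2 * H ρ ^ 2))
    (deriv (fun ρ => deriv H ρ / (2 * H ρ)) ρ)
    ((deriv (deriv r) ρ * r ρ - deriv r ρ ^ 2) / r ρ ^ 2) w' (w' * sin θ ^ 2) 0 0

theorem hasDerivAt_connection_radius (h : RegularAt A H r p) (k i j : Fin 4) :
    HasDerivAt (fun ρ => connection A H r ρ (p 2) k i j)
      (connectionRadialDeriv A H r (p 1) (p 2) k i j) (p 1) := by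
  have hA := h.pos_A.ne'
  have hH := h.pos_H.ne'
  have hr := h.pos_r.ne'
  have dA := hasDerivAt_of_contDiffAt_two h.contDiffAt_A
  have dH := hasDerivAt_of_contDiffAt_two h.contDiffAt_H
  have dr := hasDerivAt_of_contDiffAt_two h.contDiffAt_r
  have dA' := hasDerivAt_deriv_of_contDiffAt_two h.contDiffAt_A
  have dH' := hasDerivAt_deriv_of_contDiffAt_two h.contDiffAt_H
  have dr' := hasDerivAt_deriv_of_contDiffAt_two h.contDiffAt_r
  have hwarp := ((dr.fun_mul dr').fun_neg.fun_div dH hH).congr_deriv (g' :=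
    (-(deriv r (p 1) ^ 2 + r (p 1) * deriv (deriv r) (p 1)) * H (p 1)
      + r (p 1) * deriv r (p 1) * deriv H (p 1)) / H (p 1) ^ 2) (by ring)
  apply hasDerivAt_connectionMatrix _ _ _ _ hwarp (hwarp.mul_const _) (hasDerivAt_const _ _)
    (hasDerivAt_const _ _)
  · exact (dA'.fun_div (dA.const_mul 2) (by simpa using hA)).congr_deriv (by field_simp)
  · exact (dA'.fun_div (dH.const_mul 2) (by simpa using hH)).congr_deriv (by field_simp)
  · exact (dH'.fun_div (dH.const_mul 2) (by simpa using hH)).differentiableAt.hasDerivAt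
  · exact (dr'.fun_div dr hr).congr_deriv (by ring)

/-- The angular derivatives `∂_θ Γ_k` of the connection matrices. -/
def connectionAngularDeriv (H r : ℝ → ℝ) (ρ θ : ℝ) : Fin 4 → Matrix (Fin 4) (Fin 4) ℝ :=
  connectionMatrix 0 0 0 0 0 (-(r ρ * deriv r ρ) / H ρ * (2 * sin θ * cos θ))
    (sin θ ^ 2 - cos θ ^ 2) (-1 / sin θ ^ 2)

theorem hasDerivAt_connection_angle (A H r : ℝ → ℝ) (ρ : ℝ) {θ : ℝ} (hθ : sin θ ≠ 0)
    (k i j : Fin 4) :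
    HasDerivAt (fun θ => connection A H r ρ θ k i j) (connectionAngularDeriv H r ρ θ k i j) θ := by
  apply hasDerivAt_connectionMatrix (hasDerivAt_const _ _) (hasDerivAt_const _ _)
    (hasDerivAt_const _ _) (hasDerivAt_const _ _) (hasDerivAt_const _ _)
  · exact (((hasDerivAt_sin θ).fun_pow 2).const_mul _).congr_deriv (by norm_num)
  · exact ((hasDerivAt_sin θ).fun_mul (hasDerivAt_cos θ)).fun_neg.congr_deriv (by ring)
  · refine ((hasDerivAt_cos θ).fun_div (hasDerivAt_sin θ) hθ).congr_deriv ?_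
    congr 1
    linear_combination -sin_sq_add_cos_sq θ

theorem pderiv_connection (h : RegularAt A H r p) (m k i j : Fin 4) :
    pderiv m (fun q => connection A H r (q 1) (q 2) k i j) p =
      (![0, connectionRadialDeriv A H r (p 1) (p 2), connectionAngularDeriv H r (p 1) (p 2), 0] :
        Fin 4 → Fin 4 → Matrix (Fin 4) (Fin 4) ℝ) m k i j := by
  fin_cases m
  · exact deriv_const (p 0) (connection A H r (p 1) (p 2) k i j)
  · exact (hasDerivAt_connection_radius h k i j).deriv
  · exact (hasDerivAt_connection_angle A H r (p 1) h.sin_ne_zero k i j).deriv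
  · exact deriv_const (p 3) (connection A H r (p 1) (p 2) k i j)

theorem riemann_eq_connection (h : RegularAt A H r p) (i j k l : Fin 4) :
    riemann (staticMetric A H r) i j k l p =
      pderiv k (fun q => connection A H r (q 1) (q 2) l i j) p
        - pderiv l (fun q => connection A H r (q 1) (q 2) k i j) p
        + ⁅connection A H r (p 1) (p 2) k, connection A H r (p 1) (p 2) l⁆ i j := by
  have hpderiv (m i k j : Fin 4) : pderiv m (christoffel (staticMetric A H r) i k j) p =
      pderiv m (fun q => connection A H r (q 1) (q 2) k i j) p :=
    pderiv_congr (h.eventually.mono fun q hq => christoffel_staticMetric hq i k j)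
  simp only [riemann, hpderiv, christoffel_staticMetric h, Ring.lie_def,
    Matrix.sub_apply, Matrix.mul_apply, Finset.sum_sub_distrib]

theorem riemann_antisymm (g : MetricField) (i j k l : Fin 4) (p : Fin 4 → ℝ) :
    riemann g i j k l p = -riemann g i j l k p := by
  simp only [riemann, Finset.sum_sub_distrib]
  ring

/-- The sectional curvatures `R^{ij}_{ij}` of `staticMetric A H r` in the coordinate planes. -/
def sectional (A H r : ℝ → ℝ) (ρ : ℝ) : Matrix (Fin 4) (Fin 4) ℝ :=
  let a := -(deriv (deriv A) ρ) / (2 * A ρ * H ρ) + deriv A ρ ^ 2 / (4 * A ρ ^ 2 * H ρ)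
      + deriv A ρ * deriv H ρ / (4 * A ρ * H ρ ^ 2)
  let b := -(deriv A ρ * deriv r ρ) / (2 * A ρ * r ρ * H ρ)
  let d := -(deriv (deriv r) ρ) / (r ρ * H ρ) + deriv r ρ * deriv H ρ / (2 * r ρ * H ρ ^ 2)
  let e := (1 - deriv r ρ ^ 2 / H ρ) / r ρ ^ 2
  !![0, a, b, b; a, 0, d, d; b, d, 0, e; b, d, e, 0]

section Bracket

variable (a b h l w u v z : ℝ)

theorem connectionMatrix_lie_zero_one :
    ⁅connectionMatrix a b h l w u v z 0, connectionMatrix a b h l w u v z 1⁆ =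
      !![0, a * h - a * a, 0, 0; b * a - h * b, 0, 0, 0; 0, 0, 0, 0; 0, 0, 0, 0] := by
  ext i j
  fin_cases i <;> fin_cases j <;> simp [Ring.lie_def, connectionMatrix]

theorem connectionMatrix_lie_zero_two :
    ⁅connectionMatrix a b h l w u v z 0, connectionMatrix a b h l w u v z 2⁆ =
      !![0, 0, a * w, 0; 0, 0, 0, 0; -(l * b), 0, 0, 0; 0, 0, 0, 0] := by
  ext i j
  fin_cases i <;> fin_cases j <;> simp [Ring.lie_def, connectionMatrix]

theorem connectionMatrix_lie_zero_three :
    ⁅connectionMatrix a b h l w u v z 0, connectionMatrix a b h l w u v z 3⁆ =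
      !![0, 0, 0, a * u; 0, 0, 0, 0; 0, 0, 0, 0; -(l * b), 0, 0, 0] := by
  ext i j
  fin_cases i <;> fin_cases j <;> simp [Ring.lie_def, connectionMatrix]

theorem connectionMatrix_lie_one_two :
    ⁅connectionMatrix a b h l w u v z 1, connectionMatrix a b h l w u v z 2⁆ =
      !![0, 0, 0, 0; 0, 0, h * w - w * l, 0; 0, l * l - l * h, 0, 0; 0, 0, 0, 0] := by
  ext i j
  fin_cases i <;> fin_cases j <;> simp [Ring.lie_def, connectionMatrix, mul_comm]

theorem connectionMatrix_lie_one_three :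
    ⁅connectionMatrix a b h l w u v z 1, connectionMatrix a b h l w u v z 3⁆ =
      !![0, 0, 0, 0; 0, 0, 0, h * u - u * l; 0, 0, 0, 0; 0, l * l - l * h, 0, 0] := by
  ext i j
  fin_cases i <;> fin_cases j <;> simp [Ring.lie_def, connectionMatrix, mul_comm]

theorem connectionMatrix_lie_two_three :
    ⁅connectionMatrix a b h l w u v z 2, connectionMatrix a b h l w u v z 3⁆ =
      !![0, 0, 0, 0; 0, 0, 0, w * v - u * z; 0, 0, 0, l * u - v * z; 0, 0, z * z - l * w, 0] := by
  ext i j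
  fin_cases i <;> fin_cases j <;> simp [Ring.lie_def, connectionMatrix]

end Bracket

theorem riemann_staticMetric (h : RegularAt A H r p) (i j k l : Fin 4) :
    riemann (staticMetric A H r) i j k l p = sectional A H r (p 1) i j * metricDiag A H r p j *
      ((if i = k ∧ j = l then 1 else 0) - (if i = l ∧ j = k then 1 else 0)) := by
  have hA := h.pos_A.ne'
  have hH := h.pos_H.ne'
  have hr := h.pos_r.ne'
  have hs := h.sin_ne_zero
  have hcos := cos_sq' (p 2)
  wlog hkl : k ≤ l generalizing k l
  · rw [riemann_antisymm, this l k (le_of_not_ge hkl)]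
    ring
  rw [riemann_eq_connection h, pderiv_connection h, pderiv_connection h]
  rcases hkl.eq_or_lt with rfl | hlt
  · simp [Ring.lie_def]
  have hpair : (k = 0 ∧ l = 1) ∨ (k = 0 ∧ l = 2) ∨ (k = 0 ∧ l = 3) ∨ (k = 1 ∧ l = 2) ∨
      (k = 1 ∧ l = 3) ∨ (k = 2 ∧ l = 3) := by
    clear hkl
    decide +revert
  simp only [connection, connectionRadialDeriv, connectionAngularDeriv, sectional, metricDiag]
  rcases hpair with ⟨rfl, rfl⟩ | ⟨rfl, rfl⟩ | ⟨rfl, rfl⟩ | ⟨rfl, rfl⟩ | ⟨rfl, rfl⟩ | ⟨rfl, rfl⟩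
  all_goals
    simp only [connectionMatrix_lie_zero_one, connectionMatrix_lie_zero_two,
      connectionMatrix_lie_zero_three, connectionMatrix_lie_one_two, connectionMatrix_lie_one_three,
      connectionMatrix_lie_two_three]
    simp only [connectionMatrix, Matrix.cons_val]
    fin_cases i <;> fin_cases j <;> simp
  all_goals field_simp
  all_goals try rw [hcos]
  all_goals ring

theorem sectional_self (A H r : ℝ → ℝ) (ρ : ℝ) (i : Fin 4) : sectional A H r ρ i i = 0 := by
  fin_cases i <;> rfl

theorem sectional_symm (A H r : ℝ → ℝ) (ρ : ℝ) (i j : Fin 4) :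
    sectional A H r ρ i j = sectional A H r ρ j i := by
  fin_cases i <;> fin_cases j <;> rfl

theorem sum_sectional (A H r : ℝ → ℝ) (ρ : ℝ) (j : Fin 4) :
    ∑ i, sectional A H r ρ i j =
      ![sectional A H r ρ 0 1 + 2 * sectional A H r ρ 0 2,
        sectional A H r ρ 0 1 + 2 * sectional A H r ρ 1 2,
        sectional A H r ρ 0 2 + sectional A H r ρ 1 2 + sectional A H r ρ 2 3,
        sectional A H r ρ 0 2 + sectional A H r ρ 1 2 + sectional A H r ρ 2 3] j := by
  fin_cases j <;> simp [sectional, Fin.sum_univ_four] <;> ring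

theorem ricci_staticMetric (h : RegularAt A H r p) (j l : Fin 4) :
    ricci (staticMetric A H r) j l p =
      if j = l then (∑ i, sectional A H r (p 1) i j) * metricDiag A H r p j else 0 := by
  simp only [ricci, riemann_staticMetric h]
  rcases eq_or_ne j l with rfl | hjl
  · rw [if_pos rfl, Finset.sum_mul]
    refine Finset.sum_congr rfl fun i _ => ?_
    rcases eq_or_ne i j with rfl | hij
    · simp [sectional_self]
    · simp [hij]
  · rw [if_neg hjl]
    refine Finset.sum_eq_zero fun i _ => ?_
    rcases eq_or_ne i j with rfl | hij
    · simp [sectional_self]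
    · simp [hjl, hij.symm]

theorem scalarCurvature_staticMetric (h : RegularAt A H r p) :
    scalarCurvature (staticMetric A H r) p = ∑ j, ∑ i, sectional A H r (p 1) i j := by
  simp only [scalarCurvature, ricci_staticMetric h, h.inv_apply, ite_mul, zero_mul,
    Finset.sum_ite_eq, Finset.mem_univ, if_true]
  refine Finset.sum_congr rfl fun j _ => ?_
  field_simp [h.metricDiag_ne_zero j]

theorem einstein_staticMetric (h : RegularAt A H r p) (a b : Fin 4) :
    einstein (staticMetric A H r) a b p =
      if a = b then metricDiag A H r p a * (∑ i, sectional A H r (p 1) i a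
        - (1 / 2) * ∑ j, ∑ i, sectional A H r (p 1) i j) else 0 := by
  rw [einstein, ricci_staticMetric h, scalarCurvature_staticMetric h, staticMetric_apply]
  split_ifs <;> ring

theorem scalarStress_staticMetric (h : RegularAt A H r p) (ψ : ℝ → ℝ) (a b : Fin 4) :
    scalarStress (staticMetric A H r) (fun q => ψ (q 1)) a b p =
      if a = b then metricDiag A H r p a * (((if a = 1 then 2 else 0) - 1) *
        (deriv ψ (p 1) ^ 2 / (2 * H (p 1)))) else 0 := by
  have hH := h.pos_H.ne'
  have hdiag : metricDiag A H r p 1 = H (p 1) := rfl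
  have hgrad_sq : ∑ c, ∑ d, (staticMetric A H r p)⁻¹ c d *
      (pderiv c (fun q => ψ (q 1)) p * pderiv d (fun q => ψ (q 1)) p) =
      deriv ψ (p 1) ^ 2 / H (p 1) := by
    simp only [h.inv_apply, pderiv_comp_radius, ite_mul, zero_mul, Finset.mem_univ,
      if_true, mul_ite, mul_zero, Finset.sum_ite_eq', hdiag]
    field_simp
  rw [scalarStress, hgrad_sq, staticMetric_apply, pderiv_comp_radius, pderiv_comp_radius]
  rcases eq_or_ne a b with rfl | hab
  · rcases eq_or_ne a 1 with rfl | ha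
    · simp only [if_true, hdiag]
      field_simp
    · simp only [if_true, if_neg ha]
      field_simp
      ring
  · rcases eq_or_ne a 1 with rfl | ha
    · simp [hab, hab.symm]
    · simp [hab, ha]

theorem einstein_eq_iff_sectional (h : RegularAt A H r p) (ψ : ℝ → ℝ) :
    (∀ a b, einstein (staticMetric A H r) a b p =
      scalarStress (staticMetric A H r) (fun q => ψ (q 1)) a b p) ↔
      2 * sectional A H r (p 1) 1 2 + sectional A H r (p 1) 2 3 =
          deriv ψ (p 1) ^ 2 / (2 * H (p 1)) ∧
        2 * sectional A H r (p 1) 0 2 + sectional A H r (p 1) 2 3 =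
          -(deriv ψ (p 1) ^ 2 / (2 * H (p 1))) ∧
        sectional A H r (p 1) 0 1 + sectional A H r (p 1) 0 2 + sectional A H r (p 1) 1 2 =
          deriv ψ (p 1) ^ 2 / (2 * H (p 1)) := by
  have hdiagonal : (∀ a b, einstein (staticMetric A H r) a b p =
      scalarStress (staticMetric A H r) (fun q => ψ (q 1)) a b p) ↔
      ∀ a, ∑ i, sectional A H r (p 1) i a - (1 / 2) * ∑ j, ∑ i, sectional A H r (p 1) i j =
        ((if a = 1 then 2 else 0) - 1) * (deriv ψ (p 1) ^ 2 / (2 * H (p 1))) := by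
    simp only [einstein_staticMetric h, scalarStress_staticMetric h]
    refine ⟨fun heq a => ?_, fun heq a b => by rw [heq a]⟩
    exact mul_left_cancel₀ (h.metricDiag_ne_zero a) (by simpa only [if_true] using heq a a)
  rw [hdiagonal]
  simp only [sum_sectional]
  simp only [Fin.sum_univ_four, Fin.forall_fin_succ, IsEmpty.forall_iff, and_true,
    Fin.succ_zero_eq_one, Fin.succ_one_eq_two, Fin.reduceSucc, Fin.reduceEq, if_true, if_false,
    zero_ne_one, Matrix.cons_val]
  constructor
  · rintro ⟨h_tt, h_rr, h_θθ, -⟩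
    refine ⟨?_, ?_, ?_⟩ <;> linarith
  · rintro ⟨h_tt, h_rr, h_θθ⟩
    refine ⟨?_, ?_, ?_, ?_⟩ <;> linarith

theorem riemannUp_staticMetric (h : RegularAt A H r p) (a b c d : Fin 4) :
    riemannUp (staticMetric A H r) a b c d p = sectional A H r (p 1) a b *
      ((if a = c ∧ b = d then 1 else 0) - (if a = d ∧ b = c then 1 else 0)) := by
  simp only [riemannUp, h.inv_apply, riemann_staticMetric h, ite_mul, zero_mul, Finset.sum_ite_eq,
    Finset.mem_univ, if_true]
  field_simp [h.metricDiag_ne_zero b]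

theorem sum_sum_antisymm_mul_antisymm {ι R : Type*} [Fintype ι] [DecidableEq ι] [CommRing R]
    {K : Matrix ι ι R} (hself : ∀ a, K a a = 0) (hsymm : ∀ a b, K a b = K b a) (a b : ι) :
    ∑ c, ∑ d, (K a b * ((if a = c ∧ b = d then 1 else 0) - (if a = d ∧ b = c then 1 else 0)) *
      (K c d * ((if c = a ∧ d = b then 1 else 0) - (if c = b ∧ d = a then 1 else 0)))) =
      2 * K a b ^ 2 := by
  have hterm (c d : ι) :
      K a b * ((if a = c ∧ b = d then 1 else 0) - (if a = d ∧ b = c then 1 else 0)) *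
        (K c d * ((if c = a ∧ d = b then 1 else 0) - (if c = b ∧ d = a then 1 else 0))) =
      (if a = c then (if b = d then K a b ^ 2 else 0) else 0) +
        (if b = c then (if a = d then K a b ^ 2 else 0) else 0) := by
    grind
  simp only [hterm, Finset.sum_add_distrib, Finset.sum_ite_eq, Finset.mem_univ, if_true,
    Finset.sum_ite_irrel, Finset.sum_const_zero]
  ring

theorem kretschmann_staticMetric (h : RegularAt A H r p) :
    kretschmann (staticMetric A H r) p =
      4 * (sectional A H r (p 1) 0 1 ^ 2 + 2 * sectional A H r (p 1) 0 2 ^ 2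
        + 2 * sectional A H r (p 1) 1 2 ^ 2 + sectional A H r (p 1) 2 3 ^ 2) := by
  simp only [kretschmann, riemannUp_staticMetric h]
  simp only [sum_sum_antisymm_mul_antisymm (sectional_self A H r (p 1))
    (sectional_symm A H r (p 1))]
  simp only [Fin.sum_univ_four, sectional, Matrix.of_apply, Matrix.cons_val]
  ring

theorem waveOperator_staticMetric (h : RegularAt A H r p) (ψ : ℝ → ℝ) :
    waveOperator (staticMetric A H r) (fun q => ψ (q 1)) p =
      (deriv (deriv ψ) (p 1) + (deriv A (p 1) / (2 * A (p 1)) - deriv H (p 1) / (2 * H (p 1))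
        + 2 * (deriv r (p 1) / r (p 1))) * deriv ψ (p 1)) / H (p 1) := by
  have hA := h.pos_A.ne'
  have hH := h.pos_H.ne'
  have hr := h.pos_r.ne'
  have hs := h.sin_ne_zero
  have hpderiv_pderiv (a b : Fin 4) : pderiv a (pderiv b (fun q : Fin 4 → ℝ => ψ (q 1))) p =
      if b = 1 then (if a = 1 then deriv (deriv ψ) (p 1) else 0) else 0 := by
    rw [funext (pderiv_comp_radius b ψ)]
    split_ifs with hb ha
    · simp [pderiv_comp_radius, ha]
    · simp [pderiv_comp_radius, ha]
    · exact deriv_const _ _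
  simp only [waveOperator, hpderiv_pderiv, h.inv_apply, pderiv_comp_radius,
    christoffel_staticMetric h, ite_mul, zero_mul, Finset.sum_ite_eq, Finset.mem_univ, if_true,
    mul_ite, mul_zero, Finset.sum_ite_eq', Fin.sum_univ_four]
  simp only [metricDiag, connection, connectionMatrix, Matrix.of_apply, Matrix.cons_val,
    Fin.reduceEq, if_false, zero_ne_one]
  field_simp
  ring

theorem sqrt_gaussCurvature {ρ : ℝ} (hr : 0 < r ρ) : √(gaussCurvature r ρ) = 1 / r ρ := by
  rw [gaussCurvature, sqrt_div zero_le_one, sqrt_one, sqrt_sq hr.le]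

theorem x₂_eq {ρ : ℝ} (hr : 0 < r ρ) : x₂ H r ρ = deriv r ρ / √(H ρ) := by
  rw [x₂, sqrt_gaussCurvature hr, sheetExpansion, hat]
  field_simp

theorem x₃_eq {ρ : ℝ} (hr : 0 < r ρ) :
    x₃ A H r ρ = r ρ * deriv A ρ / (2 * A ρ * √(H ρ)) := by
  rw [x₃, sqrt_gaussCurvature hr, acceleration, hat]
  field_simp

theorem normDeriv_eq {f : ℝ → ℝ} {ρ : ℝ} (hr : 0 < r ρ) :
    normDeriv H r f ρ = r ρ * deriv f ρ / √(H ρ) := by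
  rw [normDeriv, sqrt_gaussCurvature hr, hat]
  field_simp

theorem y₁_sq_eq {ψ : ℝ → ℝ} {ρ : ℝ} (hr : 0 < r ρ) (hH : 0 < H ρ) :
    y₁ H r ψ ρ ^ 2 = r ρ ^ 2 * (deriv ψ ρ ^ 2 / (2 * H ρ)) := by
  have hK : 0 ≤ 2 * gaussCurvature r ρ := by
    rw [gaussCurvature]
    positivity
  rw [y₁, hat, div_pow, sq_sqrt hK, div_pow, sq_sqrt hH.le, gaussCurvature]
  field_simp

namespace RegularAt

theorem eventually_pos_r (h : RegularAt A H r p) : ∀ᶠ ρ in 𝓝 (p 1), 0 < r ρ :=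
  h.contDiffAt_r.continuousAt.eventually (lt_mem_nhds h.pos_r)

theorem hasDerivAt_x₂ (h : RegularAt A H r p) :
    HasDerivAt (x₂ H r) (-(r (p 1) * √(H (p 1)) * sectional A H r (p 1) 1 2)) (p 1) := by
  have hH := h.pos_H
  have hr := h.pos_r
  have hs : 0 < √(H (p 1)) := sqrt_pos.2 hH
  have hsq : √(H (p 1)) ^ 2 = H (p 1) := sq_sqrt hH.le
  have dH := hasDerivAt_of_contDiffAt_two h.contDiffAt_H
  have dr' := hasDerivAt_deriv_of_contDiffAt_two h.contDiffAt_r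
  have hx₂ : x₂ H r =ᶠ[𝓝 (p 1)] fun ρ => deriv r ρ / √(H ρ) :=
    h.eventually_pos_r.mono fun _ => x₂_eq
  refine ((dr'.fun_div (dH.sqrt hH.ne') hs.ne').congr_deriv ?_).congr_of_eventuallyEq hx₂
  simp only [sectional, hsq, Matrix.of_apply, Matrix.cons_val]
  generalize √(H (p 1)) = s at *
  rw [← hsq]
  field_simp
  ring

theorem hasDerivAt_x₃ (h : RegularAt A H r p) :
    HasDerivAt (x₃ A H r) (√(H (p 1)) / r (p 1) * (-(r (p 1) ^ 2 * sectional A H r (p 1) 0 1)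
      + x₂ H r (p 1) * x₃ A H r (p 1) - x₃ A H r (p 1) ^ 2)) (p 1) := by
  have hA := h.pos_A
  have hH := h.pos_H
  have hr := h.pos_r
  have hs : 0 < √(H (p 1)) := sqrt_pos.2 hH
  have hsq : √(H (p 1)) ^ 2 = H (p 1) := sq_sqrt hH.le
  have dA := hasDerivAt_of_contDiffAt_two h.contDiffAt_A
  have dH := hasDerivAt_of_contDiffAt_two h.contDiffAt_H
  have dr := hasDerivAt_of_contDiffAt_two h.contDiffAt_r
  have dA' := hasDerivAt_deriv_of_contDiffAt_two h.contDiffAt_A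
  have hx₃ : x₃ A H r =ᶠ[𝓝 (p 1)] fun ρ => r ρ * deriv A ρ / (2 * A ρ * √(H ρ)) :=
    h.eventually_pos_r.mono fun _ => x₃_eq
  refine (((dr.fun_mul dA').fun_div ((dA.const_mul 2).fun_mul (dH.sqrt hH.ne'))
    (by positivity)).congr_deriv ?_).congr_of_eventuallyEq hx₃
  simp only [sectional, x₂_eq hr, x₃_eq hr, Matrix.of_apply, Matrix.cons_val]
  generalize √(H (p 1)) = s at *
  rw [← hsq]
  field_simp
  ring

theorem normDeriv_x₂ (h : RegularAt A H r p) :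
    normDeriv H r (x₂ H r) (p 1) = -(r (p 1) ^ 2 * sectional A H r (p 1) 1 2) := by
  have hs : 0 < √(H (p 1)) := sqrt_pos.2 h.pos_H
  rw [normDeriv_eq h.pos_r, h.hasDerivAt_x₂.deriv]
  field_simp

theorem normDeriv_x₃ (h : RegularAt A H r p) :
    normDeriv H r (x₃ A H r) (p 1) = -(r (p 1) ^ 2 * sectional A H r (p 1) 0 1)
      + x₂ H r (p 1) * x₃ A H r (p 1) - x₃ A H r (p 1) ^ 2 := by
  have hr := h.pos_r
  have hs : 0 < √(H (p 1)) := sqrt_pos.2 h.pos_H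
  rw [normDeriv_eq hr, h.hasDerivAt_x₃.deriv]
  field_simp

theorem x₂_mul_x₃ (h : RegularAt A H r p) :
    x₂ H r (p 1) * x₃ A H r (p 1) = -(r (p 1) ^ 2 * sectional A H r (p 1) 0 2) := by
  have hA := h.pos_A
  have hr := h.pos_r
  have hs : 0 < √(H (p 1)) := sqrt_pos.2 h.pos_H
  have hsq : √(H (p 1)) ^ 2 = H (p 1) := sq_sqrt h.pos_H.le
  rw [x₂_eq hr, x₃_eq hr]
  simp only [sectional, Matrix.of_apply, Matrix.cons_val]
  generalize √(H (p 1)) = s at *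
  rw [← hsq]
  field_simp

theorem x₂_sq (h : RegularAt A H r p) :
    x₂ H r (p 1) ^ 2 = 1 - r (p 1) ^ 2 * sectional A H r (p 1) 2 3 := by
  have hr := h.pos_r
  have hs : 0 < √(H (p 1)) := sqrt_pos.2 h.pos_H
  have hsq : √(H (p 1)) ^ 2 = H (p 1) := sq_sqrt h.pos_H.le
  rw [x₂_eq hr]
  simp only [sectional, Matrix.of_apply, Matrix.cons_val]
  generalize √(H (p 1)) = s at *
  rw [← hsq]
  field_simp
  ring

end RegularAt

theorem einstein_eq_iff (h : RegularAt A H r p) (ψ : ℝ → ℝ) :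
    (∀ a b, einstein (staticMetric A H r) a b p =
      scalarStress (staticMetric A H r) (fun q => ψ (q 1)) a b p) ↔
      (normDeriv H r (x₂ H r) (p 1), normDeriv H r (x₃ A H r) (p 1)) =
        field (x₂ H r (p 1), x₃ A H r (p 1)) ∧
      y₁ H r ψ (p 1) ^ 2 = x₂ H r (p 1) ^ 2 + 2 * x₂ H r (p 1) * x₃ A H r (p 1) - 1 := by
  have hr_sq : r (p 1) ^ 2 ≠ 0 := pow_ne_zero 2 h.pos_r.ne'
  have hK₀₂ := h.x₂_mul_x₃
  have hK₂₃ := h.x₂_sq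
  rw [einstein_eq_iff_sectional h, y₁_sq_eq h.pos_r h.pos_H, h.normDeriv_x₂, h.normDeriv_x₃, field,
    Prod.mk.injEq]
  dsimp only
  generalize deriv ψ (p 1) ^ 2 / (2 * H (p 1)) = P
  constructor
  · rintro ⟨h_tt, h_rr, h_θθ⟩
    refine ⟨⟨?_, ?_⟩, ?_⟩
    · linear_combination hK₂₃ + hK₀₂ - r (p 1) ^ 2 / 2 * (h_tt + h_rr)
    · linear_combination 2 * hK₀₂ - r (p 1) ^ 2 * (h_θθ - h_tt / 2 + h_rr / 2)
    · linear_combination -hK₂₃ - 2 * hK₀₂ + r (p 1) ^ 2 * h_rr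
  · rintro ⟨⟨hx₂, hx₃⟩, hy₁⟩
    refine ⟨?_, ?_, ?_⟩ <;> apply mul_left_cancel₀ hr_sq
    · linear_combination -2 * hx₂ + hK₂₃ - hy₁
    · linear_combination hK₂₃ + 2 * hK₀₂ + hy₁
    · linear_combination -hx₂ - hx₃ - hy₁ + hK₀₂

theorem wave_eq_iff (h : RegularAt A H r p) {ψ : ℝ → ℝ} (hψ : ContDiffAt ℝ 2 ψ (p 1)) :
    waveOperator (staticMetric A H r) (fun q => ψ (q 1)) p = 0 ↔
      normDeriv H r (normDeriv H r ψ) (p 1) =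
        -(x₂ H r (p 1) + x₃ A H r (p 1)) * normDeriv H r ψ (p 1) := by
  have hA := h.pos_A
  have hH := h.pos_H
  have hr := h.pos_r
  have hs : 0 < √(H (p 1)) := sqrt_pos.2 hH
  have hsq : √(H (p 1)) ^ 2 = H (p 1) := sq_sqrt hH.le
  have dH := hasDerivAt_of_contDiffAt_two h.contDiffAt_H
  have dr := hasDerivAt_of_contDiffAt_two h.contDiffAt_r
  have dψ' := hasDerivAt_deriv_of_contDiffAt_two hψ
  have hnormDeriv : normDeriv H r ψ =ᶠ[𝓝 (p 1)] fun ρ => r ρ * deriv ψ ρ / √(H ρ) :=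
    h.eventually_pos_r.mono fun _ => normDeriv_eq
  rw [waveOperator_staticMetric h, normDeriv_eq hr,
    (((dr.fun_mul dψ').fun_div (dH.sqrt hH.ne') hs.ne').congr_of_eventuallyEq hnormDeriv).deriv,
    normDeriv_eq hr, x₂_eq hr, x₃_eq hr, ← sub_eq_zero (b := -_ * _)]
  generalize √(H (p 1)) = s at *
  rw [← hsq, ← mul_right_inj' (pow_ne_zero 2 hr.ne'), mul_zero]
  apply Eq.congr_left
  field_simp
  ring

end Curvature

/-! ### Solutions of the reduced system -/

section Calculus

variable {E F : Type*} [NormedAddCommGroup E] [NormedSpace ℝ E] [NormedAddCommGroup F]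
  [NormedSpace ℝ F] {s : Set ℝ} {τ : ℝ}

theorem hasDerivWithinAt_fst {γ : ℝ → E × F} {v : E × F} (h : HasDerivWithinAt γ v s τ) :
    HasDerivWithinAt (fun τ => (γ τ).1) v.1 s τ :=
  (hasFDerivAt_fst (𝕜 := ℝ) (p := γ τ)).comp_hasDerivWithinAt τ h

theorem hasDerivWithinAt_snd {γ : ℝ → E × F} {v : E × F} (h : HasDerivWithinAt γ v s τ) :
    HasDerivWithinAt (fun τ => (γ τ).2) v.2 s τ :=
  (hasFDerivAt_snd (𝕜 := ℝ) (p := γ τ)).comp_hasDerivWithinAt τ h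

theorem eq_of_hasDerivWithinAt_zero (hs : Convex ℝ s) {f : ℝ → E}
    (h : ∀ x ∈ s, HasDerivWithinAt f 0 s x) {x y : ℝ} (hx : x ∈ s) (hy : y ∈ s) : f x = f y := by
  have hle := hs.norm_image_sub_le_of_norm_hasDerivWithin_le h (C := 0) (by simp) hy hx
  rwa [zero_mul, norm_le_zero_iff, sub_eq_zero] at hle

theorem exists_hasDerivWithinAt_eq_mul {w : ℝ → ℝ} {a b t₀ : ℝ} (hw : ContinuousOn w (Icc a b))
    (ht₀ : t₀ ∈ Icc a b) :
    ∃ Q : ℝ → ℝ, Q t₀ = 1 ∧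
      ∀ τ ∈ Icc a b, 0 < Q τ ∧ HasDerivWithinAt Q (w τ * Q τ) (Icc a b) τ := by
  refine ⟨fun τ => exp (∫ x in t₀..τ, w x), by simp, fun τ hτ => ⟨exp_pos _, ?_⟩⟩
  have : Fact (τ ∈ Icc a b) := ⟨hτ⟩
  have hint : HasDerivWithinAt (fun u => ∫ x in t₀..u, w x) (w τ) (Icc a b) τ :=
    intervalIntegral.integral_hasDerivWithinAt_right
      (hw.mono (ordConnected_Icc.uIcc_subset ht₀ hτ)).intervalIntegrable
      (hw.stronglyMeasurableAtFilter_nhdsWithin measurableSet_Icc τ) (hw τ hτ)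
  exact hint.exp.congr_deriv (mul_comm _ _)

end Calculus

/-- The solution `Q` of `Q'' = Q`, `Q 0 = 1`, `Q' 0 = x₂ + x₃`. It is the integrating factor of the
reduced system along the solution through `x`. -/
def integratingFactor (x : ℝ × ℝ) (τ : ℝ) : ℝ := cosh τ + (x.1 + x.2) * sinh τ

/-- The solution of the reduced system with initial value `x`, as long as the integrating factor is
positive. -/
def flow (x : ℝ × ℝ) (τ : ℝ) : ℝ × ℝ :=
  ((sinh τ + (x.1 + x.2) * cosh τ - x.2) / integratingFactor x τ, x.2 / integratingFactor x τ)

theorem flow_zero (x : ℝ × ℝ) : flow x 0 = x := by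
  ext <;> simp [flow, integratingFactor]

theorem hasDerivAt_flow {x : ℝ × ℝ} {τ : ℝ} (hτ : integratingFactor x τ ≠ 0) :
    HasDerivAt (flow x) (field (flow x τ)) τ := by
  have hQ : HasDerivAt (integratingFactor x) (sinh τ + (x.1 + x.2) * cosh τ) τ :=
    (hasDerivAt_cosh τ).add ((hasDerivAt_sinh τ).const_mul _)
  have hQ' : HasDerivAt (fun τ => sinh τ + (x.1 + x.2) * cosh τ) (integratingFactor x τ) τ :=
    (hasDerivAt_sinh τ).add ((hasDerivAt_cosh τ).const_mul _)
  refine (((hQ'.sub_const x.2).fun_div hQ hτ).prodMk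
    ((hasDerivAt_const τ x.2).fun_div hQ hτ)).congr_deriv ?_
  simp only [field, flow, Prod.mk.injEq]
  constructor <;> field_simp <;> ring

section Uniqueness

variable {γ : ℝ → ℝ × ℝ} {s : Set ℝ} {τ : ℝ}

theorem hasDerivWithinAt_solution_snd (h : HasDerivWithinAt γ (field (γ τ)) s τ) :
    HasDerivWithinAt (fun τ => (γ τ).2) (-((γ τ).2 * ((γ τ).1 + (γ τ).2))) s τ :=
  (hasDerivWithinAt_snd h).congr_deriv (neg_mul _ _)

theorem hasDerivWithinAt_solution_add (h : HasDerivWithinAt γ (field (γ τ)) s τ) :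
    HasDerivWithinAt (fun τ => (γ τ).1 + (γ τ).2) (1 - ((γ τ).1 + (γ τ).2) ^ 2) s τ := by
  refine ((hasDerivWithinAt_fst h).fun_add (hasDerivWithinAt_snd h)).congr_deriv ?_
  simp only [field]
  ring

theorem eq_flow_of_hasDerivWithinAt {a b t₀ : ℝ}
    (h : ∀ τ ∈ Icc a b, HasDerivWithinAt γ (field (γ τ)) (Icc a b) τ) (ht₀ : t₀ ∈ Icc a b)
    (hτ : τ ∈ Icc a b) :
    0 < integratingFactor (γ t₀) (τ - t₀) ∧ γ τ = flow (γ t₀) (τ - t₀) := by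
  have hsinh (τ : ℝ) : HasDerivWithinAt (fun τ => sinh (τ - t₀)) (cosh (τ - t₀)) (Icc a b) τ :=
    ((hasDerivAt_sinh _).comp_sub_const τ t₀).hasDerivWithinAt
  have hcosh (τ : ℝ) : HasDerivWithinAt (fun τ => cosh (τ - t₀)) (sinh (τ - t₀)) (Icc a b) τ :=
    ((hasDerivAt_cosh _).comp_sub_const τ t₀).hasDerivWithinAt
  have hy (τ) (hτ : τ ∈ Icc a b) := hasDerivWithinAt_solution_snd (h τ hτ)
  have hw (τ) (hτ : τ ∈ Icc a b) := hasDerivWithinAt_solution_add (h τ hτ)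
  obtain ⟨Q, hQ₀, hQ⟩ :=
    exists_hasDerivWithinAt_eq_mul (fun τ hτ => (hw τ hτ).continuousWithinAt) ht₀
  have hQ_y : Q τ * (γ τ).2 = (γ t₀).2 := by
    have := eq_of_hasDerivWithinAt_zero (convex_Icc a b) (fun τ hτ =>
      ((hQ τ hτ).2.fun_mul (hy τ hτ)).congr_deriv (by ring)) hτ ht₀
    rwa [hQ₀, one_mul] at this
  have hQ_cosh : Q τ * (cosh (τ - t₀) - ((γ τ).1 + (γ τ).2) * sinh (τ - t₀)) = 1 := by
    have := eq_of_hasDerivWithinAt_zero (convex_Icc a b) (fun τ hτ => ((hQ τ hτ).2.fun_mul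
      ((hcosh τ).fun_sub ((hw τ hτ).fun_mul (hsinh τ)))).congr_deriv (by ring)) hτ ht₀
    simpa [hQ₀] using this
  have hQ_sinh : Q τ * (((γ τ).1 + (γ τ).2) * cosh (τ - t₀) - sinh (τ - t₀)) =
      (γ t₀).1 + (γ t₀).2 := by
    have := eq_of_hasDerivWithinAt_zero (convex_Icc a b) (fun τ hτ => ((hQ τ hτ).2.fun_mul
      (((hw τ hτ).fun_mul (hcosh τ)).fun_sub (hsinh τ))).congr_deriv (by ring)) hτ ht₀
    simpa [hQ₀] using this
  have hcs := cosh_sq_sub_sinh_sq (τ - t₀)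
  have hQ_eq : Q τ = integratingFactor (γ t₀) (τ - t₀) := by
    rw [integratingFactor, ← hQ_sinh]
    linear_combination cosh (τ - t₀) * hQ_cosh - Q τ * hcs
  have hQ_pos := (hQ τ hτ).1
  refine ⟨hQ_eq ▸ hQ_pos, ?_⟩
  rw [flow, ← hQ_eq]
  ext
  · refine (eq_div_iff hQ_pos.ne').2 ?_
    rw [← hQ_sinh, ← hQ_y]
    linear_combination sinh (τ - t₀) * hQ_cosh - ((γ τ).1 + (γ τ).2) * Q τ * hcs
  · exact (eq_div_iff hQ_pos.ne').2 ((mul_comm _ _).trans hQ_y)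

theorem IsSolution.eq_flow {J : Set ℝ} (h : IsSolution γ J) {t₀ : ℝ} (ht₀ : t₀ ∈ J)
    (hτ : τ ∈ J) : 0 < integratingFactor (γ t₀) (τ - t₀) ∧ γ τ = flow (γ t₀) (τ - t₀) :=
  eq_flow_of_hasDerivWithinAt
    (fun x hx => (h.hasDerivAt x (h.ordConnected.uIcc_subset ht₀ hτ hx)).hasDerivWithinAt)
    left_mem_uIcc right_mem_uIcc

end Uniqueness

/-- The non-constant solutions of the reduced system, with singularity at `s = 0`. -/
def orbit (c s : ℝ) : ℝ × ℝ := ((cosh s - c) / sinh s, c / sinh s)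

theorem orbit_neg (c s : ℝ) : orbit c (-s) = -orbit c s := by
  simp [orbit, div_neg]

section Orbit

variable {c s : ℝ}

theorem sinh_ne_zero_iff : sinh s ≠ 0 ↔ s ≠ 0 := Real.sinh_eq_zero.not

theorem integratingFactor_orbit (c : ℝ) (hs : s ≠ 0) (τ : ℝ) :
    integratingFactor (orbit c s) τ = sinh (τ + s) / sinh s := by
  have hs' := sinh_ne_zero_iff.2 hs
  rw [integratingFactor, orbit, sinh_add]
  field_simp
  ring

theorem flow_orbit (c : ℝ) (hs : s ≠ 0) (τ : ℝ) : flow (orbit c s) τ = orbit c (τ + s) := by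
  have hs' := sinh_ne_zero_iff.2 hs
  have hfst : sinh τ + ((orbit c s).1 + (orbit c s).2) * cosh τ - (orbit c s).2 =
      (cosh (τ + s) - c) / sinh s := by
    rw [orbit, cosh_add]
    field_simp
    ring
  rw [flow, hfst, integratingFactor_orbit c hs, div_div_div_cancel_right₀ hs']
  simp only [orbit, div_div_div_cancel_right₀ hs']

theorem hasDerivAt_orbit (c : ℝ) (hs : s ≠ 0) :
    HasDerivAt (orbit c) (field (orbit c s)) s := by
  have hs' := sinh_ne_zero_iff.2 hs
  refine ((((hasDerivAt_cosh s).sub_const c).fun_div (hasDerivAt_sinh s) hs').prodMk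
    ((hasDerivAt_const s c).fun_div (hasDerivAt_sinh s) hs')).congr_deriv ?_
  simp only [field, orbit, Prod.mk.injEq]
  constructor <;> field_simp <;> ring

theorem orbit_constraint (c : ℝ) (hs : s ≠ 0) :
    (orbit c s).1 ^ 2 + 2 * (orbit c s).1 * (orbit c s).2 = 1 + (1 - c ^ 2) / sinh s ^ 2 := by
  have hs' := sinh_ne_zero_iff.2 hs
  simp only [orbit]
  field_simp
  linear_combination cosh_sq_sub_sinh_sq s

theorem orbit_mem_phaseSpace (hc : |c| ≤ 1) (hs : s ≠ 0) : orbit c s ∈ phaseSpace := by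
  have hc_sq : 0 ≤ 1 - c ^ 2 := sub_nonneg.2 (sq_le_one_iff_abs_le_one c |>.2 hc)
  rw [phaseSpace, mem_ofPred_eq, orbit_constraint c hs, le_add_iff_nonneg_right]
  positivity

theorem orbit_fst_pos (hc : c ≤ 1) (hs : 0 < s) : 0 < (orbit c s).1 :=
  div_pos (sub_pos.2 (hc.trans_lt (one_lt_cosh.2 hs.ne'))) (sinh_pos_iff.2 hs)

end Orbit

theorem field_neg (x : ℝ × ℝ) : field (-x) = field x := by
  simp only [field, Prod.fst_neg, Prod.snd_neg, Prod.mk.injEq]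
  constructor <;> ring

theorem neg_mem_phaseSpace {x : ℝ × ℝ} : -x ∈ phaseSpace ↔ x ∈ phaseSpace := by
  simp only [phaseSpace, mem_ofPred_eq, Prod.fst_neg, Prod.snd_neg]
  ring_nf

theorem neg_PM : -PM = PMbar := by simp [PM, PMbar]

theorem neg_PMbar : -PMbar = PM := by simp [PM, PMbar]

theorem add_sq_eq (x : ℝ × ℝ) : (x.1 + x.2) ^ 2 = x.1 ^ 2 + 2 * x.1 * x.2 + x.2 ^ 2 := by ring

theorem exists_cosh_eq_mul_sinh {w : ℝ} (hw : 1 < w) : ∃ s > 0, cosh s = w * sinh s := by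
  have hw₀ : 0 < w := one_pos.trans hw
  refine ⟨artanh w⁻¹, artanh_pos ⟨inv_pos.2 hw₀, inv_lt_one_of_one_lt₀ hw⟩, ?_⟩
  have htanh := tanh_artanh (x := w⁻¹)
    ⟨neg_one_lt_zero.trans (inv_pos.2 hw₀), inv_lt_one_of_one_lt₀ hw⟩
  rw [tanh_eq_sinh_div_cosh, div_eq_iff (cosh_pos _).ne'] at htanh
  rw [htanh, mul_inv_cancel_left₀ hw₀.ne']

theorem exists_orbit_of_pos {x : ℝ × ℝ} (hx : x ∈ phaseSpace) (hw : 0 < x.1 + x.2) :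
    x = PM ∨ ∃ c s, |c| ≤ 1 ∧ 0 < s ∧ x = orbit c s := by
  have hconstraint : 1 + x.2 ^ 2 ≤ (x.1 + x.2) ^ 2 := by
    rw [add_sq_eq]
    exact add_le_add_left hx _
  have hone_le : 1 ≤ x.1 + x.2 := by nlinarith [sq_nonneg x.2]
  rcases hone_le.eq_or_lt with hw₁ | hw₁
  · left
    have hx₃ : x.2 = 0 := pow_eq_zero_iff two_ne_zero |>.1 (by nlinarith [sq_nonneg x.2])
    exact Prod.ext (by simpa [hx₃, PM] using hw₁.symm) hx₃
  · right
    obtain ⟨s, hs, hcosh⟩ := exists_cosh_eq_mul_sinh hw₁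
    have hsinh : 0 < sinh s := sinh_pos_iff.2 hs
    refine ⟨x.2 * sinh s, s, ?_, hs, ?_⟩
    · rw [← sq_le_one_iff_abs_le_one, mul_pow]
      have hcs := cosh_sq_sub_sinh_sq s
      rw [hcosh, mul_pow] at hcs
      nlinarith [sq_nonneg (sinh s)]
    · rw [orbit, hcosh]
      ext
      · exact (eq_div_iff hsinh.ne').2 (by ring)
      · exact (eq_div_iff hsinh.ne').2 rfl

theorem add_ne_zero_of_mem_phaseSpace {x : ℝ × ℝ} (hx : x ∈ phaseSpace) : x.1 + x.2 ≠ 0 := by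
  have hx' : 1 ≤ x.1 ^ 2 + 2 * x.1 * x.2 := hx
  have := add_sq_eq x
  exact (sq_pos_iff (a := x.1 + x.2)).1 (by nlinarith [sq_nonneg x.2])

theorem exists_orbit {x : ℝ × ℝ} (hx : x ∈ phaseSpace) :
    x = PM ∨ x = PMbar ∨ ∃ c s, |c| ≤ 1 ∧ s ≠ 0 ∧ x = orbit c s := by
  rcases (add_ne_zero_of_mem_phaseSpace hx).lt_or_gt with hw | hw
  · rcases exists_orbit_of_pos (neg_mem_phaseSpace.2 hx) (by simp; linarith) with
      h | ⟨c, s, hc, hs, h⟩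
    · exact .inr (.inl (by rw [← neg_PM, ← h, neg_neg]))
    · exact .inr (.inr ⟨c, -s, hc, neg_ne_zero.2 hs.ne', by rw [orbit_neg, ← h, neg_neg]⟩)
  · rcases exists_orbit_of_pos hx hw with h | ⟨c, s, hc, hs, h⟩
    · exact .inl h
    · exact .inr (.inr ⟨c, s, hc, hs.ne', h⟩)

/-- The reflection `ξ ↦ -ξ`, `x ↦ -x`, which maps solutions of the reduced system to solutions. -/
def reflection (γ : ℝ → ℝ × ℝ) (ξ : ℝ) : ℝ × ℝ := -γ (-ξ)

theorem reflection_reflection (γ : ℝ → ℝ × ℝ) : reflection (reflection γ) = γ := by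
  ext ξ <;> simp [reflection]

section Maximal

variable {γ : ℝ → ℝ × ℝ} {J : Set ℝ}

theorem IsSolution.eq_PM (h : IsSolution γ J) {t₀ τ : ℝ} (ht₀ : t₀ ∈ J) (h₀ : γ t₀ = PM)
    (hτ : τ ∈ J) : γ τ = PM := by
  obtain ⟨hpos, heq⟩ := h.eq_flow ht₀ hτ
  rw [h₀] at hpos heq
  rw [heq, flow, Prod.ext_iff]
  simp only [integratingFactor, PM, add_zero, one_mul, sub_zero, zero_div, and_true] at hpos ⊢
  rw [add_comm, div_self hpos.ne']

theorem IsSolution.eq_orbit (h : IsSolution γ J) {t₀ τ : ℝ} (ht₀ : t₀ ∈ J) {c s : ℝ} (hs : s ≠ 0)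
    (h₀ : γ t₀ = orbit c s) (hτ : τ ∈ J) :
    0 < s * (τ - (t₀ - s)) ∧ γ τ = orbit c (τ - (t₀ - s)) := by
  obtain ⟨hpos, heq⟩ := h.eq_flow ht₀ hτ
  rw [h₀] at hpos heq
  rw [integratingFactor_orbit c hs, sub_add] at hpos
  rw [flow_orbit c hs, sub_add] at heq
  refine ⟨?_, heq⟩
  simpa [div_pos_iff, mul_pos_iff, and_comm] using hpos

theorem IsSolution.reflect (h : IsSolution γ J) : IsSolution (reflection γ) (-J) where
  isOpen := h.isOpen.neg
  ordConnected := h.ordConnected.preimage_anti fun _ _ => neg_le_neg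
  nonempty := h.nonempty.neg
  hasDerivAt ξ hξ :=
    ((h.hasDerivAt (-ξ) hξ).scomp ξ (hasDerivAt_neg ξ)).neg.congr_deriv (by
      simp [reflection, field_neg])
  mem ξ hξ := neg_mem_phaseSpace.2 (h.mem (-ξ) hξ)

theorem IsMaximalSolution.reflect (h : IsMaximalSolution γ J) :
    IsMaximalSolution (reflection γ) (-J) := by
  refine ⟨h.1.reflect, fun γ' J' h' hJ hγ => ?_⟩
  have hneg : -J' = J := h.2 (reflection γ') (-J') h'.reflect (Set.neg_subset.1 hJ) fun ξ hξ => by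
    rw [reflection, hγ (x := -ξ) (Set.neg_mem_neg.2 hξ), reflection, neg_neg, neg_neg]
  rw [← hneg, neg_neg]

theorem isSolution_PM : IsSolution (fun _ => PM) univ where
  isOpen := isOpen_univ
  ordConnected := ordConnected_univ
  nonempty := univ_nonempty
  hasDerivAt ξ _ := (hasDerivAt_const ξ PM).congr_deriv (by ext <;> norm_num [field, PM])
  mem ξ _ := by norm_num [phaseSpace, PM]

theorem isSolution_orbit {c : ℝ} (hc : |c| ≤ 1) (a : ℝ) :
    IsSolution (fun ξ => orbit c (ξ - a)) (Ioi a) where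
  isOpen := isOpen_Ioi
  ordConnected := ordConnected_Ioi
  nonempty := nonempty_Ioi
  hasDerivAt ξ hξ := (hasDerivAt_orbit c (sub_pos.2 hξ).ne').comp_sub_const ξ a
  mem _ hξ := orbit_mem_phaseSpace hc (sub_pos.2 hξ).ne'

theorem isMaximalSolution_PM : IsMaximalSolution (fun _ => PM) univ :=
  ⟨isSolution_PM, fun _ _ _ h _ => univ_subset_iff.1 h⟩

theorem isMaximalSolution_orbit {c : ℝ} (hc : |c| ≤ 1) (a : ℝ) :
    IsMaximalSolution (fun ξ => orbit c (ξ - a)) (Ioi a) := by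
  refine ⟨isSolution_orbit hc a, fun γ' J' h' hJ hγ => Subset.antisymm (fun τ hτ => ?_) hJ⟩
  have hmem : a + 1 ∈ Ioi a := lt_add_one a
  have hinit : γ' (a + 1) = orbit c 1 := (hγ hmem).trans (by simp)
  simpa using (h'.eq_orbit (hJ hmem) one_ne_zero hinit hτ).1

theorem IsMaximalSolution.eq_PM (h : IsMaximalSolution γ J) {t : ℝ} (ht : t ∈ J)
    (h₀ : γ t = PM) : J = univ ∧ ∀ ξ, γ ξ = PM := by
  have hJ : univ = J := h.2 _ _ isSolution_PM (subset_univ _)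
    fun τ hτ => (h.1.eq_PM ht h₀ hτ).symm
  exact ⟨hJ.symm, fun ξ => h.1.eq_PM ht h₀ (hJ ▸ mem_univ ξ)⟩

theorem IsMaximalSolution.eq_orbit (h : IsMaximalSolution γ J) {t c s : ℝ} (ht : t ∈ J)
    (hc : |c| ≤ 1) (hs : 0 < s) (h₀ : γ t = orbit c s) :
    J = Ioi (t - s) ∧ ∀ ξ ∈ J, γ ξ = orbit c (ξ - (t - s)) := by
  have horbit (τ) (hτ : τ ∈ J) := h.1.eq_orbit ht hs.ne' h₀ hτ
  have hJ : J ⊆ Ioi (t - s) := fun τ hτ => sub_pos.1 (pos_of_mul_pos_right (horbit τ hτ).1 hs.le)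
  exact ⟨(h.2 _ _ (isSolution_orbit hc (t - s)) hJ fun τ hτ => (horbit τ hτ).2.symm).symm,
    fun τ hτ => (horbit τ hτ).2⟩

theorem IsMaximalSolution.classification (h : IsMaximalSolution γ J) :
    (J = univ ∧ ∀ ξ, γ ξ = PM) ∨ (J = univ ∧ ∀ ξ, γ ξ = PMbar) ∨
      (∃ a c, |c| ≤ 1 ∧ J = Ioi a ∧ ∀ ξ ∈ J, γ ξ = orbit c (ξ - a)) ∨
      (∃ a c, |c| ≤ 1 ∧ J = Iio a ∧ ∀ ξ ∈ J, γ ξ = orbit c (ξ - a)) := by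
  obtain ⟨t, ht⟩ := h.1.nonempty
  have ht' : -t ∈ -J := Set.neg_mem_neg.2 ht
  have hγ (ξ : ℝ) : γ ξ = -reflection γ (-ξ) := by simp [reflection]
  rcases exists_orbit (h.1.mem t ht) with h₀ | h₀ | ⟨c, s, hc, hs, h₀⟩
  · exact .inl (h.eq_PM ht h₀)
  · obtain ⟨hJ, hPM⟩ := h.reflect.eq_PM ht' (by rw [reflection, neg_neg, h₀, neg_PMbar])
    exact .inr (.inl ⟨by rw [← neg_neg J, hJ, Set.neg_univ], fun ξ => by rw [hγ, hPM, neg_PM]⟩)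
  · rcases hs.lt_or_gt with hs | hs
    · obtain ⟨hJ, horbit⟩ := h.reflect.eq_orbit ht' hc (neg_pos.2 hs)
        (by rw [reflection, neg_neg, h₀, orbit_neg])
      refine .inr (.inr (.inr ⟨t - s, c, hc, ?_, fun ξ hξ => ?_⟩))
      · rw [← neg_neg J, hJ, Set.neg_Ioi]
        ring_nf
      · rw [hγ, horbit (-ξ) (Set.neg_mem_neg.2 hξ), ← orbit_neg]
        ring_nf
    · exact .inr (.inr (.inl ⟨t - s, c, hc, h.eq_orbit ht hc hs h₀⟩))

end Maximal

theorem exists_isMaximalSolution_of_pos {x : ℝ × ℝ} (hx : x ∈ phaseSpace) (hw : 0 < x.1 + x.2) :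
    ∃ γ J, IsMaximalSolution γ J ∧ (0 : ℝ) ∈ J ∧ γ 0 = x := by
  rcases exists_orbit_of_pos hx hw with rfl | ⟨c, s, hc, hs, rfl⟩
  · exact ⟨_, _, isMaximalSolution_PM, mem_univ _, rfl⟩
  · exact ⟨_, _, isMaximalSolution_orbit hc (-s), neg_lt_zero.2 hs, by rw [zero_sub, neg_neg]⟩

theorem exists_isMaximalSolution {x : ℝ × ℝ} (hx : x ∈ phaseSpace) :
    ∃ γ J, IsMaximalSolution γ J ∧ (0 : ℝ) ∈ J ∧ γ 0 = x := by
  rcases (add_ne_zero_of_mem_phaseSpace hx).lt_or_gt with hw | hw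
  · obtain ⟨γ, J, hγ, h₀, hx₀⟩ :=
      exists_isMaximalSolution_of_pos (neg_mem_phaseSpace.2 hx) (by simp; linarith)
    exact ⟨_, _, hγ.reflect, by simpa using h₀, by simp [reflection, hx₀]⟩
  · exact exists_isMaximalSolution_of_pos hx hw

/-! ### Finite fixed points -/

theorem fixedPoints_eq : {x | x ∈ phaseSpace ∧ field x = 0} = {PM, PMbar} := by
  ext x
  simp only [mem_ofPred_eq, mem_insert_iff, mem_singleton_iff]
  constructor
  · rintro ⟨hx, h⟩
    obtain ⟨h₁, h₂⟩ := Prod.ext_iff.1 h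
    have hx₃ : x.2 = 0 :=
      neg_eq_zero.1 ((mul_eq_zero.1 h₂).resolve_right (add_ne_zero_of_mem_phaseSpace hx))
    have hx₂ : x.1 ^ 2 = 1 ^ 2 := by
      simp only [field, hx₃, add_zero, Prod.fst_zero] at h₁
      linarith
    exact (sq_eq_sq_iff_eq_or_eq_neg.1 hx₂).imp (Prod.ext · hx₃) (Prod.ext · hx₃)
  · rintro (rfl | rfl) <;> norm_num [phaseSpace, field, PM, PMbar]

theorem fderiv_field_apply (p v : ℝ × ℝ) :
    fderiv ℝ field p v = (-(v.1 * (p.1 + p.2)) - p.1 * (v.1 + v.2),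
      -(v.2 * (p.1 + p.2)) - p.2 * (v.1 + v.2)) := by
  have hfst : HasFDerivAt Prod.fst (ContinuousLinearMap.fst ℝ ℝ ℝ) p := hasFDerivAt_fst
  have hsnd : HasFDerivAt Prod.snd (ContinuousLinearMap.snd ℝ ℝ ℝ) p := hasFDerivAt_snd
  have hfield : HasFDerivAt field _ p :=
    ((hfst.mul (hfst.add hsnd)).const_sub 1).prodMk (hsnd.neg.mul (hfst.add hsnd))
  rw [hfield.fderiv]
  ext <;> simp <;> ring

theorem fderiv_field_neg (p : ℝ × ℝ) : fderiv ℝ field (-p) = -fderiv ℝ field p := by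
  ext <;> simp [fderiv_field_apply] <;> ring

section Eigenvalue

variable {R V : Type*} [CommRing R] [AddCommGroup V] [Module R V] {f : Module.End R V} {μ : R}

theorem hasEigenvalue_iff_exists : f.HasEigenvalue μ ↔ ∃ v ≠ 0, f v = μ • v := by
  refine ⟨fun h => ?_, fun ⟨_, hv, hfv⟩ =>
    Module.End.hasEigenvalue_of_hasEigenvector ⟨Module.End.mem_eigenspace_iff.2 hfv, hv⟩⟩
  obtain ⟨v, hv⟩ := h.exists_hasEigenvector
  exact ⟨v, hv.2, hv.apply_eq_smul⟩

theorem hasEigenvalue_neg : (-f).HasEigenvalue μ ↔ f.HasEigenvalue (-μ) := by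
  simp only [hasEigenvalue_iff_exists, LinearMap.neg_apply, neg_smul, neg_eq_iff_eq_neg]

end Eigenvalue

theorem hasEigenvalue_fderiv_field_PM (μ : ℝ) : Module.End.HasEigenvalue
    ((fderiv ℝ field PM : ℝ × ℝ →L[ℝ] ℝ × ℝ) : Module.End ℝ (ℝ × ℝ)) μ ↔ μ = -2 ∨ μ = -1 := by
  have happly (v : ℝ × ℝ) : fderiv ℝ field PM v = (-2 * v.1 - v.2, -v.2) := by
    rw [fderiv_field_apply]
    ext <;> simp only [PM] <;> ring
  simp only [hasEigenvalue_iff_exists, ContinuousLinearMap.coe_coe, happly]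
  constructor
  · rintro ⟨v, hv, h⟩
    obtain ⟨h₁, h₂⟩ := Prod.ext_iff.1 h
    simp only [Prod.smul_fst, Prod.smul_snd, smul_eq_mul] at h₁ h₂
    by_cases hv₂ : v.2 = 0
    · have hv₁ : v.1 ≠ 0 := fun hv₁ => hv (Prod.ext hv₁ hv₂)
      exact .inl (mul_right_cancel₀ hv₁ (by linarith))
    · exact .inr (mul_right_cancel₀ hv₂ (by linarith))
  · rintro (rfl | rfl)
    · exact ⟨(1, 0), by simp, by norm_num⟩
    · exact ⟨(1, -1), by simp, by norm_num⟩

theorem hasEigenvalue_fderiv_field_PMbar (μ : ℝ) : Module.End.HasEigenvalue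
    ((fderiv ℝ field PMbar : ℝ × ℝ →L[ℝ] ℝ × ℝ) : Module.End ℝ (ℝ × ℝ)) μ ↔ μ = 2 ∨ μ = 1 := by
  rw [← neg_PM, fderiv_field_neg, ContinuousLinearMap.toLinearMap_neg, hasEigenvalue_neg,
    hasEigenvalue_fderiv_field_PM, neg_inj, neg_inj]

theorem dist_PM (x : ℝ × ℝ) : dist x PM = max |x.1 - 1| |x.2| := by
  rw [Prod.dist_eq, PM, Real.dist_eq, Real.dist_eq, sub_zero]

theorem abs_add_sub_one_le (x : ℝ × ℝ) : |x.1 + x.2 - 1| ≤ 2 * dist x PM := by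
  rw [dist_PM, add_sub_right_comm, two_mul]
  exact (abs_add_le _ _).trans (add_le_add (le_max_left _ _) (le_max_right _ _))

theorem add_nonneg_of_dist_PM_lt {x : ℝ × ℝ} (hx : dist x PM < 1 / 2) : 0 ≤ x.1 + x.2 := by
  linarith [(abs_le.1 (abs_add_sub_one_le x)).1]

theorem flow_fst_sub_one {x : ℝ × ℝ} {τ : ℝ} (hτ : integratingFactor x τ ≠ 0) :
    (flow x τ).1 - 1 = ((x.1 + x.2 - 1) * exp (-τ) - x.2) / integratingFactor x τ := by
  rw [flow, eq_div_iff hτ, sub_mul, div_mul_cancel₀ _ hτ, integratingFactor, ← cosh_sub_sinh]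
  ring

section Attraction

variable {x : ℝ × ℝ} {τ : ℝ}

theorem cosh_le_integratingFactor (hx : 0 ≤ x.1 + x.2) (hτ : 0 ≤ τ) :
    cosh τ ≤ integratingFactor x τ :=
  le_add_of_nonneg_right (mul_nonneg hx (sinh_nonneg_iff.2 hτ))

theorem integratingFactor_pos (hx : 0 ≤ x.1 + x.2) (hτ : 0 ≤ τ) : 0 < integratingFactor x τ :=
  (cosh_pos τ).trans_le (cosh_le_integratingFactor hx hτ)

theorem dist_flow_PM_le (hx : 0 ≤ x.1 + x.2) (hτ : 0 ≤ τ) :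
    dist (flow x τ) PM ≤ 3 * dist x PM := by
  have hpos := integratingFactor_pos hx hτ
  have hone_le := (one_le_cosh τ).trans (cosh_le_integratingFactor hx hτ)
  have hsnd : |x.2| ≤ dist x PM := dist_PM x ▸ le_max_right _ _
  have hdiv (a : ℝ) : |a / integratingFactor x τ| ≤ |a| := by
    rw [abs_div, abs_of_pos hpos]
    exact div_le_self (abs_nonneg a) hone_le
  rw [dist_PM (flow x τ), flow_fst_sub_one hpos.ne', max_le_iff]
  constructor
  · calc |((x.1 + x.2 - 1) * exp (-τ) - x.2) / integratingFactor x τ|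
        ≤ |x.1 + x.2 - 1| * exp (-τ) + |x.2| := by
          refine (hdiv _).trans ((abs_sub _ _).trans_eq ?_)
          rw [abs_mul, abs_of_pos (exp_pos _)]
      _ ≤ 2 * dist x PM + dist x PM := by
          refine add_le_add ((mul_le_of_le_one_right (abs_nonneg _) ?_).trans
            (abs_add_sub_one_le x)) hsnd
          exact exp_le_one_iff.2 (neg_nonpos.2 hτ)
      _ = 3 * dist x PM := by ring
  · exact (hdiv _).trans (by linarith [dist_nonneg (x := x) (y := PM)])

theorem tendsto_integratingFactor (hx : 0 ≤ x.1 + x.2) :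
    Tendsto (integratingFactor x) atTop atTop := by
  refine tendsto_atTop_mono' atTop ?_ (tendsto_exp_atTop.atTop_div_const (two_pos (α := ℝ)))
  filter_upwards [eventually_ge_atTop 0] with τ hτ
  calc exp τ / 2 ≤ cosh τ := by
        rw [cosh_eq]
        gcongr
        exact le_add_of_nonneg_right (exp_pos _).le
    _ ≤ integratingFactor x τ := cosh_le_integratingFactor hx hτ

theorem tendsto_flow (hx : 0 ≤ x.1 + x.2) : Tendsto (flow x) atTop (𝓝 PM) := by
  have hQ := tendsto_integratingFactor hx
  have hnum : Tendsto (fun τ => (x.1 + x.2 - 1) * exp (-τ) - x.2) atTop (𝓝 _) :=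
    (tendsto_exp_neg_atTop_nhds_zero.const_mul _).sub_const _
  have hfst : Tendsto (fun τ => (flow x τ).1 - 1) atTop (𝓝 0) := by
    refine (hnum.div_atTop hQ).congr' ?_
    filter_upwards [eventually_ge_atTop 0] with τ hτ
    rw [flow_fst_sub_one (integratingFactor_pos hx hτ).ne']
  exact (tendsto_sub_nhds_zero_iff.1 hfst).prodMk_nhds (hQ.const_div_atTop x.2)

end Attraction

theorem isStable_PM : IsStable field univ PM := by
  intro ε hε
  refine ⟨min (ε / 3) (1 / 2), by positivity, fun T γ hγ h₀ τ hτ => ?_⟩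
  obtain ⟨-, heq⟩ := eq_flow_of_hasDerivWithinAt (fun t ht => (hγ t ht).1)
    (left_mem_Icc.2 (hτ.1.trans hτ.2)) hτ
  have hw := add_nonneg_of_dist_PM_lt (h₀.trans_le (min_le_right _ _))
  calc dist (γ τ) PM ≤ 3 * dist (γ 0) PM := by
        rw [heq, sub_zero]
        exact dist_flow_PM_le hw hτ.1
    _ < ε := by linarith [h₀.trans_le (min_le_left _ _)]

theorem isAsymptoticallyStable_PM : IsAsymptoticallyStable field univ PM := by
  refine ⟨isStable_PM, 1 / 2, by norm_num, fun x _ hx => ?_⟩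
  have hw := add_nonneg_of_dist_PM_lt hx
  exact ⟨flow x, flow_zero x, fun τ hτ =>
    ⟨(hasDerivAt_flow (integratingFactor_pos hw hτ).ne').hasDerivWithinAt, mem_univ _⟩,
    tendsto_flow hw⟩

section Negation

variable {v v' : ℝ × ℝ → ℝ × ℝ} {S : Set (ℝ × ℝ)} {P : ℝ × ℝ}

theorem IsStable.neg (h : IsStable v S P) (hv : ∀ x, v' (-x) = -v x) : IsStable v' (-S) (-P) := by
  intro ε hε
  obtain ⟨δ, hδ, hstable⟩ := h ε hε
  have hv' (x) : v (-x) = -v' x := by rw [← neg_eq_iff_eq_neg, ← hv, neg_neg]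
  have hdist (x : ℝ × ℝ) : dist (-x) P = dist x (-P) := by rw [← dist_neg_neg, neg_neg]
  refine ⟨δ, hδ, fun T γ hγ h₀ τ hτ => ?_⟩
  rw [← hdist] at h₀ ⊢
  refine hstable T (-γ) (fun t ht => ⟨?_, (hγ t ht).2⟩) h₀ τ hτ
  rw [Pi.neg_apply, hv']
  exact (hγ t ht).1.neg

theorem IsAsymptoticallyStable.neg (h : IsAsymptoticallyStable v S P)
    (hv : ∀ x, v' (-x) = -v x) : IsAsymptoticallyStable v' (-S) (-P) := by
  refine ⟨h.1.neg hv, ?_⟩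
  obtain ⟨δ, hδ, hattract⟩ := h.2
  refine ⟨δ, hδ, fun x hx hdist => ?_⟩
  obtain ⟨γ, h₀, hγ, hlim⟩ := hattract (-x) hx (by rwa [← dist_neg_neg, neg_neg])
  refine ⟨-γ, by rw [Pi.neg_apply, h₀, neg_neg], fun t ht => ⟨?_, ?_⟩, hlim.neg⟩
  · rw [Pi.neg_apply, hv]
    exact (hγ t ht).1.neg
  · exact Set.neg_mem_neg.2 (hγ t ht).2

end Negation

theorem isAsymptoticallyStable_PMbar :
    IsAsymptoticallyStable (fun x => -field x) univ PMbar := by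
  rw [← neg_PM, ← Set.neg_univ]
  exact isAsymptoticallyStable_PM.neg fun x => by rw [field_neg]

/-! ### The Poincaré compactification -/

/-- The norm of `(1, x₂, x₃)`, by which the Poincaré map divides. -/
def poincareNorm (x : ℝ × ℝ) : ℝ := √(1 + x.1 ^ 2 + x.2 ^ 2)

theorem poincareNorm_pos (x : ℝ × ℝ) : 0 < poincareNorm x := Real.sqrt_pos.2 (by positivity)

theorem poincareNorm_sq (x : ℝ × ℝ) : poincareNorm x ^ 2 = 1 + x.1 ^ 2 + x.2 ^ 2 :=
  Real.sq_sqrt (by positivity)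

theorem toPoincare_eq_smul (x : ℝ × ℝ) : toPoincare x = (poincareNorm x)⁻¹ • x :=
  Prod.ext (div_eq_inv_mul _ _) (div_eq_inv_mul _ _)

theorem one_sub_normSq_toPoincare (x : ℝ × ℝ) :
    1 - (toPoincare x).1 ^ 2 - (toPoincare x).2 ^ 2 = (poincareNorm x ^ 2)⁻¹ := by
  have hN := (poincareNorm_pos x).ne'
  simp only [toPoincare_eq_smul, Prod.smul_fst, Prod.smul_snd, smul_eq_mul]
  field_simp
  linear_combination poincareNorm_sq x

theorem toPoincare_neg (x : ℝ × ℝ) : toPoincare (-x) = -toPoincare x := by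
  simp [toPoincare, neg_div]

theorem toPoincare_mem_iff (x : ℝ × ℝ) : toPoincare x ∈ poincareSpace ↔ x ∈ phaseSpace := by
  have hN := pow_pos (poincareNorm_pos x) 2
  have hle : (toPoincare x).1 ^ 2 + (toPoincare x).2 ^ 2 ≤ 1 := by
    linarith [one_sub_normSq_toPoincare x, inv_pos.2 hN]
  have hform : 2 * (toPoincare x).1 ^ 2 + 2 * (toPoincare x).1 * (toPoincare x).2
      + (toPoincare x).2 ^ 2 = (2 * x.1 ^ 2 + 2 * x.1 * x.2 + x.2 ^ 2) / poincareNorm x ^ 2 := by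
    simp only [toPoincare_eq_smul, Prod.smul_fst, Prod.smul_snd, smul_eq_mul]
    ring
  simp only [poincareSpace, phaseSpace, mem_ofPred_eq, hform, hle, and_true, one_le_div hN]
  rw [poincareNorm_sq]
  constructor <;> intro <;> linarith

theorem toPoincare_injective : Function.Injective toPoincare := by
  intro x y hxy
  have hsq := one_sub_normSq_toPoincare x
  rw [hxy, one_sub_normSq_toPoincare y, inv_inj,
    pow_left_inj₀ (poincareNorm_pos y).le (poincareNorm_pos x).le two_ne_zero] at hsq
  rw [toPoincare_eq_smul, toPoincare_eq_smul, hsq] at hxy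
  exact smul_right_injective _ (inv_pos.2 (poincareNorm_pos x)).ne' hxy

theorem toPoincare_inv_sqrt_smul {X : ℝ × ℝ} (hX : 0 < 1 - X.1 ^ 2 - X.2 ^ 2) :
    toPoincare ((√(1 - X.1 ^ 2 - X.2 ^ 2))⁻¹ • X) = X := by
  have hs := Real.sqrt_pos.2 hX
  have hnorm : poincareNorm ((√(1 - X.1 ^ 2 - X.2 ^ 2))⁻¹ • X) = (√(1 - X.1 ^ 2 - X.2 ^ 2))⁻¹ := by
    rw [← pow_left_inj₀ (poincareNorm_pos _).le (inv_pos.2 hs).le two_ne_zero, poincareNorm_sq]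
    simp only [Prod.smul_fst, Prod.smul_snd, smul_eq_mul, mul_pow, inv_pow, Real.sq_sqrt hX.le]
    field_simp
    ring
  rw [toPoincare_eq_smul, hnorm, inv_inv, smul_inv_smul₀ hs.ne']

theorem bijOn_toPoincare : BijOn toPoincare phaseSpace (poincareSpace \ atInfinity) := by
  refine ⟨fun x hx => ⟨(toPoincare_mem_iff x).2 hx, fun h => ?_⟩, toPoincare_injective.injOn,
    fun X hX => ?_⟩
  · have hinv := inv_pos.2 (pow_pos (poincareNorm_pos x) 2)
    linarith [one_sub_normSq_toPoincare x, h.2]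
  · have hlt : X.1 ^ 2 + X.2 ^ 2 < 1 := hX.1.2.lt_of_ne fun h => hX.2 ⟨hX.1, h⟩
    have hinv := toPoincare_inv_sqrt_smul (X := X) (by linarith)
    exact ⟨_, (toPoincare_mem_iff _).1 (hinv.symm ▸ hX.1), hinv⟩

theorem hasFDerivAt_poincareNorm (x : ℝ × ℝ) :
    HasFDerivAt poincareNorm ((poincareNorm x)⁻¹ •
      (x.1 • ContinuousLinearMap.fst ℝ ℝ ℝ + x.2 • ContinuousLinearMap.snd ℝ ℝ ℝ)) x := by
  have hfst : HasFDerivAt Prod.fst (ContinuousLinearMap.fst ℝ ℝ ℝ) x := hasFDerivAt_fst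
  have hsnd : HasFDerivAt Prod.snd (ContinuousLinearMap.snd ℝ ℝ ℝ) x := hasFDerivAt_snd
  have hsq : 1 + x.1 ^ 2 + x.2 ^ 2 ≠ 0 := by positivity
  refine ((((hfst.pow 2).const_add 1).add (hsnd.pow 2)).sqrt hsq).congr_fderiv ?_
  ext <;> simp [poincareNorm] <;> field_simp

theorem hasFDerivAt_toPoincare (x : ℝ × ℝ) :
    HasFDerivAt toPoincare ((poincareNorm x)⁻¹ • ContinuousLinearMap.id ℝ (ℝ × ℝ) -
      ((poincareNorm x ^ 3)⁻¹ • (x.1 • ContinuousLinearMap.fst ℝ ℝ ℝ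
        + x.2 • ContinuousLinearMap.snd ℝ ℝ ℝ)).smulRight x) x := by
  have hN := (poincareNorm_pos x).ne'
  rw [funext toPoincare_eq_smul]
  refine (((hasDerivAt_inv hN).comp_hasFDerivAt x (hasFDerivAt_poincareNorm x)).smul
    (hasFDerivAt_id x)).congr_fderiv ?_
  ext <;> simp <;> field_simp <;> simp [sub_eq_add_neg]

theorem fderiv_toPoincare_field (x : ℝ × ℝ) :
    √(1 - (toPoincare x).1 ^ 2 - (toPoincare x).2 ^ 2) • fderiv ℝ toPoincare x (field x)
        = poincareField (toPoincare x) := by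
  have hN := poincareNorm_pos x
  rw [(hasFDerivAt_toPoincare x).fderiv, poincareField, one_sub_normSq_toPoincare,
    Real.sqrt_inv, Real.sqrt_sq hN.le, toPoincare_eq_smul]
  ext
  · simp [field]
    field_simp
    linear_combination (-(x.1 * (x.1 + x.2))) * poincareNorm_sq x
  · simp [field]
    field_simp
    linear_combination (-(x.2 * (x.1 + x.2))) * poincareNorm_sq x

/-! ### Points at infinity -/

theorem poincareField_eq_zero {X : ℝ × ℝ} (hX : X ∈ atInfinity) : poincareField X = 0 := by
  have hzero : 1 - X.1 ^ 2 - X.2 ^ 2 = 0 := by linarith [hX.2]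
  ext <;> simp [poincareField, hzero]

theorem mem_atInfinity_iff {X : ℝ × ℝ} :
    X ∈ atInfinity ↔ X.1 ^ 2 + X.2 ^ 2 = 1 ∧ 0 ≤ X.1 * (X.1 + 2 * X.2) := by
  simp only [atInfinity, poincareSpace, mem_ofPred_eq]
  constructor
  · rintro ⟨⟨h, -⟩, hX⟩
    exact ⟨hX, by linarith⟩
  · rintro ⟨hX, h⟩
    exact ⟨⟨by linarith, hX.le⟩, hX⟩

theorem neg_PH : -PH = PHbar := by simp [PH, PHbar]

theorem neg_PS : -PS = PSbar := by simp [PS, PSbar]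

theorem PS_fst : PS.1 = -2 * PS.2 := by
  simp only [PS]
  ring

theorem PS_snd_sq : PS.2 ^ 2 = 1 / 5 := by
  norm_num [PS]

theorem PS_snd_neg : PS.2 < 0 := neg_neg_of_pos (by positivity)

theorem mem_rightArc_iff {X : ℝ × ℝ} :
    X ∈ rightArc ↔ X.1 ^ 2 + X.2 ^ 2 = 1 ∧ 0 ≤ X.1 ∧ 0 ≤ X.1 + 2 * X.2 := by
  change X.1 ^ 2 + X.2 ^ 2 = 1 ∧ 0 ≤ X.1 ∧ PS.2 ≤ X.2 ↔ _
  refine and_congr_right fun hX => and_congr_right fun h₁ => ⟨fun h₂ => ?_, fun h₂ => ?_⟩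
  · have hsq : 0 ≤ X.1 ^ 2 - (2 * X.2) ^ 2 ∨ 0 ≤ X.2 := by
      refine (le_total 0 X.2).symm.imp_left fun h => ?_
      nlinarith [PS_snd_sq]
    rcases hsq with hsq | hsq
    · linarith [(abs_le_of_sq_le_sq' (sub_nonneg.1 hsq) h₁).1]
    · positivity
  · by_contra! h
    nlinarith [PS_snd_sq, PS_snd_neg]

theorem atInfinity_eq : atInfinity = rightArc ∪ leftArc := by
  ext X
  rw [mem_union, leftArc, mem_ofPred_eq, mem_rightArc_iff, mem_rightArc_iff, mem_atInfinity_iff,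
    mul_nonneg_iff]
  simp only [Prod.fst_neg, Prod.snd_neg, neg_sq, ← and_or_left, neg_nonneg]
  refine and_congr_right fun _ => or_congr_right (and_congr_right fun _ => ?_)
  constructor <;> intro <;> linarith

theorem disjoint_rightArc_leftArc : Disjoint rightArc leftArc := by
  refine Set.disjoint_left.2 fun X hright hleft => ?_
  obtain ⟨hX, h₁, h₂⟩ := mem_rightArc_iff.1 hright
  obtain ⟨-, h₁', h₂'⟩ := mem_rightArc_iff.1 hleft
  simp only [Prod.fst_neg, Prod.snd_neg] at h₁' h₂'
  have hX₂ : X.1 = 0 := by linarith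
  have hX₃ : X.2 = 0 := by linarith
  norm_num [hX₂, hX₃] at hX

theorem neg_mem_leftArc {X : ℝ × ℝ} : -X ∈ leftArc ↔ X ∈ rightArc := by
  rw [leftArc, mem_ofPred_eq, neg_neg]

theorem PH_mem_rightArc : PH ∈ rightArc := mem_rightArc_iff.2 (by norm_num [PH])

theorem PS_mem_rightArc : PS ∈ rightArc := by
  refine mem_rightArc_iff.2 ⟨?_, ?_, ?_⟩
  · linear_combination (PS.1 - 2 * PS.2) * PS_fst + 5 * PS_snd_sq
  · linarith [PS_fst, PS_snd_neg]
  · linarith [PS_fst]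

theorem PHbar_mem_leftArc : PHbar ∈ leftArc := neg_PH ▸ neg_mem_leftArc.2 PH_mem_rightArc

theorem PSbar_mem_leftArc : PSbar ∈ leftArc := neg_PS ▸ neg_mem_leftArc.2 PS_mem_rightArc

theorem boundary_iff_of_mem_rightArc {X : ℝ × ℝ} (hX : X ∈ rightArc) :
    2 * X.1 ^ 2 + 2 * X.1 * X.2 + X.2 ^ 2 = 1 ↔ X = PH ∨ X = PS := by
  obtain ⟨hcircle, h₁, h₂⟩ := mem_rightArc_iff.1 hX
  constructor
  · intro h
    have hmul : X.1 * (X.1 + 2 * X.2) = 0 := by linarith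
    rcases mul_eq_zero.1 hmul with hX₂ | hX₂
    · have hX₃ : X.2 ^ 2 = 1 ^ 2 := by simpa [hX₂] using hcircle
      exact .inl (Prod.ext hX₂ ((pow_left_inj₀ (by linarith) zero_le_one two_ne_zero).1 hX₃))
    · have hX₃ : (-X.2) ^ 2 = (-PS.2) ^ 2 := by
        rw [neg_sq, neg_sq, PS_snd_sq]
        linear_combination hcircle / 5 - (X.1 - 2 * X.2) / 5 * hX₂
      have hX₃' : X.2 = PS.2 := neg_injective ((pow_left_inj₀ (by linarith)
        (neg_nonneg.2 PS_snd_neg.le) two_ne_zero).1 hX₃)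
      exact .inr (Prod.ext (by linarith [PS_fst]) hX₃')
  · rintro (rfl | rfl)
    · norm_num [PH]
    · linear_combination 2 * (PS.1 - PS.2) * PS_fst + 5 * PS_snd_sq

theorem atInfinity_boundary :
    {X | X ∈ atInfinity ∧ 2 * X.1 ^ 2 + 2 * X.1 * X.2 + X.2 ^ 2 = 1} = {PH, PHbar, PS, PSbar} := by
  ext X
  have hleft (hX : X ∈ leftArc) :
      2 * X.1 ^ 2 + 2 * X.1 * X.2 + X.2 ^ 2 = 1 ↔ X = PHbar ∨ X = PSbar := by
    have h := boundary_iff_of_mem_rightArc (X := -X) hX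
    rwa [Prod.fst_neg, Prod.snd_neg, neg_sq, neg_sq, mul_neg 2, neg_mul_neg, neg_eq_iff_eq_neg,
      neg_eq_iff_eq_neg, neg_PH, neg_PS] at h
  simp only [mem_ofPred_eq, mem_insert_iff, mem_singleton_iff, atInfinity_eq, mem_union]
  constructor
  · rintro ⟨hX | hX, h⟩
    · have := (boundary_iff_of_mem_rightArc hX).1 h
      tauto
    · have := (hleft hX).1 h
      tauto
  · rintro (rfl | rfl | rfl | rfl)
    · exact ⟨.inl PH_mem_rightArc, (boundary_iff_of_mem_rightArc PH_mem_rightArc).2 (.inl rfl)⟩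
    · exact ⟨.inr PHbar_mem_leftArc, (hleft PHbar_mem_leftArc).2 (.inl rfl)⟩
    · exact ⟨.inl PS_mem_rightArc, (boundary_iff_of_mem_rightArc PS_mem_rightArc).2 (.inr rfl)⟩
    · exact ⟨.inr PSbar_mem_leftArc, (hleft PSbar_mem_leftArc).2 (.inr rfl)⟩

/-! ### Stability of points at infinity -/

theorem exists_first_eq {d : ℝ → ℝ} {a b ε : ℝ} (hab : a ≤ b) (hd : ContinuousOn d (Icc a b))
    (ha : d a < ε) (hb : ε ≤ d b) :
    ∃ m ∈ Icc a b, d m = ε ∧ ∀ s ∈ Ico a m, d s < ε := by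
  have hcompact : IsCompact (Icc a b ∩ d ⁻¹' Ici ε) :=
    isCompact_Icc.of_isClosed_subset (hd.preimage_isClosed_of_isClosed isClosed_Icc isClosed_Ici)
      inter_subset_left
  obtain ⟨m, ⟨hm, hdm⟩, hleast⟩ :=
    hcompact.exists_isLeast ⟨b, right_mem_Icc.2 hab, hb⟩
  have hbefore : ∀ s ∈ Ico a m, d s < ε := fun s hs => by
    by_contra! h
    exact hs.2.not_ge (hleast ⟨⟨hs.1, hs.2.le.trans hm.2⟩, h⟩)
  obtain ⟨s, hs, hds⟩ :=
    intermediate_value_Icc hm.1 (hd.mono (Icc_subset_Icc_right hm.2)) ⟨ha.le, hdm⟩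
  rcases hs.2.eq_or_lt with rfl | hlt
  · exact ⟨s, hm, hds, hbefore⟩
  · exact absurd hds (hbefore s ⟨hs.1, hlt⟩).ne

section Lyapunov

variable {v : ℝ × ℝ → ℝ × ℝ} {S : Set (ℝ × ℝ)} {P : ℝ × ℝ} {V : ℝ × ℝ → ℝ}

theorem le_of_fderiv_nonneg_along (hV : Differentiable ℝ V) {γ : ℝ → ℝ × ℝ} {a b : ℝ}
    (hab : a ≤ b) (hγ : ∀ τ ∈ Icc a b, HasDerivWithinAt γ (v (γ τ)) (Icc a b) τ)
    (hnonneg : ∀ τ ∈ Ico a b, 0 ≤ fderiv ℝ V (γ τ) (v (γ τ))) : V (γ a) ≤ V (γ b) := by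
  have hderiv (τ) (hτ : τ ∈ Icc a b) := (hV (γ τ)).hasFDerivAt.comp_hasDerivWithinAt τ (hγ τ hτ)
  refine monotoneOn_of_hasDerivWithinAt_nonneg (convex_Icc a b)
    (fun τ hτ => (hderiv τ hτ).continuousWithinAt)
    (fun τ hτ => (hderiv τ (interior_subset hτ)).mono interior_subset) (fun τ hτ => ?_)
    (left_mem_Icc.2 hab) (right_mem_Icc.2 hab) hab
  rw [interior_Icc] at hτ
  exact hnonneg τ (Ioo_subset_Ico_self hτ)

theorem exists_forall_sphere_lt (hS : IsClosed S) (hV : Differentiable ℝ V) {ε : ℝ}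
    (hε : ∀ X ∈ Metric.sphere P ε ∩ S, V X < V P) :
    ∃ δ > 0, ∀ X, dist X P < δ → ∀ Y ∈ Metric.sphere P ε ∩ S, V Y < V X := by
  rcases (Metric.sphere P ε ∩ S).eq_empty_or_nonempty with hempty | hne
  · exact ⟨1, one_pos, by simp [hempty]⟩
  obtain ⟨Z, hZ, hZmax⟩ :=
    ((isCompact_sphere P ε).inter_right hS).exists_isMaxOn hne hV.continuous.continuousOn
  obtain ⟨δ, hδ, h⟩ := Metric.eventually_nhds_iff.1
    ((hV P).continuousAt.tendsto.eventually_const_lt (hε Z hZ))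
  exact ⟨δ, hδ, fun X hX Y hY => (hZmax hY).trans_lt (h hX)⟩

theorem isStable_of_lyapunov (hS : IsClosed S) (hV : Differentiable ℝ V)
    (hmax : ∀ᶠ X in 𝓝[S] P, X ≠ P → V X < V P)
    (hmono : ∀ᶠ X in 𝓝[S] P, 0 ≤ fderiv ℝ V X (v X)) : IsStable v S P := by
  intro ε hε
  obtain ⟨ρ, hρ, hball⟩ := Metric.mem_nhdsWithin_iff.1 (hmax.and hmono)
  set ε' := min ε (ρ / 2)
  have hε' : 0 < ε' := by positivity
  have hε'ρ : ε' < ρ := (min_le_right _ _).trans_lt (half_lt_self hρ)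
  obtain ⟨δ, hδ, hδV⟩ := exists_forall_sphere_lt hS hV fun X hX =>
    (hball ⟨(Metric.mem_sphere.1 hX.1).trans_lt hε'ρ, hX.2⟩).1
      (Metric.ne_of_mem_sphere hX.1 hε'.ne')
  refine ⟨min δ ε', by positivity, fun T γ hγ h₀ τ hτ => ?_⟩
  by_contra! hfar
  have hcont : ContinuousOn (fun t => dist (γ t) P) (Icc 0 τ) := fun t ht =>
    ((hγ t (Icc_subset_Icc_right hτ.2 ht)).1.continuousWithinAt.mono
      (Icc_subset_Icc_right hτ.2)).dist continuousWithinAt_const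
  obtain ⟨m, hm, hdist, hbefore⟩ := exists_first_eq hτ.1 hcont (h₀.trans_le (min_le_right _ _))
    ((min_le_left _ _).trans hfar)
  have hmem : ∀ t ∈ Icc 0 m, t ∈ Icc 0 T := fun t ht => ⟨ht.1, ht.2.trans (hm.2.trans hτ.2)⟩
  have hle : V (γ 0) ≤ V (γ m) := le_of_fderiv_nonneg_along hV hm.1
    (fun t ht => (hγ t (hmem t ht)).1.mono hmem) fun t ht =>
      (hball ⟨(hbefore t ht).trans hε'ρ, (hγ t (hmem t (Ico_subset_Icc_self ht))).2⟩).2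
  exact hle.not_gt (hδV (γ 0) (h₀.trans_le (min_le_left _ _)) (γ m)
    ⟨hdist, (hγ m (hmem m (right_mem_Icc.2 hm.1))).2⟩)

end Lyapunov

theorem isClosed_poincareSpace : IsClosed poincareSpace := by
  simp only [poincareSpace, ofPred_and]
  exact (isClosed_le (by fun_prop) (by fun_prop)).inter
    (isClosed_le (by fun_prop) (by fun_prop))

theorem fst_mul_nonneg_of_mem_poincareSpace {X : ℝ × ℝ} (hX : X ∈ poincareSpace) :
    0 ≤ X.1 * (X.1 + 2 * X.2) := by
  linarith [hX.1, hX.2]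

section LinearLyapunov

/-- The Lyapunov function `X₂ + b X₃ + X₂² + X₃²` for the end points of the left arc, where `b` is
chosen such that its linear part vanishes at the end point. -/
def lyapunov (b : ℝ) (X : ℝ × ℝ) : ℝ := X.1 + b * X.2 + (X.1 ^ 2 + X.2 ^ 2)

variable {b : ℝ}

theorem differentiable_lyapunov : Differentiable ℝ (lyapunov b) := by
  unfold lyapunov
  fun_prop

theorem fderiv_lyapunov_poincareField (X : ℝ × ℝ) :
    fderiv ℝ (lyapunov b) X (poincareField X) = (1 - X.1 ^ 2 - X.2 ^ 2) *
      (1 - (2 * X.1 + X.2) * (X.1 + b * X.2) +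
        2 * (X.1 * (1 - 2 * (X.1 ^ 2 + X.2 ^ 2)) - X.2 * (X.1 ^ 2 + X.2 ^ 2))) := by
  have hfst : HasFDerivAt Prod.fst (ContinuousLinearMap.fst ℝ ℝ ℝ) X := hasFDerivAt_fst
  have hsnd : HasFDerivAt Prod.snd (ContinuousLinearMap.snd ℝ ℝ ℝ) X := hasFDerivAt_snd
  have hV : HasFDerivAt (lyapunov b) _ X :=
    (hfst.add (hsnd.const_mul b)).add ((hfst.pow 2).add (hsnd.pow 2))
  rw [hV.fderiv]
  simp [poincareField]
  ring

theorem eq_of_mem_circle_of_linear_eq_zero {X P : ℝ × ℝ} (hP : P.1 ^ 2 + P.2 ^ 2 = 1)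
    (hX : X.1 ^ 2 + X.2 ^ 2 = 1) (hPb : P.1 + b * P.2 = 0) (hXb : X.1 + b * X.2 = 0)
    (hneg : X ≠ -P) : X = P := by
  have hsq : X.2 ^ 2 = P.2 ^ 2 := by
    have hb : (1 + b ^ 2) * X.2 ^ 2 = (1 + b ^ 2) * P.2 ^ 2 := by
      linear_combination hX - hP - (X.1 - b * X.2) * hXb + (P.1 - b * P.2) * hPb
    exact mul_left_cancel₀ (by positivity) hb
  rcases sq_eq_sq_iff_eq_or_eq_neg.1 hsq with h | h
  · exact Prod.ext (by linear_combination hXb - hPb - b * h) h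
  · exact absurd (Prod.ext (by simp; linear_combination hXb + hPb - b * h) h) hneg

theorem isStable_of_linear_nonpos {P : ℝ × ℝ} (hP : P.1 ^ 2 + P.2 ^ 2 = 1)
    (hsum : P.1 + P.2 < 0) (hPb : P.1 + b * P.2 = 0)
    (hb : ∀ᶠ X in 𝓝[poincareSpace] P, X.1 + b * X.2 ≤ 0) :
    IsStable poincareField poincareSpace P := by
  refine isStable_of_lyapunov isClosed_poincareSpace (differentiable_lyapunov (b := b)) ?_ ?_
  · have hne : P ≠ -P := self_ne_neg.2 fun h => by simp [h] at hP
    filter_upwards [hb, self_mem_nhdsWithin, nhdsWithin_le_nhds (eventually_ne_nhds hne)]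
      with X hXb hX hXP hXne
    have hle : lyapunov b X ≤ lyapunov b P := by
      rw [lyapunov, lyapunov, hP, hPb]
      exact add_le_add hXb hX.2
    refine hle.lt_of_ne fun heq => hXne ?_
    rw [lyapunov, lyapunov, hP, hPb] at heq
    exact eq_of_mem_circle_of_linear_eq_zero hP (by linarith [hX.2]) hPb (by linarith [hX.2]) hXP
  · have hrate : ∀ᶠ X in 𝓝 P, 0 < 1 - (2 * X.1 + X.2) * (X.1 + b * X.2) +
        2 * (X.1 * (1 - 2 * (X.1 ^ 2 + X.2 ^ 2)) - X.2 * (X.1 ^ 2 + X.2 ^ 2)) := by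
      refine Tendsto.eventually_const_lt ?_ (Continuous.tendsto (by fun_prop) P)
      rw [hP, hPb]
      linarith
    filter_upwards [nhdsWithin_le_nhds hrate, self_mem_nhdsWithin] with X hX hXS
    rw [fderiv_lyapunov_poincareField]
    exact mul_nonneg (by linarith [hXS.2]) hX.le

end LinearLyapunov

theorem isStable_PHbar : IsStable poincareField poincareSpace PHbar := by
  refine isStable_of_linear_nonpos (b := 0) (by norm_num [PHbar]) (by norm_num [PHbar])
    (by norm_num [PHbar]) ?_
  have hneg : ∀ᶠ X in 𝓝 PHbar, X.1 + 2 * X.2 < 0 :=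
    Tendsto.eventually_lt_const (by norm_num [PHbar]) (Continuous.tendsto (by fun_prop) _)
  filter_upwards [nhdsWithin_le_nhds hneg, self_mem_nhdsWithin] with X hX hXS
  rw [zero_mul, add_zero]
  exact nonpos_of_mul_nonneg_left (fst_mul_nonneg_of_mem_poincareSpace hXS) hX

theorem isStable_PSbar : IsStable poincareField poincareSpace PSbar := by
  have hfst : PSbar.1 = -2 * PSbar.2 := by
    rw [← neg_PS, Prod.fst_neg, Prod.snd_neg, PS_fst, mul_neg]
  have hsnd : 0 < PSbar.2 := by
    rw [← neg_PS]
    exact neg_pos.2 PS_snd_neg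
  have hcircle : PSbar.1 ^ 2 + PSbar.2 ^ 2 = 1 := by
    simpa [← neg_PS] using PS_mem_rightArc.1
  refine isStable_of_linear_nonpos (b := 2) hcircle (by linarith) (by linarith) ?_
  have hneg : ∀ᶠ X in 𝓝 PSbar, X.1 < 0 :=
    Tendsto.eventually_lt_const (by linarith) (Continuous.tendsto (by fun_prop) _)
  filter_upwards [nhdsWithin_le_nhds hneg, self_mem_nhdsWithin] with X hX hXS
  exact nonpos_of_mul_nonneg_right (fst_mul_nonneg_of_mem_poincareSpace hXS) hX

/-! ### Orbits and their end points at infinity -/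

/-- The point at infinity at which `orbit c` starts. -/
def endpoint (c : ℝ) : ℝ × ℝ := ((1 - c) / √((1 - c) ^ 2 + c ^ 2), c / √((1 - c) ^ 2 + c ^ 2))

theorem sq_one_sub_add_sq_pos (c : ℝ) : 0 < (1 - c) ^ 2 + c ^ 2 := by
  linarith [sq_nonneg (2 * c - 1)]

theorem endpoint_normSq (c : ℝ) : (endpoint c).1 ^ 2 + (endpoint c).2 ^ 2 = 1 := by
  have hpos := sq_one_sub_add_sq_pos c
  rw [endpoint, div_pow, div_pow, Real.sq_sqrt hpos.le, ← add_div, div_self hpos.ne']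

theorem endpoint_snd_div_add (c : ℝ) : (endpoint c).2 / ((endpoint c).1 + (endpoint c).2) = c := by
  have hpos := Real.sqrt_pos.2 (sq_one_sub_add_sq_pos c)
  rw [endpoint, ← add_div, sub_add_cancel, div_div_div_cancel_right₀ hpos.ne', div_one]

theorem endpoint_injective : Function.Injective endpoint :=
  Function.LeftInverse.injective (g := fun Q : ℝ × ℝ => Q.2 / (Q.1 + Q.2))
    endpoint_snd_div_add

theorem endpoint_snd_div_fst (c : ℝ) : (endpoint c).2 / (endpoint c).1 = c / (1 - c) :=
  div_div_div_cancel_right₀ (Real.sqrt_pos.2 (sq_one_sub_add_sq_pos c)).ne' _ _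

theorem endpoint_mem_rightArc {c : ℝ} (hc : |c| ≤ 1) : endpoint c ∈ rightArc := by
  obtain ⟨hc₁, hc₂⟩ := abs_le.1 hc
  refine mem_rightArc_iff.2 ⟨endpoint_normSq c, ?_, ?_⟩
  · exact div_nonneg (sub_nonneg.2 hc₂) (Real.sqrt_nonneg _)
  · rw [endpoint, ← mul_div_assoc, ← add_div]
    exact div_nonneg (by linarith) (Real.sqrt_nonneg _)

theorem exists_endpoint {Q : ℝ × ℝ} (hQ : Q ∈ rightArc) : ∃ c, |c| ≤ 1 ∧ Q = endpoint c := by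
  obtain ⟨hcircle, h₁, h₂⟩ := mem_rightArc_iff.1 hQ
  have hw : 0 < Q.1 + Q.2 := by
    by_contra! hw
    have hfst : Q.1 = 0 := by linarith
    have hsnd : Q.2 = 0 := by linarith
    simp [hfst, hsnd] at hcircle
  refine ⟨Q.2 / (Q.1 + Q.2), ?_, ?_⟩
  · rw [abs_div, abs_of_pos hw, div_le_one hw, abs_le]
    constructor <;> linarith
  · have hone_sub : 1 - Q.2 / (Q.1 + Q.2) = Q.1 / (Q.1 + Q.2) := by
      field_simp
      ring
    rw [endpoint, hone_sub, div_pow, div_pow, ← add_div, hcircle, Real.sqrt_div zero_le_one,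
      Real.sqrt_one, Real.sqrt_sq hw.le]
    ext <;> field_simp

theorem endpoint_one : endpoint 1 = PH := by
  norm_num [endpoint, PH]

theorem endpoint_neg_one : endpoint (-1) = PS := by
  norm_num [endpoint, PS, neg_div]

theorem toPoincare_orbit (c : ℝ) {s : ℝ} (hs : 0 < s) :
    toPoincare (orbit c s) = ((cosh s - c) / √(sinh s ^ 2 + (cosh s - c) ^ 2 + c ^ 2),
      c / √(sinh s ^ 2 + (cosh s - c) ^ 2 + c ^ 2)) := by
  have hsinh : 0 < sinh s := sinh_pos_iff.2 hs
  have hnorm : √(1 + (orbit c s).1 ^ 2 + (orbit c s).2 ^ 2) =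
      √(sinh s ^ 2 + (cosh s - c) ^ 2 + c ^ 2) / sinh s := by
    rw [← Real.sqrt_sq hsinh.le, ← Real.sqrt_div (by positivity), Real.sqrt_sq hsinh.le]
    congr 1
    simp only [orbit]
    field_simp
  rw [toPoincare, hnorm]
  simp only [orbit, div_div_div_cancel_right₀ hsinh.ne']

theorem tendsto_toPoincare_orbit (c : ℝ) :
    Tendsto (fun s => toPoincare (orbit c s)) (𝓝[>] 0) (𝓝 (endpoint c)) := by
  have hnorm : Tendsto (fun s => √(sinh s ^ 2 + (cosh s - c) ^ 2 + c ^ 2)) (𝓝[>] 0)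
      (𝓝 √((1 - c) ^ 2 + c ^ 2)) :=
    (Continuous.tendsto' (by fun_prop) 0 _ (by simp)).mono_left nhdsWithin_le_nhds
  have hnum : Tendsto (fun s => cosh s - c) (𝓝[>] 0) (𝓝 (1 - c)) :=
    (Continuous.tendsto' (by fun_prop) 0 _ (by simp)).mono_left nhdsWithin_le_nhds
  have hne := (Real.sqrt_pos.2 (sq_one_sub_add_sq_pos c)).ne'
  refine Tendsto.congr' ?_
    ((hnum.div hnorm hne).prodMk_nhds ((tendsto_const_nhds (x := c)).div hnorm hne))
  filter_upwards [self_mem_nhdsWithin] with s hs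
  exact (toPoincare_orbit c hs).symm

theorem tendsto_orbit_atTop (c : ℝ) : Tendsto (orbit c) atTop (𝓝 PM) := by
  have hw : 0 ≤ (orbit c 1).1 + (orbit c 1).2 := by
    rw [orbit, ← add_div, sub_add_cancel]
    exact div_nonneg (cosh_pos 1).le (sinh_pos_iff.2 one_pos).le
  refine ((tendsto_flow hw).comp
    (tendsto_atTop_add_const_right _ (-1) tendsto_id)).congr fun s => ?_
  simp [flow_orbit c one_ne_zero]

section EndPoints

variable {γ : ℝ → ℝ × ℝ} {J : Set ℝ} {Q : ℝ × ℝ}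

theorem goesToPM_orbit {a c : ℝ} (hc : c ≤ 1) (hγ : ∀ ξ ∈ Ioi a, γ ξ = orbit c (ξ - a)) :
    GoesToPM γ (Ioi a) (endpoint c) := by
  refine ⟨fun ξ hξ => ?_, a, rfl, ?_, ?_⟩
  · rw [hγ ξ hξ]
    exact orbit_fst_pos hc (sub_pos.2 hξ)
  · have hshift : Tendsto (fun ξ => ξ - a) (𝓝[>] a) (𝓝[>] 0) := by
      refine tendsto_nhdsWithin_iff.2 ⟨?_, ?_⟩
      · exact ((continuous_sub_right a).tendsto' a 0 (sub_self a)).mono_left nhdsWithin_le_nhds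
      · filter_upwards [self_mem_nhdsWithin] with ξ hξ
        exact sub_pos.2 (mem_Ioi.1 hξ)
    refine ((tendsto_toPoincare_orbit c).comp hshift).congr' ?_
    filter_upwards [self_mem_nhdsWithin] with ξ hξ
    rw [Function.comp_apply, hγ ξ hξ]
  · refine ((tendsto_orbit_atTop c).comp
      (tendsto_atTop_add_const_right atTop (-a) tendsto_id)).congr' ?_
    filter_upwards [eventually_gt_atTop a] with ξ hξ
    exact (hγ ξ hξ).symm

theorem IsMaximalSolution.exists_orbit_of_goesToPM (h : IsMaximalSolution γ J)
    (hQ : GoesToPM γ J Q) :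
    ∃ a c, |c| ≤ 1 ∧ J = Ioi a ∧ (∀ ξ ∈ Ioi a, γ ξ = orbit c (ξ - a)) ∧ Q = endpoint c := by
  obtain ⟨-, a, rfl, hlim, -⟩ := hQ
  rcases h.classification with ⟨hJ, -⟩ | ⟨hJ, -⟩ | ⟨a', c, hc, hJ, horbit⟩ | ⟨b, _, _, hJ, -⟩
  · exact absurd (hJ ▸ bddBelow_Ioi) not_bddBelow_univ
  · exact absurd (hJ ▸ bddBelow_Ioi) not_bddBelow_univ
  · obtain rfl := Ioi_injective hJ
    obtain ⟨-, a', hJ', hlim', -⟩ := goesToPM_orbit (le_of_abs_le hc) horbit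
    obtain rfl := Ioi_injective hJ'
    exact ⟨a, c, hc, rfl, horbit, tendsto_nhds_unique hlim hlim'⟩
  · exact absurd (hJ ▸ bddAbove_Iio) (not_bddAbove_Ioi a)

theorem ComesFromPMbar.reflect (h : ComesFromPMbar γ J Q) :
    GoesToPM (reflection γ) (-J) (-Q) := by
  obtain ⟨hneg, b, rfl, hPMbar, hlim⟩ := h
  refine ⟨fun ξ hξ => neg_pos.2 (hneg (-ξ) hξ), -b, Set.neg_Iio b, ?_, ?_⟩
  · simpa [reflection, toPoincare_neg, Function.comp_def] using
      (hlim.comp (tendsto_neg_nhdsGT_neg (a := b))).neg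
  · rw [← neg_PMbar]
    exact (hPMbar.comp tendsto_neg_atTop_atBot).neg

theorem GoesToPM.reflect (h : GoesToPM γ J Q) : ComesFromPMbar (reflection γ) (-J) (-Q) := by
  obtain ⟨hpos, a, rfl, hlim, hPM⟩ := h
  refine ⟨fun ξ hξ => neg_neg_of_pos (hpos (-ξ) hξ), -a, Set.neg_Ioi a, ?_, ?_⟩
  · rw [← neg_PM]
    exact (hPM.comp tendsto_neg_atBot_atTop).neg
  · simpa [reflection, toPoincare_neg, Function.comp_def] using
      (hlim.comp (tendsto_neg_nhdsLT_neg (a := a))).neg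

theorem IsMaximalSolution.eq_PM_or_eq_PMbar_or_goesToPM_or_comesFromPMbar
    (h : IsMaximalSolution γ J) :
    (J = univ ∧ ∀ ξ, γ ξ = PM) ∨ (J = univ ∧ ∀ ξ, γ ξ = PMbar) ∨
      (∃ Q ∈ rightArc, GoesToPM γ J Q) ∨ (∃ Q ∈ leftArc, ComesFromPMbar γ J Q) := by
  rcases h.classification with hPM | hPMbar | ⟨a, c, hc, rfl, horbit⟩ | ⟨b, c, hc, rfl, horbit⟩
  · exact .inl hPM
  · exact .inr (.inl hPMbar)
  · exact .inr (.inr (.inl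
      ⟨_, endpoint_mem_rightArc hc, goesToPM_orbit (le_of_abs_le hc) horbit⟩))
  · have hreflect : GoesToPM (reflection γ) (Ioi (-b)) (endpoint c) := by
      refine goesToPM_orbit (le_of_abs_le hc) fun ξ hξ => ?_
      rw [reflection, horbit _ (mem_Iio.2 (neg_lt.1 hξ)), ← orbit_neg, neg_sub, sub_neg_eq_add,
        sub_neg_eq_add, add_comm]
    refine .inr (.inr (.inr ⟨-endpoint c, neg_mem_leftArc.2 (endpoint_mem_rightArc hc), ?_⟩))
    simpa [reflection_reflection] using hreflect.reflect

theorem image_orbit {a c : ℝ} (hγ : ∀ ξ ∈ Ioi a, γ ξ = orbit c (ξ - a)) :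
    γ '' Ioi a = orbit c '' Ioi 0 := by
  rw [image_congr hγ, ← image_image (orbit c), image_sub_const_Ioi, sub_self]

theorem existsUnique_orbit_goesToPM (hQ : Q ∈ rightArc) :
    ∃! O : Set (ℝ × ℝ), ∃ γ J, IsMaximalSolution γ J ∧ GoesToPM γ J Q ∧ O = γ '' J := by
  obtain ⟨c, hc, rfl⟩ := exists_endpoint hQ
  refine ⟨orbit c '' Ioi 0, ⟨fun ξ => orbit c (ξ - 0), Ioi 0, isMaximalSolution_orbit hc 0,
    goesToPM_orbit (le_of_abs_le hc) fun _ _ => rfl, by simp only [sub_zero]⟩, ?_⟩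
  rintro O ⟨γ, J, hmax, hgoes, rfl⟩
  obtain ⟨a, c', -, rfl, horbit, hc'⟩ := hmax.exists_orbit_of_goesToPM hgoes
  rw [endpoint_injective hc', image_orbit horbit]

theorem image_reflection_neg (γ : ℝ → ℝ × ℝ) (J : Set ℝ) :
    reflection γ '' (-J) = -(γ '' J) := by
  simp only [← image_neg_eq_neg, image_image, reflection, neg_neg]

theorem existsUnique_orbit_comesFromPMbar (hQ : Q ∈ leftArc) :
    ∃! O : Set (ℝ × ℝ), ∃ γ J, IsMaximalSolution γ J ∧ ComesFromPMbar γ J Q ∧ O = γ '' J := by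
  obtain ⟨O, ⟨γ, J, hmax, hgoes, rfl⟩, hunique⟩ := existsUnique_orbit_goesToPM hQ
  refine ⟨reflection γ '' (-J), ⟨_, _, hmax.reflect, by simpa using hgoes.reflect, rfl⟩, ?_⟩
  rintro O ⟨γ', J', hmax', hcomes', rfl⟩
  rw [image_reflection_neg, ← hunique _ ⟨_, _, hmax'.reflect, hcomes'.reflect, rfl⟩,
    image_reflection_neg, neg_neg]

end EndPoints

/-! ### Instability of the end points of the right arc -/

theorem exists_inverse {f f' : ℝ → ℝ} {J : Set ℝ} (hJ : IsOpen J) (hJc : J.OrdConnected)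
    (hf : ∀ x ∈ J, HasDerivAt f (f' x) x) (hf' : ContinuousOn f' J) (hpos : ∀ x ∈ J, 0 < f' x) :
    StrictMonoOn f J ∧ IsOpen (f '' J) ∧
      ∃ g : ℝ → ℝ, ∀ x ∈ J, g (f x) = x ∧ HasDerivAt g (f' x)⁻¹ (f x) := by
  have hmono : StrictMonoOn f J :=
    strictMonoOn_of_hasDerivWithinAt_pos hJc.convex
      (fun x hx => (hf x hx).continuousAt.continuousWithinAt)
      (fun x hx => (hf x (interior_subset hx)).hasDerivWithinAt)
      (fun x hx => hpos x (interior_subset hx))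
  have hinv : LeftInvOn (Function.invFunOn f J) f J := hmono.injOn.leftInvOn_invFunOn
  have hstrict : ∀ x ∈ J, HasStrictDerivAt f (f' x) x := fun x hx =>
    hasStrictDerivAt_of_hasDerivAt_of_continuousAt
      (eventually_of_mem (hJ.mem_nhds hx) hf) (hf'.continuousAt (hJ.mem_nhds hx))
  refine ⟨hmono, isOpen_iff_mem_nhds.2 ?_, Function.invFunOn f J, fun x hx => ⟨hinv hx, ?_⟩⟩
  · rintro _ ⟨x, hx, rfl⟩
    rw [← (hstrict x hx).map_nhds_eq (hpos x hx).ne']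
    exact image_mem_map (hJ.mem_nhds hx)
  · exact ((hstrict x hx).to_local_left_inverse (hpos x hx).ne'
      (eventually_of_mem (hJ.mem_nhds hx) fun _ hy => hinv hy)).hasDerivAt

theorem exists_reparametrization {E : Type*} [NormedAddCommGroup E] [NormedSpace ℝ E]
    {v : E → E} {γ : ℝ → E} {N : ℝ → ℝ} {J : Set ℝ} (hJ : IsOpen J) (hJc : J.OrdConnected)
    (hN : ContinuousOn N J) (hpos : ∀ s ∈ J, 0 < N s)
    (hγ : ∀ s ∈ J, HasDerivAt γ (N s • v (γ s)) s) {a b : ℝ} (ha : a ∈ J) (hb : b ∈ J)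
    (hab : a ≤ b) :
    ∃ T ≥ 0, ∃ η : ℝ → E, η 0 = γ a ∧ η T = γ b ∧
      ∀ t ∈ Icc 0 T, HasDerivAt η (v (η t)) t ∧ η t ∈ γ '' J := by
  set τ : ℝ → ℝ := fun s => ∫ u in a..s, N u
  have hτ : ∀ s ∈ J, HasDerivAt τ (N s) s := fun s hs =>
    intervalIntegral.integral_hasDerivAt_right
      (hN.mono (hJc.uIcc_subset ha hs)).intervalIntegrable
      (hN.stronglyMeasurableAtFilter hJ s hs) (hN.continuousAt (hJ.mem_nhds hs))
  obtain ⟨hmono, -, g, hg⟩ := exists_inverse hJ hJc hτ hN hpos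
  have hτa : τ a = 0 := intervalIntegral.integral_same
  have hIcc : Icc a b ⊆ J := hJc.out ha hb
  refine ⟨τ b, hτa ▸ hmono.monotoneOn ha hb hab, γ ∘ g, ?_, ?_, fun t ht => ?_⟩
  · rw [Function.comp_apply, ← hτa, (hg a ha).1]
  · rw [Function.comp_apply, (hg b hb).1]
  · rw [← hτa] at ht
    obtain ⟨s, hs, rfl⟩ := intermediate_value_Icc hab
      (fun s hs => (hτ s (hIcc hs)).continuousAt.continuousWithinAt) ht
    obtain ⟨hgs, hg'⟩ := hg s (hIcc hs)
    have hγs := hγ s (hIcc hs)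
    rw [← hgs] at hγs
    refine ⟨(hγs.scomp (τ s) hg').congr_deriv ?_, g (τ s), hgs.symm ▸ hIcc hs, rfl⟩
    rw [hgs, inv_smul_smul₀ (hpos s (hIcc hs)).ne', Function.comp_apply, hgs]

theorem hasDerivAt_toPoincare_orbit (c : ℝ) {s : ℝ} (hs : s ≠ 0) :
    HasDerivAt (fun t => toPoincare (orbit c t))
      (poincareNorm (orbit c s) • poincareField (toPoincare (orbit c s))) s := by
  have hnorm := poincareNorm_pos (orbit c s)
  refine ((hasFDerivAt_toPoincare _).differentiableAt.hasFDerivAt.comp_hasDerivAt s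
    (hasDerivAt_orbit c hs)).congr_deriv ?_
  rw [← fderiv_toPoincare_field, one_sub_normSq_toPoincare, Real.sqrt_inv,
    Real.sqrt_sq hnorm.le, smul_inv_smul₀ hnorm.ne']

theorem toPoincare_ne_endpoint (x : ℝ × ℝ) (c : ℝ) : toPoincare x ≠ endpoint c := by
  intro h
  have hpos : 0 < (poincareNorm x ^ 2)⁻¹ := by
    have := poincareNorm_pos x
    positivity
  have hnorm := endpoint_normSq c
  have hsub := one_sub_normSq_toPoincare x
  rw [h] at hsub
  linarith

/-- The orbit runs from points arbitrarily close to `endpoint c` to the point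
`toPoincare (orbit c 1)`, which does not depend on how close one starts. -/
theorem not_isStable_endpoint {c : ℝ} (hc : |c| ≤ 1) :
    ¬ IsStable poincareField poincareSpace (endpoint c) := by
  intro hstable
  obtain ⟨δ, hδ, hstay⟩ := hstable _ (dist_pos.2 (toPoincare_ne_endpoint (orbit c 1) c))
  have hnear : ∀ᶠ s in 𝓝[>] (0 : ℝ), dist (toPoincare (orbit c s)) (endpoint c) < δ :=
    (tendsto_toPoincare_orbit c).eventually (Metric.ball_mem_nhds _ hδ)
  obtain ⟨s, hs, hs0, hs1⟩ := (hnear.and (Ioo_mem_nhdsGT (zero_lt_one' ℝ))).exists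
  have hcont : ContinuousOn (fun s => poincareNorm (orbit c s)) (Ioi 0) := fun s hs =>
    (((hasFDerivAt_poincareNorm _).comp_hasDerivAt s
      (hasDerivAt_orbit c (ne_of_gt hs))).continuousAt).continuousWithinAt
  obtain ⟨T, hT, η, hη0, hηT, hη⟩ := exists_reparametrization isOpen_Ioi ordConnected_Ioi hcont
    (fun s _ => poincareNorm_pos _)
    (fun s hs => hasDerivAt_toPoincare_orbit c (ne_of_gt hs)) hs0 (mem_Ioi.2 one_pos) hs1.le
  have hfar := hstay T η (fun t ht => ⟨(hη t ht).1.hasDerivWithinAt, ?_⟩) (hη0 ▸ hs) T ⟨hT, le_rfl⟩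
  · rw [hηT] at hfar
    exact lt_irrefl _ hfar
  · obtain ⟨u, hu, hηu⟩ := (hη t ht).2
    rw [← hηu]
    exact (toPoincare_mem_iff _).2 (orbit_mem_phaseSpace hc (ne_of_gt hu))

theorem not_isStable_PH : ¬ IsStable poincareField poincareSpace PH :=
  endpoint_one ▸ not_isStable_endpoint (by simp)

theorem not_isStable_PS : ¬ IsStable poincareField poincareSpace PS :=
  endpoint_neg_one ▸ not_isStable_endpoint (by simp)

/-! ### The spacetime of a solution -/

theorem contDiffOn_succ_of_hasDerivAt {I : Set ℝ} (hI : IsOpen I) {n : ℕ} {f f' : ℝ → ℝ}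
    (hf : ∀ ρ ∈ I, HasDerivAt f (f' ρ) ρ) (hf' : ContDiffOn ℝ n f' I) :
    ContDiffOn ℝ (n + 1 : ℕ) f I := by
  push_cast
  rw [contDiffOn_succ_iff_deriv_of_isOpen hI]
  refine ⟨fun ρ hρ => (hf ρ hρ).differentiableAt.differentiableWithinAt, by simp, ?_⟩
  exact hf'.congr fun ρ hρ => (hf ρ hρ).deriv

/-- A solution `(X, Y, V)` of the system for `(x₂, x₃, y₁)` with the area radius `ρ ∈ I` as the
independent variable, so that `f' = X ρ df/dρ`, together with the metric functions `A`, `B` and the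
scalar field `ψ` that it determines. -/
structure IsRadialSolution (I : Set ℝ) (A B X Y V ψ : ℝ → ℝ) : Prop where
  isOpen : IsOpen I
  ordConnected : I.OrdConnected
  nonempty : I.Nonempty
  pos : ∀ ρ ∈ I, 0 < ρ
  pos_X : ∀ ρ ∈ I, 0 < X ρ
  pos_A : ∀ ρ ∈ I, 0 < A ρ
  eq_B : ∀ ρ ∈ I, B ρ = X ρ ^ 2
  hasDerivAt_X : ∀ ρ ∈ I, HasDerivAt X ((1 - X ρ * (X ρ + Y ρ)) / (X ρ * ρ)) ρ
  hasDerivAt_Y : ∀ ρ ∈ I, HasDerivAt Y (-Y ρ * (X ρ + Y ρ) / (X ρ * ρ)) ρ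
  hasDerivAt_V : ∀ ρ ∈ I, HasDerivAt V (-(X ρ + Y ρ) * V ρ / (X ρ * ρ)) ρ
  hasDerivAt_A : ∀ ρ ∈ I, HasDerivAt A (2 * Y ρ / X ρ * (A ρ / ρ)) ρ
  hasDerivAt_ψ : ∀ ρ ∈ I, HasDerivAt ψ (√2 * V ρ / (X ρ * ρ)) ρ
  constraint : ∀ ρ ∈ I, V ρ ^ 2 = X ρ ^ 2 + 2 * X ρ * Y ρ - 1

namespace IsRadialSolution

variable {I : Set ℝ} {A B X Y V ψ : ℝ → ℝ} (h : IsRadialSolution I A B X Y V ψ)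
include h

theorem X_mul_ne_zero : ∀ ρ ∈ I, X ρ * ρ ≠ 0 :=
  fun ρ hρ => (mul_pos (h.pos_X ρ hρ) (h.pos ρ hρ)).ne'

theorem pos_B {ρ : ℝ} (hρ : ρ ∈ I) : 0 < B ρ := by
  rw [h.eq_B ρ hρ]
  exact pow_pos (h.pos_X ρ hρ) 2

theorem contDiffOn (n : ℕ) :
    ContDiffOn ℝ n X I ∧ ContDiffOn ℝ n Y I ∧ ContDiffOn ℝ n V I ∧ ContDiffOn ℝ n A I := by
  have hid (n : ℕ) : ContDiffOn ℝ n (fun ρ : ℝ => ρ) I := contDiff_id.contDiffOn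
  induction n with
  | zero =>
    simp only [Nat.cast_zero, contDiffOn_zero]
    exact ⟨fun ρ hρ => (h.hasDerivAt_X ρ hρ).continuousAt.continuousWithinAt,
      fun ρ hρ => (h.hasDerivAt_Y ρ hρ).continuousAt.continuousWithinAt,
      fun ρ hρ => (h.hasDerivAt_V ρ hρ).continuousAt.continuousWithinAt,
      fun ρ hρ => (h.hasDerivAt_A ρ hρ).continuousAt.continuousWithinAt⟩
  | succ n ih =>
    obtain ⟨hX, hY, hV, hA⟩ := ih
    have hXρ := hX.mul (hid n)
    exact ⟨contDiffOn_succ_of_hasDerivAt h.isOpen h.hasDerivAt_X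
        ((contDiffOn_const.sub (hX.mul (hX.add hY))).div hXρ h.X_mul_ne_zero),
      contDiffOn_succ_of_hasDerivAt h.isOpen h.hasDerivAt_Y
        ((hY.neg.mul (hX.add hY)).div hXρ h.X_mul_ne_zero),
      contDiffOn_succ_of_hasDerivAt h.isOpen h.hasDerivAt_V
        (((hX.add hY).neg.mul hV).div hXρ h.X_mul_ne_zero),
      contDiffOn_succ_of_hasDerivAt h.isOpen h.hasDerivAt_A
        (((contDiffOn_const.mul hY).div hX fun ρ hρ => (h.pos_X ρ hρ).ne').mul
          (hA.div (hid n) fun ρ hρ => (h.pos ρ hρ).ne'))⟩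

theorem contDiffOn_one_div_B : ContDiffOn ℝ 2 (fun ρ => 1 / B ρ) I :=
  contDiffOn_const.div (((h.contDiffOn 2).1.pow 2).congr h.eq_B) fun _ hρ => (h.pos_B hρ).ne'

theorem contDiffOn_ψ : ContDiffOn ℝ 2 ψ I :=
  contDiffOn_succ_of_hasDerivAt (n := 1) h.isOpen h.hasDerivAt_ψ
    ((contDiffOn_const.mul (h.contDiffOn 1).2.2.1).div
      ((h.contDiffOn 1).1.mul contDiff_id.contDiffOn) h.X_mul_ne_zero)

theorem regularAt {p : Fin 4 → ℝ} (hp : p 1 ∈ I) (hs : sin (p 2) ≠ 0) :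
    RegularAt A (fun ρ => 1 / B ρ) id p :=
  ⟨(h.contDiffOn 2).2.2.2.contDiffAt (h.isOpen.mem_nhds hp),
    h.contDiffOn_one_div_B.contDiffAt (h.isOpen.mem_nhds hp), contDiffAt_id, h.pos_A _ hp,
    one_div_pos.2 (h.pos_B hp), h.pos _ hp, hs⟩

theorem sqrt_one_div_B {ρ : ℝ} (hρ : ρ ∈ I) : √(1 / B ρ) = 1 / X ρ := by
  rw [h.eq_B ρ hρ, ← Real.sqrt_sq (one_div_pos.2 (h.pos_X ρ hρ)).le, div_pow, one_pow]

theorem normDeriv_eq_of_hasDerivAt {f : ℝ → ℝ} {f' ρ : ℝ} (hρ : ρ ∈ I)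
    (hf : HasDerivAt f (f' / (X ρ * ρ)) ρ) : normDeriv (fun ρ => 1 / B ρ) id f ρ = f' := by
  have hX := h.pos_X ρ hρ
  have hρ₀ := h.pos ρ hρ
  rw [normDeriv_eq hρ₀, h.sqrt_one_div_B hρ, hf.deriv, id]
  field_simp

theorem eqOn_x₂ : EqOn (x₂ (fun ρ => 1 / B ρ) id) X I := by
  intro ρ hρ
  have hX := h.pos_X ρ hρ
  rw [x₂_eq (h.pos ρ hρ), h.sqrt_one_div_B hρ, deriv_id]
  field_simp

theorem eqOn_x₃ : EqOn (x₃ A (fun ρ => 1 / B ρ) id) Y I := by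
  intro ρ hρ
  have hX := h.pos_X ρ hρ
  have hA := h.pos_A ρ hρ
  have hρ₀ := h.pos ρ hρ
  rw [x₃_eq hρ₀, h.sqrt_one_div_B hρ, (h.hasDerivAt_A ρ hρ).deriv, id]
  field_simp

theorem eqOn_normDeriv_ψ : EqOn (normDeriv (fun ρ => 1 / B ρ) id ψ) (fun ρ => √2 * V ρ) I :=
  fun ρ hρ => h.normDeriv_eq_of_hasDerivAt hρ (h.hasDerivAt_ψ ρ hρ)

theorem y₁_sq {ρ : ℝ} (hρ : ρ ∈ I) : y₁ (fun ρ => 1 / B ρ) id ψ ρ ^ 2 = V ρ ^ 2 := by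
  have hX := h.pos_X ρ hρ
  have hρ₀ := h.pos ρ hρ
  have hsqrt : √2 ^ 2 = (2 : ℝ) := Real.sq_sqrt zero_le_two
  rw [y₁_sq_eq (r := id) (H := fun ρ => 1 / B ρ) hρ₀ (one_div_pos.2 (h.pos_B hρ)),
    (h.hasDerivAt_ψ ρ hρ).deriv, h.eq_B ρ hρ, id]
  field_simp
  rw [hsqrt]
  ring

theorem einstein_eq {p : Fin 4 → ℝ} (hp : p 1 ∈ I) (hs : sin (p 2) ≠ 0) (a b : Fin 4) :
    einstein (staticMetric A (fun ρ => 1 / B ρ) id) a b p =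
      scalarStress (staticMetric A (fun ρ => 1 / B ρ) id) (fun q => ψ (q 1)) a b p := by
  have hI := h.isOpen.mem_nhds hp
  revert a b
  rw [einstein_eq_iff (h.regularAt hp hs), h.eqOn_x₂ hp, h.eqOn_x₃ hp, h.y₁_sq hp,
    h.normDeriv_eq_of_hasDerivAt hp
      ((h.hasDerivAt_X _ hp).congr_of_eventuallyEq (h.eqOn_x₂.eventuallyEq_of_mem hI)),
    h.normDeriv_eq_of_hasDerivAt hp
      ((h.hasDerivAt_Y _ hp).congr_of_eventuallyEq (h.eqOn_x₃.eventuallyEq_of_mem hI))]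
  exact ⟨rfl, h.constraint _ hp⟩

theorem wave_eq {p : Fin 4 → ℝ} (hp : p 1 ∈ I) (hs : sin (p 2) ≠ 0) :
    waveOperator (staticMetric A (fun ρ => 1 / B ρ) id) (fun q => ψ (q 1)) p = 0 := by
  have hI := h.isOpen.mem_nhds hp
  rw [wave_eq_iff (h.regularAt hp hs) (h.contDiffOn_ψ.contDiffAt hI), h.eqOn_x₂ hp, h.eqOn_x₃ hp,
    h.eqOn_normDeriv_ψ hp]
  exact h.normDeriv_eq_of_hasDerivAt hp
    ((((h.hasDerivAt_V _ hp).const_mul √2).congr_deriv (by ring)).congr_of_eventuallyEq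
      (h.eqOn_normDeriv_ψ.eventuallyEq_of_mem hI))

theorem isScalarSpacetime : IsScalarSpacetime I A (fun ρ => 1 / B ρ) id ψ where
  isOpen := h.isOpen
  ordConnected := h.ordConnected
  nonempty := h.nonempty
  contDiff_A := (h.contDiffOn 2).2.2.2
  contDiff_H := h.contDiffOn_one_div_B
  contDiff_r := contDiff_id.contDiffOn
  contDiff_ψ := h.contDiffOn_ψ
  pos ρ hρ := ⟨h.pos_A ρ hρ, one_div_pos.2 (h.pos_B hρ), h.pos ρ hρ⟩
  einstein_eq _ hp hs := h.einstein_eq hp hs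
  wave_eq _ hp hs := h.wave_eq hp hs

end IsRadialSolution

theorem Describes.reflect {γ : ℝ → ℝ × ℝ} {J I : Set ℝ} {A B : ℝ → ℝ} (h : Describes γ J I A B) :
    Describes (reflection γ) (-J) I A B := by
  obtain ⟨r, hbij, hr⟩ := h
  have hneg : BijOn (fun ξ : ℝ => -ξ) (-J) J :=
    ⟨fun ξ hξ => hξ, neg_injective.injOn, fun ξ hξ => ⟨-ξ, by simpa using hξ, neg_neg ξ⟩⟩
  refine ⟨fun ξ => r (-ξ), hbij.comp hneg, fun ξ hξ => ?_⟩
  obtain ⟨hpos, hr', hB, hA, hA'⟩ := hr (-ξ) hξ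
  refine ⟨hpos, (hr'.scomp ξ (hasDerivAt_neg ξ)).congr_deriv (by simp [reflection]), ?_, hA,
    hA'.congr_deriv (by simp [reflection, neg_div_neg_eq])⟩
  rw [hB, reflection, Prod.fst_neg, neg_sq]

section Solution

variable {γ : ℝ → ℝ × ℝ} {J : Set ℝ} (h : IsSolution γ J)
include h

theorem IsSolution.continuousOn : ContinuousOn γ J :=
  fun ξ hξ => (h.hasDerivAt ξ hξ).continuousAt.continuousWithinAt

theorem IsSolution.hasDerivAt_fst {ξ : ℝ} (hξ : ξ ∈ J) :
    HasDerivAt (fun ξ => (γ ξ).1) (1 - (γ ξ).1 * ((γ ξ).1 + (γ ξ).2)) ξ :=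
  (hasFDerivAt_fst (𝕜 := ℝ) (p := γ ξ)).comp_hasDerivAt ξ (h.hasDerivAt ξ hξ)

theorem IsSolution.hasDerivAt_snd {ξ : ℝ} (hξ : ξ ∈ J) :
    HasDerivAt (fun ξ => (γ ξ).2) (-(γ ξ).2 * ((γ ξ).1 + (γ ξ).2)) ξ :=
  (hasFDerivAt_snd (𝕜 := ℝ) (p := γ ξ)).comp_hasDerivAt ξ (h.hasDerivAt ξ hξ)

end Solution

theorem Describes.exists_isScalarSpacetime {γ : ℝ → ℝ × ℝ} {J I : Set ℝ} {A B V Ψ : ℝ → ℝ}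
    (h : Describes γ J I A B) (hγ : IsSolution γ J) (hpos : ∀ ξ ∈ J, 0 < (γ ξ).1)
    (hV : ∀ ξ ∈ J, HasDerivAt V (-((γ ξ).1 + (γ ξ).2) * V ξ) ξ)
    (hVsq : ∀ ξ ∈ J, V ξ ^ 2 = (γ ξ).1 ^ 2 + 2 * (γ ξ).1 * (γ ξ).2 - 1)
    (hΨ : ∀ ξ ∈ J, HasDerivAt Ψ (√2 * V ξ) ξ) :
    ∃ ψ, IsScalarSpacetime I A (fun r => 1 / B r) id ψ := by
  obtain ⟨r, hbij, hr⟩ := h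
  have hrc : ContinuousOn r J := fun ξ hξ => (hr ξ hξ).2.1.continuousAt.continuousWithinAt
  obtain ⟨-, hopen, g, hg⟩ := exists_inverse hγ.isOpen hγ.ordConnected (fun ξ hξ => (hr ξ hξ).2.1)
    (hγ.continuousOn.fst.mul hrc) (fun ξ hξ => mul_pos (hpos ξ hξ) (hr ξ hξ).1)
  obtain rfl : r '' J = I := hbij.image_eq
  have hasDerivAt_comp (f : ℝ → ℝ) {f' ξ : ℝ} (hξ : ξ ∈ J) (hf : HasDerivAt f f' ξ) :
      HasDerivAt (fun ρ => f (g ρ)) (f' / ((γ ξ).1 * r ξ)) (r ξ) := by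
    rw [← (hg ξ hξ).1] at hf
    exact hf.comp (r ξ) (hg ξ hξ).2
  refine ⟨fun ρ => Ψ (g ρ), IsRadialSolution.isScalarSpacetime (X := fun ρ => (γ (g ρ)).1)
    (Y := fun ρ => (γ (g ρ)).2) (V := fun ρ => V (g ρ))
    { isOpen := hopen
      ordConnected := (hγ.ordConnected.isPreconnected.image r hrc).ordConnected
      nonempty := hγ.nonempty.image r
      pos := forall_mem_image.2 fun ξ hξ => (hr ξ hξ).1
      pos_X := forall_mem_image.2 fun ξ hξ => ?_
      pos_A := forall_mem_image.2 fun ξ hξ => (hr ξ hξ).2.2.2.1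
      eq_B := forall_mem_image.2 fun ξ hξ => ?_
      hasDerivAt_X := forall_mem_image.2 fun ξ hξ => ?_
      hasDerivAt_Y := forall_mem_image.2 fun ξ hξ => ?_
      hasDerivAt_V := forall_mem_image.2 fun ξ hξ => ?_
      hasDerivAt_A := forall_mem_image.2 fun ξ hξ => ?_
      hasDerivAt_ψ := forall_mem_image.2 fun ξ hξ => ?_
      constraint := forall_mem_image.2 fun ξ hξ => ?_ }⟩ <;> simp only [(hg ξ hξ).1]
  · exact hpos ξ hξ
  · exact (hr ξ hξ).2.2.1
  · exact hasDerivAt_comp _ hξ (hγ.hasDerivAt_fst hξ)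
  · exact hasDerivAt_comp _ hξ (hγ.hasDerivAt_snd hξ)
  · exact hasDerivAt_comp _ hξ (hV ξ hξ)
  · exact (hr ξ hξ).2.2.2.2
  · exact hasDerivAt_comp _ hξ (hΨ ξ hξ)
  · exact hVsq ξ hξ

section TanhHalf

variable {s : ℝ}

theorem tanh_half_mem_Ioo (hs : 0 < s) : tanh (s / 2) ∈ Ioo (0 : ℝ) 1 := by
  refine ⟨?_, tanh_lt_one _⟩
  rw [tanh_eq_sinh_div_cosh]
  exact div_pos (sinh_pos_iff.2 (half_pos hs)) (cosh_pos _)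

theorem one_sub_tanh_half_sq_pos (s : ℝ) : 0 < 1 - tanh (s / 2) ^ 2 :=
  sub_pos.2 (tanh_sq_lt_one _)

theorem sinh_eq_tanh_half (s : ℝ) : sinh s = 2 * tanh (s / 2) / (1 - tanh (s / 2) ^ 2) := by
  have _ := cosh_pos (s / 2)
  rw [eq_div_iff (one_sub_tanh_half_sq_pos s).ne', ← mul_div_cancel₀ s two_ne_zero, sinh_two_mul,
    mul_div_cancel_left₀ _ two_ne_zero, tanh_eq_sinh_div_cosh, div_pow, one_sub_div (by positivity),
    cosh_sq_sub_sinh_sq]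
  field_simp

theorem cosh_eq_tanh_half (s : ℝ) :
    cosh s = (1 + tanh (s / 2) ^ 2) / (1 - tanh (s / 2) ^ 2) := by
  have _ := cosh_pos (s / 2)
  rw [eq_div_iff (one_sub_tanh_half_sq_pos s).ne', ← mul_div_cancel₀ s two_ne_zero, cosh_two_mul,
    mul_div_cancel_left₀ _ two_ne_zero, tanh_eq_sinh_div_cosh, div_pow, one_sub_div (by positivity),
    cosh_sq_sub_sinh_sq]
  field_simp

theorem hasDerivAt_tanh_half (s : ℝ) :
    HasDerivAt (fun s => tanh (s / 2)) ((1 - tanh (s / 2) ^ 2) / 2) s := by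
  have hcosh := cosh_pos (s / 2)
  have hhalf := (hasDerivAt_id s).div_const 2
  simp only [tanh_eq_sinh_div_cosh]
  refine (hhalf.sinh.fun_div hhalf.cosh hcosh.ne').congr_deriv ?_
  simp only [id]
  field_simp

theorem orbit_eq_tanh_half (c : ℝ) (hs : 0 < s) :
    orbit c s = ((1 + tanh (s / 2) ^ 2 - c * (1 - tanh (s / 2) ^ 2)) / (2 * tanh (s / 2)),
      c * (1 - tanh (s / 2) ^ 2) / (2 * tanh (s / 2))) := by
  have hT := (tanh_half_mem_Ioo hs).1
  have hT' := one_sub_tanh_half_sq_pos s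
  rw [orbit, sinh_eq_tanh_half, cosh_eq_tanh_half, Prod.mk.injEq]
  constructor <;> field_simp

theorem hasDerivAt_tanh_half_rpow (p : ℝ) (hs : 0 < s) :
    HasDerivAt (fun s => tanh (s / 2) ^ p) (p / sinh s * tanh (s / 2) ^ p) s := by
  have hT := (tanh_half_mem_Ioo hs).1
  refine ((hasDerivAt_tanh_half s).rpow_const (Or.inl hT.ne')).congr_deriv ?_
  rw [rpow_sub_one hT.ne', sinh_eq_tanh_half]
  field_simp

theorem hasDerivAt_tanh_half_rpow_two_mul (c : ℝ) (hs : 0 < s) :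
    HasDerivAt (fun s => tanh (s / 2) ^ (2 * c)) (2 * (orbit c s).2 * tanh (s / 2) ^ (2 * c)) s :=
  (hasDerivAt_tanh_half_rpow (2 * c) hs).congr_deriv (by rw [orbit]; ring)

theorem hasDerivAt_log_tanh_half (hs : 0 < s) :
    HasDerivAt (fun s => log (tanh (s / 2))) (sinh s)⁻¹ s := by
  have hT := (tanh_half_mem_Ioo hs).1
  refine ((hasDerivAt_tanh_half s).log hT.ne').congr_deriv ?_
  rw [sinh_eq_tanh_half, inv_div]
  field_simp

end TanhHalf

theorem exists_tanh_half_eq {T : ℝ} (hT : T ∈ Ioo (0 : ℝ) 1) : ∃ s > 0, tanh (s / 2) = T :=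
  ⟨2 * artanh T, mul_pos two_pos (artanh_pos hT), by
    rw [mul_div_cancel_left₀ _ two_ne_zero, tanh_artanh ⟨by linarith [hT.1], hT.2⟩]⟩

/-- The area radius at the point of `orbit c` with parameter `s`, in terms of `T = tanh (s / 2)`.
The factor `k` is the constant of integration of `r' = x₂ r`. -/
def areaRadius (k c T : ℝ) : ℝ := k * T ^ (1 - c) / (1 - T ^ 2)

theorem one_sub_sq_pos {T : ℝ} (hT : T ∈ Ioo (0 : ℝ) 1) : 0 < 1 - T ^ 2 := by
  nlinarith [hT.1, hT.2]

theorem areaRadius_pos {k T : ℝ} (hk : 0 < k) (c : ℝ) (hT : T ∈ Ioo (0 : ℝ) 1) :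
    0 < areaRadius k c T :=
  div_pos (mul_pos hk (rpow_pos_of_pos hT.1 _)) (one_sub_sq_pos hT)

theorem hasDerivAt_areaRadius (k c : ℝ) {s : ℝ} (hs : 0 < s) :
    HasDerivAt (fun s => areaRadius k c (tanh (s / 2)))
      ((orbit c s).1 * areaRadius k c (tanh (s / 2))) s := by
  have hT := (tanh_half_mem_Ioo hs).1
  have hT' := one_sub_tanh_half_sq_pos s
  refine (((hasDerivAt_tanh_half_rpow (1 - c) hs).const_mul k).fun_div
    (((hasDerivAt_tanh_half s).fun_pow 2).const_sub 1) hT'.ne').congr_deriv ?_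
  rw [orbit_eq_tanh_half c hs, areaRadius, sinh_eq_tanh_half]
  field_simp
  ring

theorem exists_eq_const_mul {J : Set ℝ} (hJ : Convex ℝ J) (hJn : J.Nonempty) {f g l : ℝ → ℝ}
    (hf : ∀ x ∈ J, HasDerivAt f (l x * f x) x) (hg : ∀ x ∈ J, HasDerivAt g (l x * g x) x)
    (hfpos : ∀ x ∈ J, 0 < f x) (hgpos : ∀ x ∈ J, 0 < g x) :
    ∃ k > 0, ∀ x ∈ J, f x = k * g x := by
  obtain ⟨x₀, hx₀⟩ := hJn
  have hconst (x : ℝ) (hx : x ∈ J) : f x / g x = f x₀ / g x₀ :=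
    eq_of_hasDerivWithinAt_zero hJ (fun y hy => (((hf y hy).fun_div (hg y hy)
      (hgpos y hy).ne').congr_deriv (by ring)).hasDerivWithinAt) hx hx₀
  exact ⟨f x₀ / g x₀, div_pos (hfpos _ hx₀) (hgpos _ hx₀), fun x hx =>
    (div_eq_iff (hgpos x hx).ne').1 (hconst x hx)⟩

theorem exists_describes_of_hasDerivAt {γ : ℝ → ℝ × ℝ} {J : Set ℝ} {r f : ℝ → ℝ} (hJ : IsOpen J)
    (hJc : J.OrdConnected) (hγ : ContinuousOn γ J) (hx₂ : ∀ ξ ∈ J, 0 < (γ ξ).1)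
    (hrpos : ∀ ξ ∈ J, 0 < r ξ) (hr : ∀ ξ ∈ J, HasDerivAt r ((γ ξ).1 * r ξ) ξ)
    (hfpos : ∀ ξ ∈ J, 0 < f ξ) (hf : ∀ ξ ∈ J, HasDerivAt f (2 * (γ ξ).2 * f ξ) ξ) :
    ∃ I A B, Describes γ J I A B := by
  obtain ⟨hmono, -, g, hg⟩ := exists_inverse hJ hJc hr
    (hγ.fst.mul fun ξ hξ => (hr ξ hξ).continuousAt.continuousWithinAt)
    (fun ξ hξ => mul_pos (hx₂ ξ hξ) (hrpos ξ hξ))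
  refine ⟨r '' J, f ∘ g, fun ρ => (γ (g ρ)).1 ^ 2, r, hmono.injOn.bijOn_image, fun ξ hξ => ?_⟩
  obtain ⟨hgr, hg'⟩ := hg ξ hξ
  have hx₂ξ := hx₂ ξ hξ
  have hfξ := hf ξ hξ
  rw [← hgr] at hfξ
  refine ⟨hrpos ξ hξ, hr ξ hξ, congrArg (fun ξ => (γ ξ).1 ^ 2) hgr, ?_,
    (hfξ.comp (r ξ) hg').congr_deriv ?_⟩
  · rw [Function.comp_apply, hgr]
    exact hfpos ξ hξ
  · rw [Function.comp_apply, hgr]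
    field_simp

/-- The metric functions `A`, `B` on `I` are those described by `orbit c`, with the constants of
integration `k` of the area radius and `A₀` of `A`. -/
structure IsOrbitMetric (k A₀ c : ℝ) (I : Set ℝ) (A B : ℝ → ℝ) : Prop where
  pos_k : 0 < k
  pos_A₀ : 0 < A₀
  image_eq : areaRadius k c '' Ioo 0 1 = I
  A_eq : ∀ T ∈ Ioo (0 : ℝ) 1, A (areaRadius k c T) = A₀ * T ^ (2 * c)
  B_eq : ∀ T ∈ Ioo (0 : ℝ) 1,
    B (areaRadius k c T) = ((1 + T ^ 2 - c * (1 - T ^ 2)) / (2 * T)) ^ 2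

section OrbitMetric

variable {γ : ℝ → ℝ × ℝ} {a c : ℝ} (hγ : ∀ ξ ∈ Ioi a, γ ξ = orbit c (ξ - a))
include hγ

theorem exists_eq_areaRadius {r : ℝ → ℝ} (hpos : ∀ ξ ∈ Ioi a, 0 < r ξ)
    (hr : ∀ ξ ∈ Ioi a, HasDerivAt r ((γ ξ).1 * r ξ) ξ) :
    ∃ k > 0, ∀ ξ ∈ Ioi a, r ξ = areaRadius k c (tanh ((ξ - a) / 2)) := by
  obtain ⟨k, hk, hrk⟩ := exists_eq_const_mul (convex_Ioi a) nonempty_Ioi hr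
    (g := fun ξ => areaRadius 1 c (tanh ((ξ - a) / 2)))
    (fun ξ hξ => by
      rw [hγ ξ hξ]
      exact (hasDerivAt_areaRadius 1 c (sub_pos.2 (mem_Ioi.1 hξ))).comp_sub_const ξ a)
    hpos
    (fun ξ hξ => areaRadius_pos one_pos c (tanh_half_mem_Ioo (sub_pos.2 (mem_Ioi.1 hξ))))
  refine ⟨k, hk, fun ξ hξ => ?_⟩
  rw [hrk ξ hξ]
  simp only [areaRadius]
  ring

theorem exists_eq_const_mul_tanh_half_rpow {f : ℝ → ℝ} (hpos : ∀ ξ ∈ Ioi a, 0 < f ξ)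
    (hf : ∀ ξ ∈ Ioi a, HasDerivAt f (2 * (γ ξ).2 * f ξ) ξ) :
    ∃ A₀ > 0, ∀ ξ ∈ Ioi a, f ξ = A₀ * tanh ((ξ - a) / 2) ^ (2 * c) :=
  exists_eq_const_mul (convex_Ioi a) nonempty_Ioi hf
    (g := fun ξ => tanh ((ξ - a) / 2) ^ (2 * c))
    (fun ξ hξ => by
      rw [hγ ξ hξ]
      exact (hasDerivAt_tanh_half_rpow_two_mul c (sub_pos.2 (mem_Ioi.1 hξ))).comp_sub_const ξ a)
    hpos
    (fun ξ hξ => rpow_pos_of_pos (tanh_half_mem_Ioo (sub_pos.2 (mem_Ioi.1 hξ))).1 _)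

theorem Describes.exists_isOrbitMetric {I : Set ℝ} {A B : ℝ → ℝ} (h : Describes γ (Ioi a) I A B)
    (hc : c ≤ 1) : ∃ k A₀, IsOrbitMetric k A₀ c I A B := by
  obtain ⟨r, hbij, hr⟩ := h
  obtain ⟨k, hk, hrk⟩ :=
    exists_eq_areaRadius hγ (fun ξ hξ => (hr ξ hξ).1) (fun ξ hξ => (hr ξ hξ).2.1)
  obtain ⟨A₀, hA₀, hA⟩ := exists_eq_const_mul_tanh_half_rpow hγ (f := A ∘ r)
    (fun ξ hξ => (hr ξ hξ).2.2.2.1)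
    (fun ξ hξ => by
      obtain ⟨hrpos, hr', -, -, hA'⟩ := hr ξ hξ
      have hx₂ : (γ ξ).1 ≠ 0 := by
        rw [hγ ξ hξ]
        exact (orbit_fst_pos hc (sub_pos.2 (mem_Ioi.1 hξ))).ne'
      refine (hA'.comp ξ hr').congr_deriv ?_
      rw [Function.comp_apply]
      field_simp)
  have exists_ξ (T : ℝ) (hT : T ∈ Ioo (0 : ℝ) 1) : ∃ ξ ∈ Ioi a, tanh ((ξ - a) / 2) = T := by
    obtain ⟨s, hs, rfl⟩ := exists_tanh_half_eq hT
    exact ⟨s + a, by simpa using hs, by rw [add_sub_cancel_right]⟩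
  refine ⟨k, A₀, hk, hA₀, ?_, fun T hT => ?_, fun T hT => ?_⟩
  · rw [← hbij.image_eq]
    refine Subset.antisymm (image_subset_iff.2 fun T hT => ?_) (image_subset_iff.2 fun ξ hξ => ?_)
    · obtain ⟨ξ, hξ, rfl⟩ := exists_ξ T hT
      exact ⟨ξ, hξ, hrk ξ hξ⟩
    · exact ⟨_, tanh_half_mem_Ioo (sub_pos.2 (mem_Ioi.1 hξ)), (hrk ξ hξ).symm⟩
  · obtain ⟨ξ, hξ, rfl⟩ := exists_ξ T hT
    rw [← hrk ξ hξ]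
    exact hA ξ hξ
  · obtain ⟨ξ, hξ, rfl⟩ := exists_ξ T hT
    rw [← hrk ξ hξ, (hr ξ hξ).2.2.1, hγ ξ hξ, orbit_eq_tanh_half c (sub_pos.2 (mem_Ioi.1 hξ))]

theorem exists_describes_orbit (hc : c ≤ 1) : ∃ I A B, Describes γ (Ioi a) I A B := by
  have hpos (ξ : ℝ) (hξ : ξ ∈ Ioi a) : 0 < ξ - a := sub_pos.2 hξ
  refine exists_describes_of_hasDerivAt isOpen_Ioi ordConnected_Ioi
    (r := fun ξ => areaRadius 1 c (tanh ((ξ - a) / 2))) (f := fun ξ => tanh ((ξ - a) / 2) ^ (2 * c))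
    (ContinuousOn.congr (fun ξ hξ => ((hasDerivAt_orbit c
      (hpos ξ hξ).ne').comp_sub_const ξ a).continuousAt.continuousWithinAt) hγ) (fun ξ hξ => ?_)
    (fun ξ hξ => areaRadius_pos one_pos c (tanh_half_mem_Ioo (hpos ξ hξ))) (fun ξ hξ => ?_)
    (fun ξ hξ => rpow_pos_of_pos (tanh_half_mem_Ioo (hpos ξ hξ)).1 _) (fun ξ hξ => ?_) <;>
    rw [hγ ξ hξ]
  · exact orbit_fst_pos hc (hpos ξ hξ)
  · exact (hasDerivAt_areaRadius 1 c (hpos ξ hξ)).comp_sub_const ξ a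
  · exact (hasDerivAt_tanh_half_rpow_two_mul c (hpos ξ hξ)).comp_sub_const ξ a

end OrbitMetric

theorem exists_describes_PM {γ : ℝ → ℝ × ℝ} (hγ : ∀ ξ, γ ξ = PM) :
    ∃ I A B, Describes γ univ I A B := by
  obtain rfl : γ = fun _ => PM := funext hγ
  exact exists_describes_of_hasDerivAt isOpen_univ ordConnected_univ (r := exp) (f := fun _ => 1)
    continuousOn_const (fun _ _ => one_pos) (fun ξ _ => exp_pos ξ)
    (fun ξ _ => (Real.hasDerivAt_exp ξ).congr_deriv (one_mul _).symm) (fun _ _ => one_pos)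
    (fun ξ _ => (hasDerivAt_const ξ 1).congr_deriv (by simp [PM]))

/-- Maximal solutions that run to `P_M`: the constant one and the orbits with `|c| ≤ 1`. -/
def IsRightSolution (γ : ℝ → ℝ × ℝ) (J : Set ℝ) : Prop :=
  (J = univ ∧ ∀ ξ, γ ξ = PM) ∨
    ∃ a c, |c| ≤ 1 ∧ J = Ioi a ∧ ∀ ξ ∈ Ioi a, γ ξ = orbit c (ξ - a)

theorem IsMaximalSolution.isRightSolution_or_reflect {γ : ℝ → ℝ × ℝ} {J : Set ℝ}
    (h : IsMaximalSolution γ J) :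
    IsRightSolution γ J ∨ IsRightSolution (reflection γ) (-J) := by
  rcases h.eq_PM_or_eq_PMbar_or_goesToPM_or_comesFromPMbar with
    ⟨hJ, hγ⟩ | ⟨hJ, hγ⟩ | ⟨Q, -, hQ⟩ | ⟨Q, -, hQ⟩
  · exact .inl (.inl ⟨hJ, hγ⟩)
  · exact .inr (.inl ⟨by simp [hJ], fun ξ => by rw [reflection, hγ, neg_PMbar]⟩)
  · obtain ⟨a, c, hc, hJ, hγ, -⟩ := h.exists_orbit_of_goesToPM hQ
    exact .inl (.inr ⟨a, c, hc, hJ, hγ⟩)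
  · obtain ⟨a, c, hc, hJ, hγ, -⟩ := h.reflect.exists_orbit_of_goesToPM hQ.reflect
    exact .inr (.inr ⟨a, c, hc, hJ, hγ⟩)

theorem IsRightSolution.exists_describes {γ : ℝ → ℝ × ℝ} {J : Set ℝ} (h : IsRightSolution γ J) :
    ∃ I A B, Describes γ J I A B := by
  rcases h with ⟨rfl, hγ⟩ | ⟨a, c, hc, rfl, hγ⟩
  · exact exists_describes_PM hγ
  · exact exists_describes_orbit hγ (le_of_abs_le hc)

theorem IsMaximalSolution.exists_describes {γ : ℝ → ℝ × ℝ} {J : Set ℝ}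
    (h : IsMaximalSolution γ J) : ∃ I A B, Describes γ J I A B := by
  rcases h.isRightSolution_or_reflect with h | h
  · exact h.exists_describes
  · obtain ⟨I, A, B, hd⟩ := h.exists_describes
    have hd' := hd.reflect
    rw [reflection_reflection, neg_neg] at hd'
    exact ⟨I, A, B, hd'⟩

theorem Describes.exists_isScalarSpacetime_of_orbit {γ : ℝ → ℝ × ℝ} {I : Set ℝ} {A B : ℝ → ℝ}
    {a c : ℝ} (h : Describes γ (Ioi a) I A B) (hγ : IsSolution γ (Ioi a)) (hc : |c| ≤ 1)
    (horbit : ∀ ξ ∈ Ioi a, γ ξ = orbit c (ξ - a)) :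
    ∃ ψ, IsScalarSpacetime I A (fun r => 1 / B r) id ψ := by
  have hpos (ξ : ℝ) (hξ : ξ ∈ Ioi a) : 0 < ξ - a := sub_pos.2 hξ
  have hc₂ : 0 ≤ 1 - c ^ 2 := sub_nonneg.2 ((sq_le_one_iff_abs_le_one c).2 hc)
  refine h.exists_isScalarSpacetime (V := fun ξ => √(1 - c ^ 2) / sinh (ξ - a))
    (Ψ := fun ξ => √2 * √(1 - c ^ 2) * log (tanh ((ξ - a) / 2))) hγ (fun ξ hξ => ?_)
    (fun ξ hξ => ?_) (fun ξ hξ => ?_) (fun ξ hξ => ?_)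
  · rw [horbit ξ hξ]
    exact orbit_fst_pos (le_of_abs_le hc) (hpos ξ hξ)
  · have hsinh : sinh (ξ - a) ≠ 0 := sinh_ne_zero_iff.2 (hpos ξ hξ).ne'
    have hV := ((hasDerivAt_const (ξ - a) √(1 - c ^ 2)).fun_div (hasDerivAt_sinh (ξ - a))
      hsinh).comp_sub_const ξ a
    refine hV.congr_deriv ?_
    rw [horbit ξ hξ, orbit]
    field_simp
    ring
  · rw [horbit ξ hξ, orbit_constraint c (hpos ξ hξ).ne', div_pow, Real.sq_sqrt hc₂]
    ring
  · exact (((hasDerivAt_log_tanh_half (hpos ξ hξ)).const_mul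
      (√2 * √(1 - c ^ 2))).comp_sub_const ξ a).congr_deriv (by ring)

theorem IsRightSolution.exists_isScalarSpacetime {γ : ℝ → ℝ × ℝ} {J I : Set ℝ} {A B : ℝ → ℝ}
    (h : IsRightSolution γ J) (hγ : IsSolution γ J) (hd : Describes γ J I A B) :
    ∃ ψ, IsScalarSpacetime I A (fun r => 1 / B r) id ψ := by
  rcases h with ⟨rfl, h⟩ | ⟨a, c, hc, rfl, h⟩
  · exact hd.exists_isScalarSpacetime (V := fun _ => 0) (Ψ := fun _ => 0) hγ
      (fun ξ _ => by simp [h, PM]) (fun ξ _ => by simp [hasDerivAt_const])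
      (fun ξ _ => by simp [h, PM]) (fun ξ _ => by simp [hasDerivAt_const])
  · exact hd.exists_isScalarSpacetime_of_orbit hγ hc h

theorem IsMaximalSolution.exists_isScalarSpacetime {γ : ℝ → ℝ × ℝ} {J I : Set ℝ} {A B : ℝ → ℝ}
    (h : IsMaximalSolution γ J) (hd : Describes γ J I A B) :
    ∃ ψ, IsScalarSpacetime I A (fun r => 1 / B r) id ψ := by
  rcases h.isRightSolution_or_reflect with h' | h'
  · exact h'.exists_isScalarSpacetime h.1 hd
  · exact h'.exists_isScalarSpacetime h.1.reflect hd.reflect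

section Minkowski

variable {γ : ℝ → ℝ × ℝ} {J I : Set ℝ} {A B : ℝ → ℝ}

theorem Describes.range_eq_of_eq_PM (hd : Describes γ univ I A B) (hγ : ∀ ξ, γ ξ = PM) :
    I = Ioi 0 := by
  obtain ⟨r, hbij, hr⟩ := hd
  obtain ⟨k, hk, hrk⟩ := exists_eq_const_mul convex_univ univ_nonempty
    (fun ξ hξ => (hr ξ hξ).2.1) (g := exp)
    (fun ξ _ => by simpa only [hγ ξ, PM, one_mul] using Real.hasDerivAt_exp ξ)
    (fun ξ hξ => (hr ξ hξ).1) (fun ξ _ => exp_pos ξ)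
  rw [← hbij.image_eq]
  refine Subset.antisymm (image_subset_iff.2 fun ξ hξ => (hr ξ hξ).1) fun ρ hρ => ?_
  refine ⟨log (ρ / k), mem_univ _, ?_⟩
  rw [hrk _ (mem_univ _), exp_log (div_pos hρ hk), mul_div_cancel₀ _ hk.ne']

theorem Describes.isMinkowski_of_eq_PM (hd : Describes γ univ I A B) (hγ : ∀ ξ, γ ξ = PM) :
    IsMinkowski I A B := by
  obtain rfl := hd.range_eq_of_eq_PM hγ
  obtain ⟨r, hbij, hr⟩ := hd
  have hmetric (ρ : ℝ) (hρ : ρ ∈ Ioi 0) : 0 < A ρ ∧ HasDerivAt A 0 ρ ∧ B ρ = 1 := by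
    obtain ⟨ξ, -, rfl⟩ := hbij.surjOn hρ
    obtain ⟨-, -, hB, hA, hA'⟩ := hr ξ (mem_univ ξ)
    rw [hγ ξ] at hB hA'
    exact ⟨hA, by simpa [PM] using hA', by simpa [PM] using hB⟩
  have hone : (1 : ℝ) ∈ Ioi 0 := mem_Ioi.2 one_pos
  exact ⟨rfl, A 1, (hmetric 1 hone).1, fun ρ hρ => ⟨eq_of_hasDerivWithinAt_zero (convex_Ioi 0)
    (fun y hy => (hmetric y hy).2.1.hasDerivWithinAt) hρ hone, (hmetric ρ hρ).2.2⟩⟩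

theorem IsMaximalSolution.isMinkowski_of_eq_PM (h : IsMaximalSolution γ J)
    (hd : Describes γ J I A B) (hγ : ∀ ξ ∈ J, γ ξ = PM) : IsMinkowski I A B := by
  obtain ⟨t, ht⟩ := h.1.nonempty
  obtain ⟨rfl, hPM⟩ := h.eq_PM ht (hγ t ht)
  exact hd.isMinkowski_of_eq_PM hPM

theorem IsMaximalSolution.isMinkowski (h : IsMaximalSolution γ J) (hd : Describes γ J I A B)
    (hγ : (∀ ξ ∈ J, γ ξ = PM) ∨ (∀ ξ ∈ J, γ ξ = PMbar)) : IsMinkowski I A B := by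
  rcases hγ with hγ | hγ
  · exact h.isMinkowski_of_eq_PM hd hγ
  · exact h.reflect.isMinkowski_of_eq_PM hd.reflect fun ξ hξ => by
      rw [reflection, hγ _ hξ, neg_PMbar]

end Minkowski

/-! ### Global properties of the spacetimes -/

theorem IsScalarSpacetime.regularAt {I : Set ℝ} {A H r ψ : ℝ → ℝ}
    (h : IsScalarSpacetime I A H r ψ) {p : Fin 4 → ℝ} (hp : p 1 ∈ I) (hsin : sin (p 2) ≠ 0) :
    RegularAt A H r p :=
  have hI := h.isOpen.mem_nhds hp
  have ⟨hA, hH, hr⟩ := h.pos _ hp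
  ⟨h.contDiff_A.contDiffAt hI, h.contDiff_H.contDiffAt hI, h.contDiff_r.contDiffAt hI,
    hA, hH, hr, hsin⟩

theorem IsScalarSpacetime.reduction {I : Set ℝ} {A H r ψ : ℝ → ℝ}
    (h : IsScalarSpacetime I A H r ψ) {ρ : ℝ} (hρ : ρ ∈ I) :
    DifferentiableAt ℝ (x₂ H r) ρ ∧ DifferentiableAt ℝ (x₃ A H r) ρ ∧
      (normDeriv H r (x₂ H r) ρ, normDeriv H r (x₃ A H r) ρ) = field (x₂ H r ρ, x₃ A H r ρ) ∧
      y₁ H r ψ ρ ^ 2 = x₂ H r ρ ^ 2 + 2 * x₂ H r ρ * x₃ A H r ρ - 1 ∧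
      (x₂ H r ρ, x₃ A H r ρ) ∈ phaseSpace := by
  let p : Fin 4 → ℝ := ![0, ρ, π / 2, 0]
  have hsin : sin (p 2) ≠ 0 := by simp [p]
  have hreg : RegularAt A H r p := h.regularAt hρ hsin
  obtain ⟨hfield, hy₁⟩ := (einstein_eq_iff hreg ψ).1 (h.einstein_eq p hρ hsin)
  exact ⟨hreg.hasDerivAt_x₂.differentiableAt, hreg.hasDerivAt_x₃.differentiableAt, hfield, hy₁,
    sub_nonneg.1 (hy₁ ▸ sq_nonneg _)⟩

section AreaRadius

variable {k c T : ℝ}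

theorem continuousAt_areaRadius (k : ℝ) (h : T ≠ 0 ∨ 0 ≤ 1 - c) (hT : 1 - T ^ 2 ≠ 0) :
    ContinuousAt (areaRadius k c) T :=
  (continuousAt_const.mul (continuousAt_rpow_const T _ h)).div (by fun_prop) hT

theorem continuousOn_areaRadius (k c : ℝ) : ContinuousOn (areaRadius k c) (Ioo 0 1) := fun _ hT =>
  (continuousAt_areaRadius k (.inl hT.1.ne') (one_sub_sq_pos hT).ne').continuousWithinAt

theorem tendsto_areaRadius_zero (k : ℝ) (hc : c ≤ 1) :
    Tendsto (areaRadius k c) (𝓝[>] 0) (𝓝 (areaRadius k c 0)) :=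
  (continuousAt_areaRadius k (.inr (sub_nonneg.2 hc)) (by norm_num)).tendsto.mono_left
    nhdsWithin_le_nhds

theorem tendsto_areaRadius_atTop (hk : 0 < k) (c : ℝ) :
    Tendsto (areaRadius k c) (𝓝[<] 1) atTop := by
  have hnum : Tendsto (fun T : ℝ => k * T ^ (1 - c)) (𝓝[<] 1) (𝓝 k) := by
    have hcont : ContinuousAt (fun T : ℝ => k * T ^ (1 - c)) 1 :=
      continuousAt_const.mul (continuousAt_rpow_const 1 _ (.inl one_ne_zero))
    simpa only [one_rpow, mul_one] using hcont.tendsto.mono_left nhdsWithin_le_nhds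
  have hden : Tendsto (fun T : ℝ => 1 - T ^ 2) (𝓝[<] 1) (𝓝[>] 0) := by
    refine tendsto_nhdsWithin_iff.2
      ⟨(Continuous.tendsto' (by fun_prop) 1 0 (by norm_num)).mono_left nhdsWithin_le_nhds, ?_⟩
    filter_upwards [Ioo_mem_nhdsLT (zero_lt_one' ℝ)] with T hT
    exact one_sub_sq_pos hT
  exact (hnum.pos_mul_atTop hk (tendsto_inv_nhdsGT_zero.comp hden)).congr fun T =>
    (div_eq_mul_inv _ _).symm

theorem image_areaRadius_eq_Ioi (hk : 0 < k) (hc : c ≤ 1)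
    (h : ∀ T ∈ Ioo 0 1, areaRadius k c 0 < areaRadius k c T) :
    areaRadius k c '' Ioo 0 1 = Ioi (areaRadius k c 0) :=
  Subset.antisymm (image_subset_iff.2 h) <|
    isPreconnected_Ioo.intermediate_value_Ioi (l₁ := 𝓝[>] 0) (l₂ := 𝓝[<] 1)
      (le_principal_iff.2 (Ioo_mem_nhdsGT one_pos)) (le_principal_iff.2 (Ioo_mem_nhdsLT one_pos))
      (continuousOn_areaRadius k c) (tendsto_areaRadius_zero k hc) (tendsto_areaRadius_atTop hk c)

theorem image_areaRadius_of_lt_one (hk : 0 < k) (hc : c < 1) :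
    areaRadius k c '' Ioo 0 1 = Ioi 0 := by
  have hzero : areaRadius k c 0 = 0 := by
    rw [areaRadius, zero_rpow (sub_pos.2 hc).ne', mul_zero, zero_div]
  rw [image_areaRadius_eq_Ioi hk hc.le, hzero]
  exact fun T hT => hzero.trans_lt (areaRadius_pos hk c hT)

theorem areaRadius_one (k T : ℝ) : areaRadius k 1 T = k / (1 - T ^ 2) := by
  rw [areaRadius, sub_self, rpow_zero, mul_one]

theorem areaRadius_neg_one (k T : ℝ) : areaRadius k (-1) T = k * T ^ 2 / (1 - T ^ 2) := by
  rw [areaRadius, sub_neg_eq_add, one_add_one_eq_two, rpow_two]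

theorem image_areaRadius_one (hk : 0 < k) : areaRadius k 1 '' Ioo 0 1 = Ioi k := by
  have hzero : areaRadius k 1 0 = k := by simp [areaRadius_one]
  rw [image_areaRadius_eq_Ioi hk le_rfl, hzero]
  intro T hT
  have hT₀ := hT.1
  rw [hzero, areaRadius_one, lt_div_iff₀ (one_sub_sq_pos hT)]
  exact mul_lt_of_lt_one_right hk (sub_lt_self 1 (by positivity))

theorem eventually_mem_image_areaRadius (hk : 0 < k) (c : ℝ) :
    ∀ᶠ r in atTop, r ∈ areaRadius k c '' Ioo 0 1 :=
  mem_of_superset (Ici_mem_atTop (areaRadius k c (1 / 2))) <|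
    isPreconnected_Ioo.intermediate_value_Ici (l := 𝓝[<] 1) (by norm_num)
      (le_principal_iff.2 (Ioo_mem_nhdsLT one_pos))
      (continuousOn_areaRadius k c) (tendsto_areaRadius_atTop hk c)

theorem mul_rpow_le_areaRadius (hk : 0 < k) (c : ℝ) (hT : T ∈ Ioo 0 1) :
    k * T ^ (1 - c) ≤ areaRadius k c T :=
  le_div_self (mul_nonneg hk.le (rpow_nonneg hT.1.le _)) (one_sub_sq_pos hT)
    (sub_le_self 1 (sq_nonneg T))

theorem one_sub_sq_le (hk : 0 < k) (hc : c ≤ 1) (hT : T ∈ Ioo 0 1) :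
    1 - T ^ 2 ≤ k / areaRadius k c T := by
  have hpow : T ^ (1 - c) ≤ 1 := rpow_le_one hT.1.le hT.2.le (sub_nonneg.2 hc)
  rw [le_div_iff₀ (areaRadius_pos hk c hT), areaRadius,
    mul_div_cancel₀ _ (one_sub_sq_pos hT).ne']
  exact mul_le_of_le_one_right hk.le hpow

theorem exists_areaRadius_eq_tendsto_zero (hk : 0 < k) (hc : c < 1) :
    ∃ τ : ℝ → ℝ, (∀ r > 0, τ r ∈ Ioo 0 1 ∧ areaRadius k c (τ r) = r) ∧
      Tendsto τ (𝓝[>] 0) (𝓝[>] 0) := by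
  have hsurj (r : ℝ) (hr : r > 0) : ∃ T, T ∈ Ioo 0 1 ∧ areaRadius k c T = r :=
    (image_areaRadius_of_lt_one hk hc).ge hr
  choose! τ hτ using hsurj
  refine ⟨τ, hτ, tendsto_nhdsWithin_iff.2 ⟨?_, eventually_nhdsWithin_of_forall
    fun r hr => (hτ r hr).1.1⟩⟩
  rw [Metric.tendsto_nhdsWithin_nhds]
  refine fun ε hε => ⟨k * ε ^ (1 - c), by positivity, fun r hr hdist => ?_⟩
  obtain ⟨hT, hr'⟩ := hτ r hr
  rw [Real.dist_0_eq_abs, abs_of_pos hr] at hdist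
  rw [Real.dist_0_eq_abs, abs_of_pos hT.1]
  have hpow : k * τ r ^ (1 - c) ≤ r := (mul_rpow_le_areaRadius hk c hT).trans hr'.le
  exact (rpow_lt_rpow_iff hT.1.le hε.le (sub_pos.2 hc)).1
    (lt_of_mul_lt_mul_left (hpow.trans_lt hdist) hk.le)

theorem exists_areaRadius_eq_isBigO (hk : 0 < k) (hc : c ≤ 1) :
    ∃ τ : ℝ → ℝ, (∀ᶠ r in atTop, τ r ∈ Ioo 0 1 ∧ areaRadius k c (τ r) = r) ∧
      (fun r => τ r - 1) =O[atTop] fun r => 1 / r := by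
  have hsurj (r : ℝ) (hr : r ∈ areaRadius k c '' Ioo 0 1) :
      ∃ T, T ∈ Ioo 0 1 ∧ areaRadius k c T = r := hr
  choose! τ hτ using hsurj
  have hτ' := (eventually_mem_image_areaRadius hk c).mono hτ
  refine ⟨τ, hτ', Asymptotics.IsBigO.of_bound k ?_⟩
  filter_upwards [hτ', eventually_gt_atTop 0] with r ⟨hT, hr⟩ hr₀
  rw [Real.norm_of_nonpos (sub_nonpos.2 hT.2.le), Real.norm_of_nonneg (by positivity), mul_one_div]
  have hsq : τ r ^ 2 ≤ τ r := pow_le_of_le_one hT.1.le hT.2.le two_ne_zero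
  calc -(τ r - 1) ≤ 1 - τ r ^ 2 := by linarith
    _ ≤ k / areaRadius k c (τ r) := one_sub_sq_le hk hc hT
    _ = k / r := by rw [hr]

theorem isBigO_sub_of_comp_areaRadius_eq (hk : 0 < k) (hc : c ≤ 1) {F f : ℝ → ℝ}
    (hf : DifferentiableAt ℝ f 1) (hF : ∀ T ∈ Ioo 0 1, F (areaRadius k c T) = f T) :
    (fun r => F r - f 1) =O[atTop] fun r => 1 / r := by
  obtain ⟨τ, hτ, hO⟩ := exists_areaRadius_eq_isBigO hk hc
  have hlim : Tendsto τ atTop (𝓝 1) := tendsto_sub_nhds_zero_iff.1 <|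
    hO.trans_tendsto (by simpa only [one_div] using tendsto_inv_atTop_zero)
  refine ((hf.isBigO_sub.comp_tendsto hlim).trans hO).congr' ?_ EventuallyEq.rfl
  filter_upwards [hτ] with r ⟨hT, hr⟩
  rw [Function.comp_apply, ← hF _ hT, hr]

end AreaRadius

theorem IsOrbitMetric.isAsymptoticallyFlat {k A₀ c : ℝ} {I : Set ℝ} {A B : ℝ → ℝ}
    (h : IsOrbitMetric k A₀ c I A B) (hc : c ≤ 1) : IsAsymptoticallyFlat A B := by
  refine ⟨⟨A₀, h.pos_A₀, ?_⟩, ?_⟩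
  · simpa only [id, one_rpow, mul_one] using isBigO_sub_of_comp_areaRadius_eq h.pos_k hc
      ((differentiableAt_id.rpow_const (.inl one_ne_zero)).const_mul A₀) h.A_eq
  · have hdiff : DifferentiableAt ℝ
        (fun T => ((1 + T ^ 2 - c * (1 - T ^ 2)) / (2 * T)) ^ 2) 1 := by
      fun_prop (disch := norm_num)
    simpa only [one_pow, sub_self, mul_zero, sub_zero, mul_one, one_add_one_eq_two,
      div_self (two_ne_zero' ℝ)] using
      isBigO_sub_of_comp_areaRadius_eq h.pos_k hc hdiff h.B_eq

section Schwarzschild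

variable {k A₀ M r : ℝ} {I : Set ℝ} {A B : ℝ → ℝ}

theorem setOf_pos_one_sub_div (m : ℝ) : {r | 0 < r ∧ 0 < 1 - m / r} = Ioi (max 0 m) := by
  ext r
  rw [mem_Ioi, max_lt_iff]
  exact and_congr_right fun hr => by rw [sub_pos, div_lt_one hr]

theorem IsOrbitMetric.isSchwarzschild_of_one (h : IsOrbitMetric k A₀ 1 I A B) :
    IsSchwarzschild (k / 2) I A B := by
  have hk := h.pos_k
  have hlapse (T : ℝ) (hT : T ∈ Ioo 0 1) : 1 - 2 * (k / 2) / areaRadius k 1 T = T ^ 2 := by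
    have _ := one_sub_sq_pos hT
    rw [areaRadius_one]
    field_simp
    ring
  refine ⟨?_, A₀, h.pos_A₀, ?_⟩
  · rw [← h.image_eq, image_areaRadius_one hk, setOf_pos_one_sub_div, mul_div_cancel₀ k two_ne_zero,
      max_eq_right hk.le]
  · rw [← h.image_eq, forall_mem_image]
    intro T hT
    have hT₀ := hT.1
    rw [h.A_eq T hT, h.B_eq T hT, hlapse T hT, mul_one, rpow_two]
    refine ⟨rfl, ?_⟩
    field_simp
    ring

theorem IsOrbitMetric.isSchwarzschild_of_neg_one (h : IsOrbitMetric k A₀ (-1) I A B) :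
    IsSchwarzschild (-(k / 2)) I A B := by
  have hk := h.pos_k
  have hlapse (T : ℝ) (hT : T ∈ Ioo 0 1) :
      1 - 2 * -(k / 2) / areaRadius k (-1) T = (T ^ 2)⁻¹ := by
    have hT₀ := hT.1
    have _ := one_sub_sq_pos hT
    rw [areaRadius_neg_one]
    field_simp
    ring
  refine ⟨?_, A₀, h.pos_A₀, ?_⟩
  · rw [← h.image_eq, image_areaRadius_of_lt_one hk (by norm_num), setOf_pos_one_sub_div,
      max_eq_left (by linarith)]
  · rw [← h.image_eq, forall_mem_image]
    intro T hT
    have hT₀ := hT.1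
    rw [h.A_eq T hT, h.B_eq T hT, hlapse T hT, mul_neg_one, rpow_neg hT₀.le, rpow_two]
    refine ⟨rfl, ?_⟩
    field_simp
    ring

theorem IsSchwarzschild.range_eq (hM : 0 < M) (h : IsSchwarzschild M I A B) : I = Ioi (2 * M) := by
  rw [h.1, setOf_pos_one_sub_div, max_eq_right (mul_pos two_pos hM).le]

theorem IsSchwarzschild.mem_nhds (h : IsSchwarzschild M I A B) (hr : r ∈ I) : I ∈ 𝓝 r := by
  obtain ⟨rfl, -⟩ := h
  rw [setOf_pos_one_sub_div] at hr ⊢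
  exact Ioi_mem_nhds hr

theorem contDiffAt_one_sub_div (m : ℝ) (hr : r ≠ 0) : ContDiffAt ℝ 2 (fun r => 1 - m / r) r :=
  contDiffAt_const.sub (contDiffAt_const.div contDiffAt_id hr)

theorem hasDerivAt_one_sub_div (m : ℝ) (hr : r ≠ 0) :
    HasDerivAt (fun r => 1 - m / r) (m / r ^ 2) r := by
  simpa only [div_eq_mul_inv, mul_neg, neg_neg] using
    ((hasDerivAt_inv hr).const_mul m).const_sub 1

theorem IsSchwarzschild.regularAt (h : IsSchwarzschild M I A B) {p : Fin 4 → ℝ} (hp : p 1 ∈ I)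
    (hsin : sin (p 2) ≠ 0) : RegularAt A (fun r => 1 / B r) id p := by
  have hI := h.mem_nhds hp
  obtain ⟨rfl, c, hc, hAB⟩ := h
  have hsmooth := contDiffAt_one_sub_div (2 * M) hp.1.ne'
  obtain ⟨hA, hB⟩ := hAB _ hp
  exact ⟨(contDiffAt_const.mul hsmooth).congr_of_eventuallyEq
      (EqOn.eventuallyEq_of_mem (fun r hr => (hAB r hr).1) hI),
    (contDiffAt_const.div hsmooth hp.2.ne').congr_of_eventuallyEq
      (EqOn.eventuallyEq_of_mem (fun r hr => congrArg (1 / ·) (hAB r hr).2) hI),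
    contDiffAt_id, hA ▸ mul_pos hc hp.2, one_div_pos.2 (hB ▸ hp.2), hp.1, hsin⟩

theorem IsSchwarzschild.deriv_eq (h : IsSchwarzschild M I A B) (hr : r ∈ I) :
    deriv A r = A r / (1 - 2 * M / r) * (2 * M / r ^ 2) ∧
      deriv (deriv A) r = A r / (1 - 2 * M / r) * -(4 * M / r ^ 3) ∧
      deriv (fun r => 1 / B r) r = -(2 * M / r ^ 2) / (1 - 2 * M / r) ^ 2 := by
  have hI := fun r (hr : r ∈ I) => h.mem_nhds hr
  obtain ⟨rfl, c, -, hAB⟩ := h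
  have hderiv (r : ℝ) (hr : r ∈ {r | 0 < r ∧ 0 < 1 - 2 * M / r}) :
      deriv A r = c * (2 * M / r ^ 2) :=
    ((hasDerivAt_one_sub_div (2 * M) hr.1.ne').const_mul c).congr_of_eventuallyEq
      (EqOn.eventuallyEq_of_mem (fun r hr => (hAB r hr).1) (hI r hr)) |>.deriv
  have hr₀ := hr.1.ne'
  have hderiv₂ : HasDerivAt (fun r => c * (2 * M / r ^ 2)) (c * -(4 * M / r ^ 3)) r := by
    refine (((hasDerivAt_const r (2 * M)).fun_div (hasDerivAt_pow 2 r)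
      (pow_ne_zero 2 hr₀)).const_mul c).congr_deriv ?_
    field_simp
    ring
  have hB := ((hasDerivAt_one_sub_div (2 * M) hr₀).fun_inv hr.2.ne').congr_of_eventuallyEq
    (EqOn.eventuallyEq_of_mem (fun r hr => congrArg (·⁻¹) (hAB r hr).2) (hI r hr))
  rw [(hAB r hr).1, mul_div_cancel_right₀ _ hr.2.ne']
  exact ⟨hderiv r hr,
    (hderiv₂.congr_of_eventuallyEq (EqOn.eventuallyEq_of_mem hderiv (hI r hr))).deriv,
    by simpa only [one_div] using hB.deriv⟩

theorem IsSchwarzschild.sectional_eq (h : IsSchwarzschild M I A B) (hr : r ∈ I) :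
    sectional A (fun r => 1 / B r) id r 0 1 = 2 * M / r ^ 3 ∧
      sectional A (fun r => 1 / B r) id r 0 2 = -M / r ^ 3 ∧
      sectional A (fun r => 1 / B r) id r 1 2 = -M / r ^ 3 ∧
      sectional A (fun r => 1 / B r) id r 2 3 = 2 * M / r ^ 3 := by
  obtain ⟨hA, hA', hH⟩ := h.deriv_eq hr
  obtain ⟨rfl, c, hc, hAB⟩ := h
  have hr₀ := hr.1.ne'
  obtain ⟨d, rfl⟩ : ∃ d, M = (r - d) / 2 := ⟨r - 2 * M, by ring⟩
  have hlapse : 1 - 2 * ((r - d) / 2) / r = d / r := by field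
  have hd : d ≠ 0 := (div_ne_zero_iff.1 (hlapse ▸ hr.2.ne')).1
  rw [(hAB r hr).1, mul_div_cancel_right₀ _ hr.2.ne'] at hA hA'
  simp only [sectional, Matrix.of_apply, Matrix.cons_val, hA, hA', hH, hAB r hr, hlapse, deriv_id',
    deriv_const, id]
  refine ⟨?_, ?_, ?_, ?_⟩ <;> field_simp <;> ring

theorem IsSchwarzschild.kretschmann_eq (h : IsSchwarzschild M I A B) {p : Fin 4 → ℝ} (hp : p 1 ∈ I)
    (hsin : sin (p 2) ≠ 0) : kretschmann (schwarzschildForm A B) p = 48 * M ^ 2 / p 1 ^ 6 := by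
  obtain ⟨h₀₁, h₀₂, h₁₂, h₂₃⟩ := h.sectional_eq hp
  rw [schwarzschildForm, kretschmann_staticMetric (h.regularAt hp hsin), h₀₁, h₀₂, h₁₂, h₂₃]
  ring

theorem IsSchwarzschild.isHorizonExterior (hM : 0 < M) (h : IsSchwarzschild M I A B) :
    IsHorizonExterior I A B := by
  have hI := h.range_eq hM
  have hkretschmann := fun p => h.kretschmann_eq (p := p)
  obtain ⟨rfl, c, hc, hAB⟩ := h
  have hlim : Tendsto (fun r => 1 - 2 * M / r) (𝓝[>] (2 * M)) (𝓝 0) := by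
    have hcont := (hasDerivAt_one_sub_div (2 * M) (r := 2 * M) (by positivity)).continuousAt
    simpa only [div_self (mul_pos two_pos hM).ne', sub_self] using
      hcont.tendsto.mono_left nhdsWithin_le_nhds
  refine ⟨2 * M, by positivity, hI, fun r hr => ?_, ?_, ?_, 48 * M ^ 2 / (2 * M) ^ 6,
    fun p hp hsin => ?_⟩
  · rw [(hAB r hr).1, (hAB r hr).2]
    exact ⟨mul_pos hc hr.2, hr.2⟩
  · simpa only [mul_zero] using (hlim.const_mul c).congr' <|
      eventually_nhdsWithin_of_forall fun r hr => (hAB r (hI.ge hr)).1.symm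
  · exact hlim.congr' <| eventually_nhdsWithin_of_forall fun r hr => (hAB r (hI.ge hr)).2.symm
  · have hp₀ := hp.1
    have hradius : 2 * M < p 1 := hI.le hp
    rw [hkretschmann p hp hsin, abs_of_nonneg (by positivity)]
    gcongr

end Schwarzschild

section NakedSingularity

variable {k A₀ c T : ℝ} {I : Set ℝ} {A B F f : ℝ → ℝ}

theorem areaRadius_rpow (hk : 0 < k) (hc : c < 1) (hT : T ∈ Ioo 0 1) (b : ℝ) :
    areaRadius k c T ^ (b / (1 - c)) = (k / (1 - T ^ 2)) ^ (b / (1 - c)) * T ^ b := by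
  rw [areaRadius, mul_div_right_comm, mul_rpow (div_pos hk (one_sub_sq_pos hT)).le
    (rpow_nonneg hT.1.le _), ← rpow_mul hT.1.le, mul_div_cancel₀ b (sub_pos.2 hc).ne']

theorem tendsto_div_rpow_of_comp_areaRadius_eq (hk : 0 < k) (hc : c < 1) {b : ℝ}
    (hf : ContinuousAt f 0) (hF : ∀ T ∈ Ioo 0 1, F (areaRadius k c T) = f T * T ^ b) :
    Tendsto (fun r => F r / r ^ (b / (1 - c))) (𝓝[>] 0) (𝓝 (f 0 / k ^ (b / (1 - c)))) := by
  obtain ⟨τ, hτ, hlim⟩ := exists_areaRadius_eq_tendsto_zero hk hc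
  have hden : ContinuousAt (fun T => (k / (1 - T ^ 2)) ^ (b / (1 - c))) 0 :=
    (continuousAt_const.div (by fun_prop) (by norm_num)).rpow_const (.inl (by simpa using hk.ne'))
  have hquot := (hf.div hden (by simpa using (rpow_pos_of_pos hk _).ne')).tendsto.comp
    (tendsto_nhdsWithin_iff.1 hlim).1
  simp only [Pi.div_apply, ne_eq, OfNat.ofNat_ne_zero, not_false_eq_true, zero_pow, sub_zero,
    div_one] at hquot
  refine hquot.congr' <| eventually_nhdsWithin_of_forall fun r hr => ?_
  obtain ⟨hT, hr'⟩ := hτ r hr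
  have hFr := hF _ hT
  have hpow := areaRadius_rpow hk hc hT b
  rw [hr'] at hFr hpow
  beta_reduce
  rw [Function.comp_apply, Pi.div_apply, hFr, hpow,
    mul_div_mul_right _ _ (rpow_pos_of_pos hT.1 b).ne']

theorem IsOrbitMetric.exists_tendsto_A_div_rpow (h : IsOrbitMetric k A₀ c I A B) (hc : c < 1) :
    ∃ a > 0, Tendsto (fun r => A r / r ^ (2 * c / (1 - c))) (𝓝[>] 0) (𝓝 a) :=
  ⟨_, div_pos h.pos_A₀ (rpow_pos_of_pos h.pos_k _),
    tendsto_div_rpow_of_comp_areaRadius_eq h.pos_k hc continuousAt_const h.A_eq⟩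

theorem IsOrbitMetric.exists_tendsto_B_div_rpow (h : IsOrbitMetric k A₀ c I A B) (hc : c < 1) :
    ∃ b > 0, Tendsto (fun r => B r / r ^ (-2 / (1 - c))) (𝓝[>] 0) (𝓝 b) := by
  have hcont : ContinuousAt (fun T => ((1 + T ^ 2 - c * (1 - T ^ 2)) / 2) ^ 2) 0 := by fun_prop
  have _ := sub_pos.2 hc
  have hzero : 0 < ((1 + 0 ^ 2 - c * (1 - 0 ^ 2)) / 2) ^ 2 := by
    norm_num
    positivity
  refine ⟨_, div_pos hzero (rpow_pos_of_pos h.pos_k _),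
    tendsto_div_rpow_of_comp_areaRadius_eq h.pos_k hc hcont fun T hT => ?_⟩
  rw [h.B_eq T hT, rpow_neg hT.1.le, rpow_two]
  field

theorem IsOrbitMetric.hasPowerLaw (h : IsOrbitMetric k A₀ c I A B) (hc : c < 1) :
    HasPowerLaw A B (-2 * (1 + (endpoint c).2 / (endpoint c).1))
      (2 * (endpoint c).2 / (endpoint c).1) := by
  have hc' := (sub_pos.2 hc).ne'
  have hα : -2 * (1 + c / (1 - c)) = -2 / (1 - c) := by
    field_simp
    ring
  rw [mul_div_assoc, endpoint_snd_div_fst, hα, ← mul_div_assoc]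
  exact ⟨h.exists_tendsto_A_div_rpow hc, h.exists_tendsto_B_div_rpow hc⟩

theorem IsOrbitMetric.tendsto_B_atTop (h : IsOrbitMetric k A₀ c I A B) (hc : c < 1) :
    Tendsto B (𝓝[>] 0) atTop := by
  obtain ⟨b, hb, hlim⟩ := h.exists_tendsto_B_div_rpow hc
  have hpow : Tendsto (fun r : ℝ => r ^ (-2 / (1 - c))) (𝓝[>] 0) atTop :=
    tendsto_rpow_neg_nhdsGT_zero (div_neg_of_neg_of_pos (by norm_num) (sub_pos.2 hc))
  refine (hlim.pos_mul_atTop hb hpow).congr' <| eventually_nhdsWithin_of_forall fun r hr => ?_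
  exact div_mul_cancel₀ _ (rpow_pos_of_pos hr _).ne'

theorem IsOrbitMetric.le_A_mul_B (h : IsOrbitMetric k A₀ c I A B) (hc : c ∈ Icc (-1) 1)
    {r : ℝ} (hr : r ∈ I) : A₀ * ((1 - c) / 2) ^ 2 ≤ A r * B r := by
  rw [← h.image_eq] at hr
  obtain ⟨T, hT, rfl⟩ := hr
  have hA₀ := h.pos_A₀
  have hT₀ := hT.1
  have hc₁ : 0 ≤ 1 - c := sub_nonneg.2 hc.2
  have hpow : 1 ≤ T ^ (2 * c - 2) :=
    one_le_rpow_of_pos_of_le_one_of_nonpos hT₀ hT.2.le (by linarith)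
  have hnum : 1 - c ≤ 1 + T ^ 2 - c * (1 - T ^ 2) := by
    linarith [mul_nonneg (neg_le_iff_add_nonneg'.1 hc.1) (sq_nonneg T)]
  calc A₀ * ((1 - c) / 2) ^ 2 ≤ A₀ * ((1 + T ^ 2 - c * (1 - T ^ 2)) / 2) ^ 2 := by gcongr
    _ ≤ A₀ * ((1 + T ^ 2 - c * (1 - T ^ 2)) / 2) ^ 2 * T ^ (2 * c - 2) :=
      le_mul_of_one_le_right (by positivity) hpow
    _ = A (areaRadius k c T) * B (areaRadius k c T) := by
      rw [h.A_eq T hT, h.B_eq T hT, rpow_sub hT₀, rpow_two]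
      field_simp

theorem RegularAt.sq_le_kretschmann {p : Fin 4 → ℝ} (h : RegularAt A (fun r => 1 / B r) id p) :
    ((1 - B (p 1)) / p 1 ^ 2) ^ 2 ≤ kretschmann (schwarzschildForm A B) p := by
  have hsphere : sectional A (fun r => 1 / B r) id (p 1) 2 3 = (1 - B (p 1)) / p 1 ^ 2 := by
    simp [sectional]
  rw [schwarzschildForm, kretschmann_staticMetric h, hsphere]
  linarith only [sq_nonneg (sectional A (fun r => 1 / B r) id (p 1) 0 1),
    sq_nonneg (sectional A (fun r => 1 / B r) id (p 1) 0 2),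
    sq_nonneg (sectional A (fun r => 1 / B r) id (p 1) 1 2), sq_nonneg ((1 - B (p 1)) / p 1 ^ 2)]

theorem tendsto_kretschmann_atTop (hB : Tendsto B (𝓝[>] 0) atTop) {t θ φ : ℝ}
    (hreg : ∀ r > 0, RegularAt A (fun r => 1 / B r) id ![t, r, θ, φ]) :
    Tendsto (fun r => kretschmann (schwarzschildForm A B) ![t, r, θ, φ]) (𝓝[>] 0) atTop := by
  refine tendsto_atTop_mono' _ ?_ (tendsto_atTop_add_const_right _ (-1) hB)
  filter_upwards [Ioo_mem_nhdsGT (zero_lt_one' ℝ), hB.eventually_ge_atTop 2] with r hr hBr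
  have hr₀ := hr.1
  have hr₄ : (r ^ 2) ^ 2 ≤ 1 := pow_le_one₀ (by positivity) (pow_le_one₀ hr₀.le hr.2.le)
  calc B r + -1 ≤ (1 - B r) ^ 2 := by nlinarith only [hBr]
    _ ≤ (1 - B r) ^ 2 / (r ^ 2) ^ 2 := le_div_self (sq_nonneg _) (by positivity) hr₄
    _ = ((1 - B r) / r ^ 2) ^ 2 := (div_pow _ _ 2).symm
    _ ≤ kretschmann (schwarzschildForm A B) ![t, r, θ, φ] := (hreg r hr₀).sq_le_kretschmann

theorem integrableOn_one_div_sqrt {s : Set ℝ} {m : ℝ} (hs : MeasurableSet s)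
    (hvol : MeasureTheory.volume s < ⊤) (hF : ContinuousOn F s) (hm : 0 < m)
    (hle : ∀ r ∈ s, m ≤ F r) : MeasureTheory.IntegrableOn (fun r => 1 / √(F r)) s := by
  have hcont : ContinuousOn (fun r => 1 / √(F r)) s :=
    continuousOn_const.div hF.sqrt fun r hr => (Real.sqrt_pos.2 (hm.trans_le (hle r hr))).ne'
  refine .of_bound hvol (hcont.aestronglyMeasurable hs) (1 / √m)
    (MeasureTheory.ae_restrict_of_forall_mem hs fun r hr => ?_)
  rw [Real.norm_of_nonneg (by positivity)]
  have := hle r hr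
  gcongr

theorem IsOrbitMetric.isNakedSingularity {ψ : ℝ → ℝ} (h : IsOrbitMetric k A₀ c I A B)
    (hc : c ∈ Ico (-1) 1) (hs : IsScalarSpacetime I A (fun r => 1 / B r) id ψ) :
    IsNakedSingularity I A B := by
  obtain rfl : I = Ioi 0 := h.image_eq.symm.trans (image_areaRadius_of_lt_one h.pos_k hc.2)
  have hA₀ := h.pos_A₀
  have hc' := sub_pos.2 hc.2
  have hB : ContinuousOn B (Ioi 0) := by
    simpa only [one_div, inv_inv, Pi.inv_def] using
      hs.contDiff_H.continuousOn.inv₀ fun r hr => (hs.pos r hr).2.1.ne'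
  exact
    { range := rfl
      no_horizon := fun r hr => ⟨(hs.pos r hr).1, one_div_pos.1 (hs.pos r hr).2.1⟩
      singular := fun t θ φ hθ => tendsto_kretschmann_atTop (h.tendsto_B_atTop hc.2)
        fun r hr => hs.regularAt (p := ![t, r, θ, φ]) hr hθ
      flat := h.isAsymptoticallyFlat hc.2.le
      visible := fun R _ => integrableOn_one_div_sqrt measurableSet_Ioc measure_Ioc_lt_top
        ((hs.contDiff_A.continuousOn.mul hB).mono Ioc_subset_Ioi_self)
        (mul_pos hA₀ (pow_pos (half_pos hc') 2))
        fun r hr => h.le_A_mul_B (Ico_subset_Icc_self hc) hr.1 }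

end NakedSingularity

/-! ### Horizons and naked singularities -/

section Classification

variable {γ : ℝ → ℝ × ℝ} {J I : Set ℝ} {A B : ℝ → ℝ} {Q : ℝ × ℝ}

theorem IsMaximalSolution.exists_constraint_eq (h : IsMaximalSolution γ J)
    (hQ : GoesToPM γ J Q ∨ ComesFromPMbar γ J (-Q)) :
    ∃ c, |c| ≤ 1 ∧ Q = endpoint c ∧ ∀ ξ ∈ J, ∃ s ≠ 0,
      (γ ξ).1 ^ 2 + 2 * (γ ξ).1 * (γ ξ).2 = 1 + (1 - c ^ 2) / sinh s ^ 2 := by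
  wlog hQ' : GoesToPM γ J Q generalizing γ J
  · have hrefl : GoesToPM (reflection γ) (-J) Q :=
      neg_neg Q ▸ (hQ.resolve_left hQ').reflect
    obtain ⟨c, hc, hQc, hconstraint⟩ := this h.reflect (.inl hrefl) hrefl
    refine ⟨c, hc, hQc, fun ξ hξ => ?_⟩
    simpa [reflection] using hconstraint (-ξ) (by simpa using hξ)
  obtain ⟨a, c, hc, rfl, hγ, hQc⟩ := h.exists_orbit_of_goesToPM hQ'
  refine ⟨c, hc, hQc, fun ξ hξ => ?_⟩
  have hs : ξ - a ≠ 0 := sub_ne_zero.2 (mem_Ioi.1 hξ).ne'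
  exact ⟨ξ - a, hs, by rw [hγ ξ hξ, orbit_constraint c hs]⟩

theorem IsMaximalSolution.exists_isOrbitMetric_of_goesToPM (h : IsMaximalSolution γ J)
    (hd : Describes γ J I A B) (hQ : GoesToPM γ J Q) :
    ∃ k A₀ c, |c| ≤ 1 ∧ Q = endpoint c ∧ IsOrbitMetric k A₀ c I A B := by
  obtain ⟨a, c, hc, rfl, hγ, hQc⟩ := h.exists_orbit_of_goesToPM hQ
  obtain ⟨k, A₀, hmetric⟩ := hd.exists_isOrbitMetric hγ (abs_le.1 hc).2
  exact ⟨k, A₀, c, hc, hQc, hmetric⟩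

theorem IsMaximalSolution.exists_isOrbitMetric (h : IsMaximalSolution γ J)
    (hd : Describes γ J I A B) (hQ : GoesToPM γ J Q ∨ ComesFromPMbar γ J (-Q)) :
    ∃ k A₀ c, |c| ≤ 1 ∧ Q = endpoint c ∧ IsOrbitMetric k A₀ c I A B := by
  rcases hQ with hQ | hQ
  · exact h.exists_isOrbitMetric_of_goesToPM hd hQ
  · exact h.reflect.exists_isOrbitMetric_of_goesToPM hd.reflect (neg_neg Q ▸ hQ.reflect)

theorem IsMaximalSolution.constraint_eq_one {c : ℝ} (hc : c ^ 2 = 1) (h : IsMaximalSolution γ J)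
    (hQ : GoesToPM γ J (endpoint c) ∨ ComesFromPMbar γ J (-endpoint c)) :
    ∀ ξ ∈ J, (γ ξ).1 ^ 2 + 2 * (γ ξ).1 * (γ ξ).2 = 1 := by
  obtain ⟨c', -, hcc', hconstraint⟩ := h.exists_constraint_eq hQ
  obtain rfl := endpoint_injective hcc'
  intro ξ hξ
  obtain ⟨s, -, hs⟩ := hconstraint ξ hξ
  rw [hs, hc, sub_self, zero_div, add_zero]

theorem IsMaximalSolution.one_lt_constraint (h : IsMaximalSolution γ J)
    (hQ : (GoesToPM γ J Q ∧ Q ≠ PH ∧ Q ≠ PS) ∨ (ComesFromPMbar γ J Q ∧ Q ≠ PHbar ∧ Q ≠ PSbar)) :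
    ∀ ξ ∈ J, 1 < (γ ξ).1 ^ 2 + 2 * (γ ξ).1 * (γ ξ).2 := by
  wlog hQ' : GoesToPM γ J Q ∧ Q ≠ PH ∧ Q ≠ PS generalizing γ J Q
  · obtain ⟨hQ, hPH, hPS⟩ := hQ.resolve_left hQ'
    have hrefl : GoesToPM (reflection γ) (-J) (-Q) ∧ -Q ≠ PH ∧ -Q ≠ PS :=
      ⟨hQ.reflect, by rwa [ne_eq, neg_eq_iff_eq_neg, neg_PH],
        by rwa [ne_eq, neg_eq_iff_eq_neg, neg_PS]⟩
    intro ξ hξ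
    simpa [reflection] using this h.reflect (.inl hrefl) hrefl (-ξ) (by simpa using hξ)
  obtain ⟨hQ, hPH, hPS⟩ := hQ'
  obtain ⟨c, hc, rfl, hconstraint⟩ := h.exists_constraint_eq (.inl hQ)
  have hc₁ : c ≠ 1 := fun hc => hPH (hc ▸ endpoint_one)
  have hc₂ : c ≠ -1 := fun hc => hPS (hc ▸ endpoint_neg_one)
  have hc_sq : c ^ 2 < 1 :=
    ((sq_le_one_iff_abs_le_one c).2 hc).lt_of_ne fun h => (sq_eq_one_iff.1 h).elim hc₁ hc₂
  intro ξ hξ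
  obtain ⟨s, hs, hγ⟩ := hconstraint ξ hξ
  rw [hγ, lt_add_iff_pos_right]
  exact div_pos (sub_pos.2 hc_sq) (sq_pos_iff.2 (sinh_ne_zero_iff.2 hs))

theorem IsMaximalSolution.horizon (h : IsMaximalSolution γ J) (hd : Describes γ J I A B)
    (hQ : GoesToPM γ J PH ∨ ComesFromPMbar γ J PHbar) :
    (∀ ξ ∈ J, (γ ξ).1 ^ 2 + 2 * (γ ξ).1 * (γ ξ).2 = 1) ∧
      (∃ M > 0, IsSchwarzschild M I A B) ∧ IsHorizonExterior I A B ∧ IsAsymptoticallyFlat A B := by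
  rw [← neg_PH, ← endpoint_one] at hQ
  obtain ⟨k, A₀, c, hc, hQc, hmetric⟩ := h.exists_isOrbitMetric hd hQ
  obtain rfl := endpoint_injective hQc
  have hM := half_pos hmetric.pos_k
  have hS := hmetric.isSchwarzschild_of_one
  exact ⟨h.constraint_eq_one (one_pow 2) hQ, ⟨_, hM, hS⟩, hS.isHorizonExterior hM,
    hmetric.isAsymptoticallyFlat le_rfl⟩

theorem IsMaximalSolution.negative_mass (h : IsMaximalSolution γ J) (hd : Describes γ J I A B)
    (hQ : GoesToPM γ J PS ∨ ComesFromPMbar γ J PSbar) :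
    (∀ ξ ∈ J, (γ ξ).1 ^ 2 + 2 * (γ ξ).1 * (γ ξ).2 = 1) ∧ ∃ M < 0, IsSchwarzschild M I A B := by
  rw [← neg_PS, ← endpoint_neg_one] at hQ
  obtain ⟨k, A₀, c, hc, hQc, hmetric⟩ := h.exists_isOrbitMetric hd hQ
  obtain rfl := endpoint_injective hQc
  exact ⟨h.constraint_eq_one neg_one_sq hQ, _, neg_lt_zero.2 (half_pos hmetric.pos_k),
    hmetric.isSchwarzschild_of_neg_one⟩

theorem IsMaximalSolution.naked_singularity (h : IsMaximalSolution γ J) (hd : Describes γ J I A B)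
    (hQ : (GoesToPM γ J Q ∧ Q ≠ PH) ∨ (ComesFromPMbar γ J Q ∧ Q ≠ PHbar)) :
    IsNakedSingularity I A B ∧ HasPowerLaw A B (-2 * (1 + Q.2 / Q.1)) (2 * Q.2 / Q.1) := by
  wlog hQ' : GoesToPM γ J Q ∧ Q ≠ PH generalizing γ J Q
  · obtain ⟨hQ, hPH⟩ := hQ.resolve_left hQ'
    have hrefl : GoesToPM (reflection γ) (-J) (-Q) ∧ -Q ≠ PH :=
      ⟨hQ.reflect, by rwa [ne_eq, neg_eq_iff_eq_neg, neg_PH]⟩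
    simpa only [Prod.fst_neg, Prod.snd_neg, mul_neg, neg_div_neg_eq] using
      this h.reflect hd.reflect (.inl hrefl) hrefl
  obtain ⟨ψ, hs⟩ := h.exists_isScalarSpacetime hd
  obtain ⟨k, A₀, c, hc, rfl, hmetric⟩ := h.exists_isOrbitMetric hd (.inl hQ'.1)
  have hc₁ : c ≠ 1 := fun hc => hQ'.2 (hc ▸ endpoint_one)
  have hc_lt : c < 1 := (abs_le.1 hc).2.lt_of_ne hc₁
  exact ⟨hmetric.isNakedSingularity ⟨(abs_le.1 hc).1, hc_lt⟩ hs, hmetric.hasPowerLaw hc_lt⟩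

end Classification

end StaticScalar

end

open StaticScalar in
theorem mainTheorem3 :
    -- reduction of the field equations to the planar system
    (∀ (I : Set ℝ) (A H r ψ : ℝ → ℝ), IsScalarSpacetime I A H r ψ → ∀ ρ ∈ I,
      DifferentiableAt ℝ (x₂ H r) ρ ∧ DifferentiableAt ℝ (x₃ A H r) ρ ∧
      (normDeriv H r (x₂ H r) ρ, normDeriv H r (x₃ A H r) ρ) = field (x₂ H r ρ, x₃ A H r ρ) ∧
      y₁ H r ψ ρ ^ 2 = x₂ H r ρ ^ 2 + 2 * x₂ H r ρ * x₃ A H r ρ - 1 ∧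
      (x₂ H r ρ, x₃ A H r ρ) ∈ phaseSpace) ∧
    -- every point of the phase space lies on a maximal solution, every solution describes a
    -- spacetime, and every such spacetime solves the field equations
    (∀ x ∈ phaseSpace, ∃ γ J, IsMaximalSolution γ J ∧ (0 : ℝ) ∈ J ∧ γ 0 = x) ∧
    (∀ γ J, IsMaximalSolution γ J → ∃ I A B, Describes γ J I A B) ∧
    (∀ γ J I A B, IsMaximalSolution γ J → Describes γ J I A B →
      ∃ ψ, IsScalarSpacetime I A (fun r => 1 / B r) id ψ) ∧
    -- the fixed points: a sink and a source, both Minkowski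
    {x | x ∈ phaseSpace ∧ field x = 0} = {PM, PMbar} ∧
    (∀ μ : ℝ, Module.End.HasEigenvalue
      ((fderiv ℝ field PM : ℝ × ℝ →L[ℝ] ℝ × ℝ) : Module.End ℝ (ℝ × ℝ)) μ ↔ μ = -2 ∨ μ = -1) ∧
    (∀ μ : ℝ, Module.End.HasEigenvalue
      ((fderiv ℝ field PMbar : ℝ × ℝ →L[ℝ] ℝ × ℝ) : Module.End ℝ (ℝ × ℝ)) μ ↔ μ = 2 ∨ μ = 1) ∧
    IsAsymptoticallyStable field univ PM ∧
    IsAsymptoticallyStable (fun x => -field x) univ PMbar ∧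
    (∀ γ J I A B, IsMaximalSolution γ J → Describes γ J I A B →
      (∀ ξ ∈ J, γ ξ = PM) ∨ (∀ ξ ∈ J, γ ξ = PMbar) → IsMinkowski I A B) ∧
    -- the Poincaré compactification
    BijOn toPoincare phaseSpace (poincareSpace \ atInfinity) ∧
    (∀ x, HasFDerivAt toPoincare (fderiv ℝ toPoincare x) x ∧
      √(1 - (toPoincare x).1 ^ 2 - (toPoincare x).2 ^ 2) • fderiv ℝ toPoincare x (field x)
        = poincareField (toPoincare x)) ∧
    -- the points at infinity: two arcs of critical points, and the stability of their end points
    (∀ X ∈ atInfinity, poincareField X = 0) ∧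
    atInfinity = rightArc ∪ leftArc ∧ Disjoint rightArc leftArc ∧
    {X | X ∈ atInfinity ∧ 2 * X.1 ^ 2 + 2 * X.1 * X.2 + X.2 ^ 2 = 1} = {PH, PHbar, PS, PSbar} ∧
    PH ∈ rightArc ∧ PS ∈ rightArc ∧ PHbar ∈ leftArc ∧ PSbar ∈ leftArc ∧
    ¬ IsStable poincareField poincareSpace PH ∧
    IsStable poincareField poincareSpace PHbar ∧
    ¬ IsStable poincareField poincareSpace PS ∧
    IsStable poincareField poincareSpace PSbar ∧
    -- all maximal solutions
    (∀ γ J, IsMaximalSolution γ J →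
      (J = univ ∧ ∀ ξ, γ ξ = PM) ∨ (J = univ ∧ ∀ ξ, γ ξ = PMbar) ∨
      (∃ Q ∈ rightArc, GoesToPM γ J Q) ∨ (∃ Q ∈ leftArc, ComesFromPMbar γ J Q)) ∧
    -- exactly one orbit comes from (goes to) each point at infinity
    (∀ Q ∈ rightArc, ∃! O : Set (ℝ × ℝ), ∃ γ J, IsMaximalSolution γ J ∧ GoesToPM γ J Q ∧
      O = γ '' J) ∧
    (∀ Q ∈ leftArc, ∃! O : Set (ℝ × ℝ), ∃ γ J, IsMaximalSolution γ J ∧ ComesFromPMbar γ J Q ∧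
      O = γ '' J) ∧
    -- the horizons: the Schwarzschild solution
    (∀ γ J I A B, IsMaximalSolution γ J → Describes γ J I A B →
      GoesToPM γ J PH ∨ ComesFromPMbar γ J PHbar →
      (∀ ξ ∈ J, (γ ξ).1 ^ 2 + 2 * (γ ξ).1 * (γ ξ).2 = 1) ∧
      (∃ M > 0, IsSchwarzschild M I A B) ∧ IsHorizonExterior I A B ∧ IsAsymptoticallyFlat A B) ∧
    -- all other points at infinity: naked singularities
    (∀ γ J I A B Q, IsMaximalSolution γ J → Describes γ J I A B →
      (GoesToPM γ J Q ∧ Q ∈ rightArc ∧ Q ≠ PH) ∨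
        (ComesFromPMbar γ J Q ∧ Q ∈ leftArc ∧ Q ≠ PHbar) →
      IsNakedSingularity I A B ∧ HasPowerLaw A B (-2 * (1 + Q.2 / Q.1)) (2 * Q.2 / Q.1)) ∧
    -- the points `P_S`, `P̄_S`: the Schwarzschild solution of negative mass; in all remaining cases
    -- the scalar field is not constant
    (∀ γ J I A B, IsMaximalSolution γ J → Describes γ J I A B →
      GoesToPM γ J PS ∨ ComesFromPMbar γ J PSbar →
      (∀ ξ ∈ J, (γ ξ).1 ^ 2 + 2 * (γ ξ).1 * (γ ξ).2 = 1) ∧ ∃ M < 0, IsSchwarzschild M I A B) ∧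
    (∀ γ J Q, IsMaximalSolution γ J →
      (GoesToPM γ J Q ∧ Q ≠ PH ∧ Q ≠ PS) ∨ (ComesFromPMbar γ J Q ∧ Q ≠ PHbar ∧ Q ≠ PSbar) →
      ∀ ξ ∈ J, 1 < (γ ξ).1 ^ 2 + 2 * (γ ξ).1 * (γ ξ).2) := by
  exact ⟨fun _ _ _ _ _ h _ => h.reduction, fun _ => exists_isMaximalSolution,
    fun _ _ => IsMaximalSolution.exists_describes,
    fun _ _ _ _ _ => IsMaximalSolution.exists_isScalarSpacetime,
    fixedPoints_eq, hasEigenvalue_fderiv_field_PM, hasEigenvalue_fderiv_field_PMbar,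
    isAsymptoticallyStable_PM, isAsymptoticallyStable_PMbar,
    fun _ _ _ _ _ => IsMaximalSolution.isMinkowski, bijOn_toPoincare,
    fun x => ⟨(hasFDerivAt_toPoincare x).differentiableAt.hasFDerivAt, fderiv_toPoincare_field x⟩,
    fun _ => poincareField_eq_zero, atInfinity_eq, disjoint_rightArc_leftArc, atInfinity_boundary,
    PH_mem_rightArc, PS_mem_rightArc, PHbar_mem_leftArc, PSbar_mem_leftArc,
    not_isStable_PH, isStable_PHbar, not_isStable_PS, isStable_PSbar,
    fun _ _ => IsMaximalSolution.eq_PM_or_eq_PMbar_or_goesToPM_or_comesFromPMbar,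
    fun _ => existsUnique_orbit_goesToPM, fun _ => existsUnique_orbit_comesFromPMbar,
    fun _ _ _ _ _ => IsMaximalSolution.horizon,
    fun _ _ _ _ _ _ h hd hQ => h.naked_singularity hd
      (hQ.imp (And.imp_right And.right) (And.imp_right And.right)),
    fun _ _ _ _ _ => IsMaximalSolution.negative_mass,
    fun _ _ _ => IsMaximalSolution.one_lt_constraint⟩
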